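/- Setting. Let $\pi\colon E\to M$ be a smooth fibre bundle, $\dim M=m$, $\dim E=m+n$, where $M$ and $E$ are Hausdorff, second countable $C^\infty$ manifolds without boundary and $M$ is connected; let $\omega$ be a volume form on $M$, and orient $M$ by $\omega$. $\Gamma(M,\cdot)$ denotes smooth global sections. Let $\pi^1\colon J^1\pi\to E$ be the first jet bundle: its points over $y\in E$ are the linear maps $\gamma\colon T_{\pi(y)}M\to T_yE$ with $T_y\pi\circ\gamma=\mathrm{id}$. Let $\mathcal L=\pounds\,\omega$ with $\pounds\in C^\infty(J^1\pi)$ be a Lagrangian density, with Poincaré–Cartan form $\Theta_{\mathcal L}=i(\mathcal V)\mathcal L+\mathcal L\in\Omega^m(J^1\pi)$, where $\mathcal V$ is the vertical endomorphism; in coordinates $(x^\nu,y^A,v^A_\nu)$ with $\omega=d^mx$ and $d^{m-1}x_\nu=i(\partial/\partial x^\nu)d^mx$, $$\Theta_{\mathcal L}=\frac{\partial\pounds}{\partial v^A_\nu}\,dy^A\wedge d^{m-1}x_\nu-\Big(\frac{\partial\pounds}{\partial v^A_\nu}v^A_\nu-\pounds\Big)d^mx .$$ Let $\mathcal M\pi=\Lambda^m_2T^*E$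 be the bundle of $m$-forms on $E$ that vanish by the action of two $\pi$-vertical vectors, with projection $\kappa\colon\mathcal M\pi\to E$ and tautological $m$-form $\Theta_\alpha(X_1,\dots,X_m)=\alpha(T\kappa X_1,\dots,T\kappa X_m)$. Let $J^1\pi^*=\mathcal M\pi/\pi^*\Lambda^mT^*M$, with projections $\mu\colon\mathcal M\pi\to J^1\pi^*$, $\tau\colon J^1\pi^*\to E$ and $\bar\tau=\pi\circ\tau$. The extended Legendre map $\widetilde{\mathcal{FL}}\colon J^1\pi\to\mathcal M\pi$ is given by $\widetilde{\mathcal{FL}}(\bar y)(Z_1,\dots,Z_m)=(\Theta_{\mathcal L})_{\bar y}(\bar Z_1,\dots,\bar Z_m)$ for any $\bar Z_i\in T_{\bar y}J^1\pi$ with $T\pi^1\bar Z_i=Z_i$, and the Legendre map is $\mathcal{FL}=\mu\circ\widetilde{\mathcal{FL}}\colon J^1\pi\to J^1\pi^*$. Assume that the Lagrangian system is hyper-regular, i.e. that $\mathcal{FL}$ is a global diffeomorphism. The associated Hamiltonian system is given by the section $h=\widetilde{\mathcal{FL}}\circ\mathcal{FL}^{-1}$ of $\mu$, with $\Theta_h=h^*\Theta$.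 A section $\phi\in\Gamma(M,E)$ is a solution of the Hamilton principle if $\int_M(j^1\phi)^*\Theta_{\mathcal L}$ converges (absolutely) and, for every compactly supported $\pi$-vertical smooth vector field on $E$ with one-parameter group $\{\sigma_t\}$, the derivative $\frac{d}{dt}\big|_{t=0}\int_M\big(j^1(\sigma_t\circ\phi)\big)^*\Theta_{\mathcal L}$ exists and is $0$. A section $\psi\in\Gamma(M,J^1\pi^*)$ of $\bar\tau$ is a solution of the Hamilton–Jacobi principle if $\int_M\psi^*\Theta_h$ converges (absolutely) and, for every compactly supported $\bar\tau$-vertical smooth vector field on $J^1\pi^*$ with one-parameter group $\{\sigma_t\}$, the derivative $\frac{d}{dt}\big|_{t=0}\int_M(\sigma_t\circ\psi)^*\Theta_h$ exists and is $0$. Theorem (equivalence theorem for sections). If $\phi\in\Gamma(M,E)$ is a solution of the Hamilton principle, then $\psi=\mathcal{FL}\circ j^1\phi$ is a section in $\Gamma(M,J^1\pi^*)$ and is a solution of the Hamilton–Jacobi principle. Conversely, if $\psi\in\Gamma(M,J^1\pi^*)$ is a solution of the Hamilton–Jacobi principle, then $\phi=\tau\circ\psi$ is a section in $\Gamma(M,E)$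 and is a solution of the Hamilton principle. -/

import Mathlib

open scoped Manifold ContDiff Topology

set_option linter.unusedSectionVars false

noncomputable section

namespace FieldTheory

/-- `ℝᵏ`. -/
abbrev X (k : ℕ) : Type := EuclideanSpace ℝ (Fin k)

/-- The standard basis of `ℝᵏ`. -/
abbrev stdB {k : ℕ} (i : Fin k) : X k := EuclideanSpace.single i (1 : ℝ)

section Alternating

variable {m : ℕ} {U V : Type*}
  [TopologicalSpace U] [AddCommGroup U] [Module ℝ U] [IsTopologicalAddGroup U]
  [ContinuousSMul ℝ U]
  [TopologicalSpace V] [AddCommGroup V] [Module ℝ V] [IsTopologicalAddGroup V]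
  [ContinuousSMul ℝ V]

/-- `(v_1, …, v_m) ↦ ∑_i α(P v_1, …, K v_i, …, P v_m)`, as a multilinear map. -/
def insertMul (α : V [⋀^Fin m]→L[ℝ] ℝ) (P K : U →L[ℝ] V) :
    ContinuousMultilinearMap ℝ (fun _ : Fin m => U) ℝ :=
  ∑ i : Fin m, α.toContinuousMultilinearMap.compContinuousLinearMap
    (fun j => if j = i then K else P)

theorem insertMul_apply (α : V [⋀^Fin m]→L[ℝ] ℝ) (P K : U →L[ℝ] V) (v : Fin m → U) :
    insertMul α P K v = ∑ i : Fin m, α (Function.update (fun j => P (v j)) i (K (v i))) := by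
  simp only [insertMul, sum_apply,
    ContinuousMultilinearMap.compContinuousLinearMap_apply]
  refine Finset.sum_congr rfl fun i _ => ?_
  change α _ = α _
  congr 1
  funext j
  by_cases h : j = i
  · subst h; simp
  · simp [h]

/-- The form `v ↦ ∑_i α(P v_1, …, K v_i, …, P v_m)`; for `K = ∑_μ θ^μ ⊗ e_μ` this is
`∑_μ θ^μ ∧ P^*(i(e_μ) α)`. -/
def insertForm (α : V [⋀^Fin m]→L[ℝ] ℝ) (P K : U →L[ℝ] V) : U [⋀^Fin m]→L[ℝ] ℝ :=
  { insertMul α P K with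
    map_eq_zero_of_eq' := by
      intro v i j hv hij
      change insertMul α P K v = 0
      rw [insertMul_apply]
      rw [← Finset.sum_subset (Finset.subset_univ {i, j})]
      · rw [Finset.sum_pair hij]
        have h : Function.update (fun l => P (v l)) j (K (v j))
            = Function.update (fun l => P (v l)) i (K (v i)) ∘ Equiv.swap i j := by
          funext l
          by_cases hli : l = i
          · subst hli
            simp [Function.update_of_ne hij, Function.update_of_ne hij.symm, hv]
          · by_cases hlj : l = j
            · subst hlj
              simp [hv]
            · simp [Equiv.swap_apply_of_ne_of_ne hli hlj, Function.update_of_ne hli,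
                Function.update_of_ne hlj]
        rw [h]
        have := α.toAlternatingMap.map_swap
          (Function.update (fun l => P (v l)) i (K (v i))) hij
        simp only [ContinuousAlternatingMap.coe_toAlternatingMap] at this
        rw [this]; ring
      · intro l _ hl
        simp only [Finset.mem_insert, Finset.mem_singleton, not_or] at hl
        refine α.map_eq_zero_of_eq _ (i := i) (j := j) ?_ hij
        rw [Function.update_of_ne (Ne.symm hl.1), Function.update_of_ne (Ne.symm hl.2), hv] }

theorem insertForm_apply (α : V [⋀^Fin m]→L[ℝ] ℝ) (P K : U →L[ℝ] V) (v : Fin m → U) :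
    insertForm α P K v = ∑ i : Fin m, α (Function.update (fun j => P (v j)) i (K (v i))) :=
  insertMul_apply α P K v

/-- The forms on `U` that vanish whenever two arguments at different places lie in `ker P`. -/
def twoSemibasic (m : ℕ) (P : U →L[ℝ] V) : Submodule ℝ (U [⋀^Fin m]→L[ℝ] ℝ) where
  carrier := {α | ∀ v : Fin m → U, ∀ i j, i ≠ j → P (v i) = 0 → P (v j) = 0 → α v = 0}
  add_mem' := by
    intro a b ha hb v i j hij hi hj
    rw [ContinuousAlternatingMap.add_apply, ha v i j hij hi hj, hb v i j hij hi hj, add_zero]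
  zero_mem' := by intro v i j _ _ _; rfl
  smul_mem' := by
    intro c a ha v i j hij hi hj
    rw [ContinuousAlternatingMap.smul_apply, ha v i j hij hi hj, smul_zero]

theorem insertForm_mem (α : V [⋀^Fin m]→L[ℝ] ℝ) (P K : U →L[ℝ] V) :
    insertForm α P K ∈ twoSemibasic m P := by
  intro v i j hij hi hj
  rw [insertForm_apply]
  refine Finset.sum_eq_zero fun l _ => ?_
  by_cases hl : i = l
  · refine α.map_coord_zero j ?_
    rw [Function.update_of_ne (by rw [← hl]; exact hij.symm)]; exact hj
  · refine α.map_coord_zero i ?_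
    rw [Function.update_of_ne hl]; exact hi

theorem comp_mem (β : V [⋀^Fin m]→L[ℝ] ℝ) (P : U →L[ℝ] V) :
    β.compContinuousLinearMap P ∈ twoSemibasic m P := by
  intro v i j _ hi _
  exact β.map_coord_zero i hi

/-- Two such forms are equivalent when they differ by a pull-back `P^* β`. -/
def basicSetoid (m : ℕ) (P : U →L[ℝ] V) : Setoid (twoSemibasic m P) where
  r α α' := ∃ β : V [⋀^Fin m]→L[ℝ] ℝ, α.1 = α'.1 + β.compContinuousLinearMap P
  iseqv :=
    { refl := fun α => ⟨0, (add_zero α.1).symm⟩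
      symm := by
        rintro α α' ⟨β, h⟩
        refine ⟨-β, ?_⟩
        rw [h, add_assoc]
        exact ((congrArg (α'.1 + ·) (add_neg_cancel (β.compContinuousLinearMap P))).trans
          (add_zero _)).symm
      trans := by
        rintro α α' α'' ⟨β, h⟩ ⟨β', h'⟩
        refine ⟨β' + β, ?_⟩
        rw [h, h', add_assoc]
        rfl }

end Alternating

section Model

variable {m n : ℕ}

/-- The standard volume form `dx¹ ∧ ⋯ ∧ dxᵐ` of `ℝᵐ`. -/
def stdVol (m : ℕ) : X m [⋀^Fin m]→L[ℝ] ℝ :=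
  { (Matrix.detRowAlternating (n := Fin m) (R := ℝ)).compLinearMap
      (EuclideanSpace.equiv (Fin m) ℝ).toLinearMap with
    cont := by
      change Continuous fun v : Fin m → X m => Matrix.det (fun i j => v i j)
      refine Continuous.matrix_det ?_
      refine continuous_matrix fun i j => ?_
      fun_prop }

theorem stdVol_apply (v : Fin m → X m) : stdVol m v = Matrix.det (fun i j => v i j) := rfl

theorem stdVol_std : stdVol m (fun i => stdB i) = 1 := by
  rw [stdVol_apply]
  have : (fun i j => (stdB i : X m) j) = (1 : Matrix (Fin m) (Fin m) ℝ) := by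
    funext i j
    simp [Matrix.one_apply, Pi.single_apply, eq_comm]
  rw [this, Matrix.det_one]

/-- The linear map `(x, y) ↦ ∑_ν p^ν(y) ∂_ν`. -/
def momMap (p : Fin m → (X n →L[ℝ] ℝ)) : (X m × X n) →L[ℝ] X m :=
  ∑ ν : Fin m, ((p ν).comp (ContinuousLinearMap.snd ℝ (X m) (X n))).smulRight (stdB ν)

theorem momMap_apply (p : Fin m → (X n →L[ℝ] ℝ)) (z : X m × X n) :
    momMap p z = ∑ ν, p ν z.2 • stdB ν := by
  simp [momMap, sum_apply]

/-- The projection `(x, y) ↦ x`. -/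
abbrev fstL (m n : ℕ) : (X m × X n) →L[ℝ] X m := ContinuousLinearMap.fst ℝ (X m) (X n)

/-- The form `p^ν_A dy^A ∧ d^{m-1}x_ν + p₀ dᵐx`. -/
def modelForm (p : Fin m → (X n →L[ℝ] ℝ)) (p₀ : ℝ) : (X m × X n) [⋀^Fin m]→L[ℝ] ℝ :=
  insertForm (stdVol m) (fstL m n) (momMap p)
    + p₀ • (stdVol m).compContinuousLinearMap (fstL m n)

theorem modelForm_apply (p : Fin m → (X n →L[ℝ] ℝ)) (p₀ : ℝ) (v : Fin m → X m × X n) :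
    modelForm p p₀ v = (∑ i, stdVol m (Function.update (fun j => (v j).1) i
      (∑ ν, p ν (v i).2 • stdB ν))) + p₀ * stdVol m (fun j => (v j).1) := by
  rw [modelForm, ContinuousAlternatingMap.add_apply, insertForm_apply]
  simp only [momMap_apply]
  rfl

theorem modelForm_mem (p : Fin m → (X n →L[ℝ] ℝ)) (p₀ : ℝ) :
    modelForm p p₀ ∈ twoSemibasic m (fstL m n) :=
  Submodule.add_mem _ (insertForm_mem _ _ _) (Submodule.smul_mem _ _ (comp_mem _ _))

/-- The arguments `(∂_1, …, w, …, ∂_m)` with the vertical vector `w` in place `ν`. -/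
def hvArgs (ν : Fin m) (w : X n) : Fin m → X m × X n :=
  Function.update (fun i => (stdB i, 0)) ν (0, w)

/-- The momenta `p^ν_A = α(∂_1, …, ∂/∂y^A, …, ∂_m)` of a form (`∂/∂y^A` in place `ν`). -/
def formMom (α : (X m × X n) [⋀^Fin m]→L[ℝ] ℝ) (ν : Fin m) : X n →L[ℝ] ℝ :=
  (α.toContinuousLinearMap (fun i => (stdB i, 0)) ν).comp (ContinuousLinearMap.inr ℝ (X m) (X n))

theorem formMom_apply (α : (X m × X n) [⋀^Fin m]→L[ℝ] ℝ) (ν : Fin m) (w : X n) :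
    formMom α ν w = α (hvArgs ν w) := rfl

/-- The last coordinate `p = α(∂_1, …, ∂_m)`. -/
def formEnergy (α : (X m × X n) [⋀^Fin m]→L[ℝ] ℝ) : ℝ := α (fun i => (stdB i, 0))

theorem formMom_modelForm (p : Fin m → (X n →L[ℝ] ℝ)) (p₀ : ℝ) :
    formMom (modelForm p p₀) = p := by
  funext ν
  ext w
  rw [formMom_apply, modelForm_apply]
  have hν : (hvArgs ν w ν : X m × X n) = (0, w) := by simp [hvArgs]
  have h0 : stdVol m (fun j => (hvArgs ν w j : X m × X n).1) = 0 :=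
    (stdVol m).map_coord_zero ν (by rw [hν])
  rw [h0, mul_zero, add_zero, Finset.sum_eq_single ν]
  · rw [hν]
    have hup : ∀ z : X m, Function.update (fun j => (hvArgs ν w j : X m × X n).1) ν z
        = Function.update (fun j => (stdB j : X m)) ν z := by
      intro z
      funext j
      by_cases hj : j = ν
      · subst hj; simp
      · simp [hvArgs, hj]
    rw [hup]
    have h := (stdVol m).toMultilinearMap.map_update_sum Finset.univ ν
      (fun μ => p μ w • (stdB μ : X m)) (fun j => (stdB j : X m))
    change stdVol m _ = ∑ μ, stdVol m _ at h
    refine h.trans ?_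
    rw [Finset.sum_eq_single ν]
    · rw [ContinuousAlternatingMap.map_update_smul, Function.update_eq_self, stdVol_std]
      simp
    · intro μ _ hμ
      rw [ContinuousAlternatingMap.map_update_smul]
      rw [(stdVol m).map_eq_zero_of_eq _ (i := ν) (j := μ) (by simp [hμ]) hμ.symm, smul_zero]
    · simp
  · intro i _ hi
    refine (stdVol m).map_coord_zero ν ?_
    rw [Function.update_of_ne hi.symm, hν]
  · simp

theorem formEnergy_modelForm (p : Fin m → (X n →L[ℝ] ℝ)) (p₀ : ℝ) :
    formEnergy (modelForm p p₀) = p₀ := by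
  rw [formEnergy, modelForm_apply]
  have : ∀ i : Fin m, stdVol m (Function.update (fun j => (stdB j : X m)) i
      (∑ ν, p ν (0 : X n) • stdB ν)) = 0 := fun i =>
    (stdVol m).map_coord_zero i (by simp)
  simp only [this, stdVol_std]
  simp

theorem eq_zero_of_coords {α : (X m × X n) [⋀^Fin m]→L[ℝ] ℝ}
    (hα : α ∈ twoSemibasic m (fstL m n)) (h1 : formMom α = 0) (h0 : formEnergy α = 0) :
    α = 0 := by
  apply ContinuousAlternatingMap.toAlternatingMap_injective
  refine Module.Basis.ext_alternating
    ((EuclideanSpace.basisFun (Fin m) ℝ).toBasis.prod (EuclideanSpace.basisFun (Fin n) ℝ).toBasis)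
    fun f hf => ?_
  change α _ = 0
  set b := (EuclideanSpace.basisFun (Fin m) ℝ).toBasis.prod
    (EuclideanSpace.basisFun (Fin n) ℝ).toBasis with hb
  have hl : ∀ i : Fin m, b (Sum.inl i) = ((stdB i : X m), (0 : X n)) := fun i => by
    apply Prod.ext <;> simp [hb]
  have hr : ∀ A : Fin n, b (Sum.inr A) = ((0 : X m), (stdB A : X n)) := fun A => by
    apply Prod.ext <;> simp [hb]
  have hperm : ∀ (v : Fin m → X m × X n) (σ : Equiv.Perm (Fin m)), α v = 0 → α (v ∘ σ) = 0 := by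
    intro v σ hv
    have := α.toAlternatingMap.map_perm v σ
    rw [ContinuousAlternatingMap.coe_toAlternatingMap, hv, smul_zero] at this
    exact this
  by_cases hall : ∀ i, ∃ j, f i = Sum.inl j
  · choose g hg using hall
    have hgi : Function.Injective g := fun i j hij => hf (by rw [hg, hg, hij])
    let σ : Equiv.Perm (Fin m) := Equiv.ofBijective g (Finite.injective_iff_bijective.mp hgi)
    have := hperm (fun i => (stdB i, 0)) σ h0
    convert this using 2
    funext i
    rw [hg, hl]; rfl
  · push Not at hall
    obtain ⟨i₀, hi₀⟩ := hall
    obtain ⟨A, hA⟩ : ∃ A, f i₀ = Sum.inr A := by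
      rcases h : f i₀ with j | A
      · exact absurd h (hi₀ j)
      · exact ⟨A, rfl⟩
    by_cases hex : ∃ i₁, i₁ ≠ i₀ ∧ ∃ A', f i₁ = Sum.inr A'
    · obtain ⟨i₁, hne, A', hA'⟩ := hex
      exact hα _ i₁ i₀ hne (by simp only [hA', hr]; rfl) (by simp only [hA, hr]; rfl)
    · push Not at hex
      have hall' : ∀ i, ∃ j, i ≠ i₀ → f i = Sum.inl j := by
        intro i
        by_cases hi : i = i₀
        · exact ⟨i₀, fun h => absurd hi h⟩
        · rcases h : f i with j | A'
          · exact ⟨j, fun _ => rfl⟩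
          · exact absurd h (hex i hi A')
      choose g hg using hall'
      obtain ⟨ν, hν⟩ : ∃ ν, ∀ i, i ≠ i₀ → g i ≠ ν := by
        by_contra hcon
        push Not at hcon
        have hsurj : (Finset.univ.erase i₀).image g = Finset.univ := by
          apply Finset.eq_univ_of_forall
          intro ν
          obtain ⟨i, hi, hi'⟩ := hcon ν
          exact Finset.mem_image.mpr ⟨i, by simp [hi], hi'⟩
        have h1 := Finset.card_image_le (s := Finset.univ.erase i₀) (f := g)
        rw [hsurj, Finset.card_erase_of_mem (Finset.mem_univ _)] at h1
        have h2 : 0 < (Finset.univ : Finset (Fin m)).card := Finset.card_pos.mpr ⟨i₀, Finset.mem_univ _⟩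
        omega
      have hgi : Function.Injective (Function.update g i₀ ν) := by
        intro i j hij
        by_cases hi : i = i₀ <;> by_cases hj : j = i₀
        · rw [hi, hj]
        · subst hi
          rw [Function.update_self, Function.update_of_ne hj] at hij
          exact absurd hij.symm (hν j hj)
        · subst hj
          rw [Function.update_self, Function.update_of_ne hi] at hij
          exact absurd hij (hν i hi)
        · rw [Function.update_of_ne hi, Function.update_of_ne hj] at hij
          exact hf (by rw [hg i hi, hg j hj, hij])
      let σ : Equiv.Perm (Fin m) :=
        Equiv.ofBijective _ (Finite.injective_iff_bijective.mp hgi)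
      have hz : α (hvArgs ν (stdB A)) = 0 := by
        rw [← formMom_apply, h1]; rfl
      have := hperm _ σ hz
      convert this using 2
      funext i
      by_cases hi : i = i₀
      · subst hi
        rw [hA, hr]
        simp [σ, hvArgs]
      · rw [hg i hi, hl]
        simp [σ, hvArgs, Function.update_of_ne hi, Function.update_of_ne (hν i hi)]

theorem modelForm_coords {α : (X m × X n) [⋀^Fin m]→L[ℝ] ℝ}
    (hα : α ∈ twoSemibasic m (fstL m n)) : modelForm (formMom α) (formEnergy α) = α := by
  have h := eq_zero_of_coords (α := modelForm (formMom α) (formEnergy α) - α)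
    (Submodule.sub_mem _ (modelForm_mem _ _) hα)
    (by
      funext ν; ext w
      have := congrFun (formMom_modelForm (formMom α) (formEnergy α)) ν
      have := congrArg (fun L => L w) this
      simp only [formMom_apply] at this ⊢
      rw [ContinuousAlternatingMap.sub_apply, this]
      exact sub_self _)
    (by
      have := formEnergy_modelForm (formMom α) (formEnergy α)
      unfold formEnergy at this ⊢
      rw [ContinuousAlternatingMap.sub_apply, this, sub_self])
  exact sub_eq_zero.mp h

end Model

/-- A smooth fibre bundle `π : E → M` with typical fibre `F`, `dim M = m`, `dim E = m + n`. -/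
structure ConfigBundle (m n : ℕ) (M E F : Type*)
    [TopologicalSpace M] [ChartedSpace (X m) M]
    [TopologicalSpace E] [ChartedSpace (X m × X n) E]
    [TopologicalSpace F] [ChartedSpace (X n) F] where
  proj : E → M
  exists_trivialization : ∀ x : M, ∃ t : Bundle.Trivialization F proj, x ∈ t.baseSet ∧
    ContMDiffOn 𝓘(ℝ, X m × X n) (𝓘(ℝ, X m).prod 𝓘(ℝ, X n)) ∞ t t.source ∧
    ContMDiffOn (𝓘(ℝ, X m).prod 𝓘(ℝ, X n)) 𝓘(ℝ, X m × X n) ∞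
      t.toOpenPartialHomeomorph.symm t.target

section Bundle

variable {m n : ℕ} {M E F : Type*}
  [TopologicalSpace M] [ChartedSpace (X m) M]
  [TopologicalSpace E] [ChartedSpace (X m × X n) E]
  [TopologicalSpace F] [ChartedSpace (X n) F]

/-- Adapted (fibred) charts: a smooth chart `e = (x, y)` of `E` and a smooth chart `c` of `M`
with `x = c ∘ π`. -/
structure AdaptedChart (B : ConfigBundle m n M E F) where
  e : OpenPartialHomeomorph E (X m × X n)
  c : OpenPartialHomeomorph M (X m)
  e_smooth : ContMDiffOn 𝓘(ℝ, X m × X n) 𝓘(ℝ, X m × X n) ∞ e e.source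
  e_symm_smooth : ContMDiffOn 𝓘(ℝ, X m × X n) 𝓘(ℝ, X m × X n) ∞ e.symm e.target
  c_smooth : ContMDiffOn 𝓘(ℝ, X m) 𝓘(ℝ, X m) ∞ c c.source
  c_symm_smooth : ContMDiffOn 𝓘(ℝ, X m) 𝓘(ℝ, X m) ∞ c.symm c.target
  mapsTo : ∀ y ∈ e.source, B.proj y ∈ c.source
  fst_e : ∀ y ∈ e.source, (e y).1 = c (B.proj y)

theorem ConfigBundle.contMDiff_proj (B : ConfigBundle m n M E F) :
    ContMDiff 𝓘(ℝ, X m × X n) 𝓘(ℝ, X m) ∞ B.proj := by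
  intro y
  obtain ⟨t, hx, ht, -⟩ := B.exists_trivialization (B.proj y)
  have hy : y ∈ t.source := t.mem_source.mpr hx
  have h1 : ContMDiffAt 𝓘(ℝ, X m × X n) (𝓘(ℝ, X m).prod 𝓘(ℝ, X n)) ∞ t y :=
    ht.contMDiffAt (t.open_source.mem_nhds hy)
  have h2 := contMDiffAt_fst.comp y h1
  refine h2.congr_of_eventuallyEq ?_
  filter_upwards [t.open_source.mem_nhds hy] with z hz
  exact (t.proj_toFun z hz).symm

theorem ConfigBundle.mdifferentiable_proj (B : ConfigBundle m n M E F) (y : E) :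
    MDifferentiableAt 𝓘(ℝ, X m × X n) 𝓘(ℝ, X m) B.proj y :=
  (B.contMDiff_proj y).mdifferentiableAt (by simp)

theorem ConfigBundle.exists_adaptedChart [IsManifold 𝓘(ℝ, X m) ∞ M] [IsManifold 𝓘(ℝ, X n) ∞ F]
    (B : ConfigBundle m n M E F) (y : E) : ∃ a : AdaptedChart B, y ∈ a.e.source := by
  obtain ⟨t, hx, ht, ht'⟩ := B.exists_trivialization (B.proj y)
  have hy : y ∈ t.source := t.mem_source.mpr hx
  set c := chartAt (X m) (B.proj y) with hc
  set f := chartAt (X n) (t y).2 with hf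
  have hcs : ContMDiffOn 𝓘(ℝ, X m) 𝓘(ℝ, X m) ∞ c c.source := contMDiffOn_chart
  have hcs' : ContMDiffOn 𝓘(ℝ, X m) 𝓘(ℝ, X m) ∞ c.symm c.target := contMDiffOn_chart_symm
  have hfs : ContMDiffOn 𝓘(ℝ, X n) 𝓘(ℝ, X n) ∞ f f.source := contMDiffOn_chart
  have hfs' : ContMDiffOn 𝓘(ℝ, X n) 𝓘(ℝ, X n) ∞ f.symm f.target := contMDiffOn_chart_symm
  let e : OpenPartialHomeomorph E (X m × X n) := t.toOpenPartialHomeomorph.trans (c.prod f)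
  have hsrc : ∀ z, z ∈ e.source ↔ z ∈ t.source ∧ (t z).1 ∈ c.source ∧ (t z).2 ∈ f.source := by
    intro z
    simp [e]
  have htgt : ∀ u, u ∈ e.target ↔ (u.1 ∈ c.target ∧ u.2 ∈ f.target) ∧
      (c.symm u.1, f.symm u.2) ∈ t.target := by
    intro u
    simp [e]
  refine ⟨⟨e, c, ?_, ?_, hcs, hcs', ?_, ?_⟩, ?_⟩
  · have h1 : ContMDiffOn 𝓘(ℝ, X m × X n) 𝓘(ℝ, X m) ∞ (fun z => c (t z).1) e.source :=
      hcs.comp (contMDiff_fst.comp_contMDiffOn (ht.mono fun z hz => ((hsrc z).1 hz).1))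
        fun z hz => ((hsrc z).1 hz).2.1
    have h2 : ContMDiffOn 𝓘(ℝ, X m × X n) 𝓘(ℝ, X n) ∞ (fun z => f (t z).2) e.source :=
      hfs.comp (contMDiff_snd.comp_contMDiffOn (ht.mono fun z hz => ((hsrc z).1 hz).1))
        fun z hz => ((hsrc z).1 hz).2.2
    exact h1.prodMk_space h2
  · have h1 : ContMDiffOn 𝓘(ℝ, X m × X n) 𝓘(ℝ, X m) ∞ (fun u => c.symm u.1) e.target :=
      hcs'.comp contDiff_fst.contMDiff.contMDiffOn fun z hz => ((htgt z).1 hz).1.1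
    have h2 : ContMDiffOn 𝓘(ℝ, X m × X n) 𝓘(ℝ, X n) ∞ (fun u => f.symm u.2) e.target :=
      hfs'.comp contDiff_snd.contMDiff.contMDiffOn fun z hz => ((htgt z).1 hz).1.2
    exact ht'.comp (h1.prodMk h2) fun z hz => ((htgt z).1 hz).2
  · intro z hz
    rw [← t.proj_toFun z ((hsrc z).1 hz).1]
    exact ((hsrc z).1 hz).2.1
  · intro z hz
    rw [← t.proj_toFun z ((hsrc z).1 hz).1]
    rfl
  · refine (hsrc y).2 ⟨hy, ?_, mem_chart_source _ _⟩
    have : (t y).1 = B.proj y := t.proj_toFun y hy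
    rw [this]; exact mem_chart_source _ _

variable {B : ConfigBundle m n M E F}

namespace AdaptedChart

theorem e_mdiff (a : AdaptedChart B) :
    a.e.MDifferentiable 𝓘(ℝ, X m × X n) 𝓘(ℝ, X m × X n) :=
  ⟨a.e_smooth.mdifferentiableOn (by simp), a.e_symm_smooth.mdifferentiableOn (by simp)⟩

theorem c_mdiff (a : AdaptedChart B) : a.c.MDifferentiable 𝓘(ℝ, X m) 𝓘(ℝ, X m) :=
  ⟨a.c_smooth.mdifferentiableOn (by simp), a.c_symm_smooth.mdifferentiableOn (by simp)⟩

/-- `T_y e : T_y E → ℝᵐ × ℝⁿ`. -/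
def D (a : AdaptedChart B) (y : E) : TangentSpace 𝓘(ℝ, X m × X n) y →L[ℝ] (X m × X n) :=
  mfderiv 𝓘(ℝ, X m × X n) 𝓘(ℝ, X m × X n) a.e y

/-- The inverse of `T_y e`. -/
def Dinv (a : AdaptedChart B) (y : E) : (X m × X n) →L[ℝ] TangentSpace 𝓘(ℝ, X m × X n) y :=
  mfderiv 𝓘(ℝ, X m × X n) 𝓘(ℝ, X m × X n) a.e.symm (a.e y)

/-- `T_x c : T_x M → ℝᵐ`. -/
def d (a : AdaptedChart B) (x : M) : TangentSpace 𝓘(ℝ, X m) x →L[ℝ] X m :=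
  mfderiv 𝓘(ℝ, X m) 𝓘(ℝ, X m) a.c x

/-- The inverse of `T_x c`. -/
def dinv (a : AdaptedChart B) (x : M) : X m →L[ℝ] TangentSpace 𝓘(ℝ, X m) x :=
  mfderiv 𝓘(ℝ, X m) 𝓘(ℝ, X m) a.c.symm (a.c x)

theorem D_Dinv (a : AdaptedChart B) {y : E} (h : y ∈ a.e.source) (z : X m × X n) :
    a.D y (a.Dinv y z) = z := by
  exact (a.e_mdiff.mfderiv h).apply_symm_apply z

theorem Dinv_D (a : AdaptedChart B) {y : E} (h : y ∈ a.e.source)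
    (z : TangentSpace 𝓘(ℝ, X m × X n) y) : a.Dinv y (a.D y z) = z := by
  exact (a.e_mdiff.mfderiv h).symm_apply_apply z

theorem d_dinv (a : AdaptedChart B) {x : M} (h : x ∈ a.c.source) (z : X m) :
    a.d x (a.dinv x z) = z := by
  exact (a.c_mdiff.mfderiv h).apply_symm_apply z

theorem dinv_d (a : AdaptedChart B) {x : M} (h : x ∈ a.c.source)
    (z : TangentSpace 𝓘(ℝ, X m) x) : a.dinv x (a.d x z) = z := by
  exact (a.c_mdiff.mfderiv h).symm_apply_apply z

theorem fst_D (a : AdaptedChart B) {y : E} (h : y ∈ a.e.source)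
    (z : TangentSpace 𝓘(ℝ, X m × X n) y) :
    (a.D y z).1 = a.d (B.proj y) (mfderiv 𝓘(ℝ, X m × X n) 𝓘(ℝ, X m) B.proj y z) := by
  have h1 : HasMFDerivAt 𝓘(ℝ, X m × X n) 𝓘(ℝ, X m) (fun z => (a.e z).1) y
      ((fstL m n).comp (a.D y)) :=
    (fstL m n).hasMFDerivAt.comp y (a.e_mdiff.mdifferentiableAt h).hasMFDerivAt
  have h2 : HasMFDerivAt 𝓘(ℝ, X m × X n) 𝓘(ℝ, X m) (a.c ∘ B.proj) y
      ((a.d (B.proj y)).comp (mfderiv 𝓘(ℝ, X m × X n) 𝓘(ℝ, X m) B.proj y)) :=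
    HasMFDerivAt.comp y (a.c_mdiff.mdifferentiableAt (a.mapsTo y h)).hasMFDerivAt
      (B.mdifferentiable_proj y).hasMFDerivAt
  have h3 := h2.congr_of_eventuallyEq (f₁ := fun z => (a.e z).1) (by
    filter_upwards [a.e.open_source.mem_nhds h] with w hw using a.fst_e w hw)
  have := hasMFDerivAt_unique h1 h3
  exact congrArg (fun L => L z) this

/-- The coordinate change of `E` from `a` to `b`. -/
def chE (a b : AdaptedChart B) : X m × X n → X m × X n := b.e ∘ a.e.symm

/-- The coordinate change of `M` from `a` to `b`. -/
def chM (a b : AdaptedChart B) : X m → X m := b.c ∘ a.c.symm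

theorem chE_smooth (a b : AdaptedChart B) :
    ContDiffOn ℝ ∞ (chE a b) (a.e.symm.trans b.e).source := by
  rw [← contMDiffOn_iff_contDiffOn]
  refine b.e_smooth.comp (a.e_symm_smooth.mono ?_) ?_
  · intro u hu; exact (by simpa using hu : _ ∧ _).1
  · intro u hu; exact (by simpa using hu : _ ∧ _).2

theorem chM_smooth (a b : AdaptedChart B) :
    ContDiffOn ℝ ∞ (chM a b) (a.c.symm.trans b.c).source := by
  rw [← contMDiffOn_iff_contDiffOn]
  refine b.c_smooth.comp (a.c_symm_smooth.mono ?_) ?_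
  · intro u hu; exact (by simpa using hu : _ ∧ _).1
  · intro u hu; exact (by simpa using hu : _ ∧ _).2

theorem D_Dinv_change (a b : AdaptedChart B) {y : E} (ha : y ∈ a.e.source) (hb : y ∈ b.e.source)
    (z : X m × X n) : b.D y (a.Dinv y z) = fderiv ℝ (chE a b) (a.e y) z := by
  have h1 : HasMFDerivAt 𝓘(ℝ, X m × X n) 𝓘(ℝ, X m × X n) (chE a b ∘ a.e) y
      ((fderiv ℝ (chE a b) (a.e y)).comp (a.D y)) := by
    refine HasMFDerivAt.comp y (HasFDerivAt.hasMFDerivAt ?_)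
      (a.e_mdiff.mdifferentiableAt ha).hasMFDerivAt
    refine (((chE_smooth a b).contDiffAt ?_).differentiableAt (by simp)).hasFDerivAt
    exact (a.e.symm.trans b.e).open_source.mem_nhds (by simp [ha, hb])
  have h2 : HasMFDerivAt 𝓘(ℝ, X m × X n) 𝓘(ℝ, X m × X n) (chE a b ∘ a.e) y (b.D y) := by
    refine (b.e_mdiff.mdifferentiableAt hb).hasMFDerivAt.congr_of_eventuallyEq ?_
    filter_upwards [a.e.open_source.mem_nhds ha] with w hw
    simp [chE, a.e.left_inv hw]
  have h3 := congrArg (fun L => L (a.Dinv y z)) (hasMFDerivAt_unique h2 h1)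
  refine h3.trans ?_
  change fderiv ℝ (chE a b) (a.e y) (a.D y (a.Dinv y z)) = _
  rw [D_Dinv a ha]

theorem d_dinv_change (a b : AdaptedChart B) {x : M} (ha : x ∈ a.c.source) (hb : x ∈ b.c.source)
    (z : X m) : b.d x (a.dinv x z) = fderiv ℝ (chM a b) (a.c x) z := by
  have h1 : HasMFDerivAt 𝓘(ℝ, X m) 𝓘(ℝ, X m) (chM a b ∘ a.c) x
      ((fderiv ℝ (chM a b) (a.c x)).comp (a.d x)) := by
    refine HasMFDerivAt.comp x (HasFDerivAt.hasMFDerivAt ?_)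
      (a.c_mdiff.mdifferentiableAt ha).hasMFDerivAt
    refine (((chM_smooth a b).contDiffAt ?_).differentiableAt (by simp)).hasFDerivAt
    exact (a.c.symm.trans b.c).open_source.mem_nhds (by simp [ha, hb])
  have h2 : HasMFDerivAt 𝓘(ℝ, X m) 𝓘(ℝ, X m) (chM a b ∘ a.c) x (b.d x) := by
    refine (b.c_mdiff.mdifferentiableAt hb).hasMFDerivAt.congr_of_eventuallyEq ?_
    filter_upwards [a.c.open_source.mem_nhds ha] with w hw
    simp [chM, a.c.left_inv hw]
  have h3 := congrArg (fun L => L (a.dinv x z)) (hasMFDerivAt_unique h2 h1)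
  refine h3.trans ?_
  change fderiv ℝ (chM a b) (a.c x) (a.d x (a.dinv x z)) = _
  rw [d_dinv a ha]

end AdaptedChart
end Bundle

section Total

variable {m n : ℕ} {M E F : Type*}
  [TopologicalSpace M] [ChartedSpace (X m) M]
  [TopologicalSpace E] [ChartedSpace (X m × X n) E]
  [TopologicalSpace F] [ChartedSpace (X n) F]

/-- Fibre coordinates, one for each adapted chart, on a family `T` of sets over `E`, with smooth
coordinate changes. -/
structure FibreCoords (B : ConfigBundle m n M E F) (G : Type*) [NormedAddCommGroup G]
    [NormedSpace ℝ G] (T : E → Type*) where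
  coord : AdaptedChart B → ∀ y : E, T y → G
  inv : ∀ (a : AdaptedChart B) (y : E), y ∈ a.e.source → G → T y
  coord_inv : ∀ a y h g, coord a y (inv a y h g) = g
  inv_coord : ∀ a y h q, inv a y h (coord a y q) = q
  trans : AdaptedChart B → AdaptedChart B → (X m × X n) × G → G
  trans_smooth : ∀ a b, ContDiffOn ℝ ∞ (trans a b) ((a.e.symm.trans b.e).source ×ˢ Set.univ)
  trans_eq : ∀ a b y (ha : y ∈ a.e.source), y ∈ b.e.source → ∀ g,
    coord b y (inv a y ha g) = trans a b (a.e y, g)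

namespace FibreCoords

variable {B : ConfigBundle m n M E F} {G : Type*} [NormedAddCommGroup G]
    [NormedSpace ℝ G] {T : E → Type*} (C : FibreCoords B G T)

theorem mk_inv (a : AdaptedChart B) {y y' : E} (hy : y' = y) (h' : y' ∈ a.e.source) (q : T y) :
    (⟨y', C.inv a y' h' (C.coord a y q)⟩ : Bundle.TotalSpace G T) = ⟨y, q⟩ := by
  subst hy
  rw [C.inv_coord]

open Classical in
/-- The induced coordinates `(x, y, g)` on the total space, over the adapted chart `a`. (The point
`q₀` is only a junk value outside the target.) -/
def chart (q₀ : Bundle.TotalSpace G T) (a : AdaptedChart B) :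
    PartialEquiv (Bundle.TotalSpace G T) ((X m × X n) × G) where
  toFun q := (a.e q.proj, C.coord a q.proj q.snd)
  invFun u := if h : u.1 ∈ a.e.target then
    ⟨a.e.symm u.1, C.inv a (a.e.symm u.1) (a.e.map_target h) u.2⟩ else q₀
  source := {q | q.proj ∈ a.e.source}
  target := a.e.target ×ˢ Set.univ
  map_source' q hq := ⟨a.e.map_source hq, trivial⟩
  map_target' u hu := by
    rw [dif_pos hu.1]
    exact a.e.map_target hu.1
  left_inv' q hq := by
    rw [dif_pos (a.e.map_source hq)]
    exact C.mk_inv a (a.e.left_inv hq) _ q.snd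
  right_inv' u hu := by
    rw [dif_pos hu.1]
    exact Prod.ext (a.e.right_inv hu.1) (C.coord_inv _ _ _ _)

open Classical in
theorem chart_trans_source (q q' : Bundle.TotalSpace G T) (a b : AdaptedChart B) :
    ((C.chart q a).symm.trans (C.chart q' b)).source
      = (a.e.symm.trans b.e).source ×ˢ Set.univ := by
  ext u
  rw [PartialEquiv.trans_source, Set.mem_inter_iff, Set.mem_prod,
    OpenPartialHomeomorph.trans_source, Set.mem_inter_iff]
  change (u ∈ a.e.target ×ˢ (Set.univ : Set G) ∧ _) ↔ (u.1 ∈ a.e.target ∧ _) ∧ _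
  constructor
  · rintro ⟨h1, h2⟩
    refine ⟨⟨h1.1, ?_⟩, trivial⟩
    change Bundle.TotalSpace.proj (dite _ _ _) ∈ b.e.source at h2
    rw [dif_pos h1.1] at h2
    exact h2
  · rintro ⟨⟨h1, h2⟩, -⟩
    refine ⟨⟨h1, trivial⟩, ?_⟩
    change Bundle.TotalSpace.proj (dite _ _ _) ∈ b.e.source
    rw [dif_pos h1]
    exact h2

open Classical in
theorem chart_trans_smooth (q q' : Bundle.TotalSpace G T) (a b : AdaptedChart B) :
    ContDiffOn ℝ ∞ ((C.chart q a).symm.trans (C.chart q' b))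
      ((C.chart q a).symm.trans (C.chart q' b)).source := by
  rw [C.chart_trans_source]
  have h1 : ContDiffOn ℝ ∞ (fun u : (X m × X n) × G => (a.chE b u.1, C.trans a b u))
      ((a.e.symm.trans b.e).source ×ˢ Set.univ) :=
    ((a.chE_smooth b).comp contDiffOn_fst fun u hu => hu.1).prodMk (C.trans_smooth a b)
  refine h1.congr ?_
  rintro ⟨u, g⟩ ⟨hu, -⟩
  have hu' : u ∈ a.e.target ∧ a.e.symm u ∈ b.e.source := by
    rw [OpenPartialHomeomorph.trans_source] at hu; exact hu
  change (C.chart q' b) (dite _ _ _) = _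
  rw [dif_pos hu'.1]
  refine Prod.ext rfl ?_
  change C.coord b _ (C.inv a _ _ _) = _
  rw [C.trans_eq a b _ _ hu'.2, a.e.right_inv hu'.1]

variable [IsManifold 𝓘(ℝ, X m) ∞ M] [IsManifold 𝓘(ℝ, X n) ∞ F]

/-- The smooth atlas on the total space given by all induced coordinates. -/
def core : ChartedSpaceCore ((X m × X n) × G) (Bundle.TotalSpace G T) where
  atlas := {e | ∃ q a, e = C.chart q a}
  chartAt q := C.chart q (B.exists_adaptedChart q.proj).choose
  mem_chart_source q := (B.exists_adaptedChart q.proj).choose_spec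
  chart_mem_atlas q := ⟨_, _, rfl⟩
  open_source := by
    rintro _ _ ⟨q, a, rfl⟩ ⟨q', b, rfl⟩
    rw [C.chart_trans_source]
    exact (a.e.symm.trans b.e).open_source.prod isOpen_univ
  continuousOn_toFun := by
    rintro _ _ ⟨q, a, rfl⟩ ⟨q', b, rfl⟩
    exact (C.chart_trans_smooth q q' a b).continuousOn

/-- The topology defined by the induced coordinates. -/
@[reducible]
def topology : TopologicalSpace (Bundle.TotalSpace G T) := C.core.toTopologicalSpace

/-- The charted space structure defined by the induced coordinates. -/
@[reducible]
def chartedSpace : @ChartedSpace ((X m × X n) × G) _ (Bundle.TotalSpace G T) C.topology :=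
  C.core.toChartedSpace

theorem isManifold : @IsManifold ℝ _ ((X m × X n) × G) _ _ ((X m × X n) × G) _
    𝓘(ℝ, (X m × X n) × G) ∞ (Bundle.TotalSpace G T) C.topology C.chartedSpace := by
  let := C.topology
  let := C.chartedSpace
  refine isManifold_of_contDiffOn _ _ _ fun e e' he he' => ?_
  have key : ∀ f ∈ atlas ((X m × X n) × G) (Bundle.TotalSpace G T),
      ∃ q a, f.toPartialEquiv = C.chart q a := by
    intro f hf
    change f ∈ ⋃ (e : PartialEquiv _ _) (he : e ∈ C.core.atlas),
      {C.core.openPartialHomeomorph e he} at hf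
    simp only [Set.mem_iUnion, Set.mem_singleton_iff] at hf
    obtain ⟨e, ⟨q, a, rfl⟩, rfl⟩ := hf
    exact ⟨q, a, rfl⟩
  obtain ⟨q, a, h⟩ := key e he
  obtain ⟨q', b, h'⟩ := key e' he'
  have h2 : (e.symm.trans e').toPartialEquiv = (C.chart q a).symm.trans (C.chart q' b) := by
    rw [← h, ← h']; rfl
  have := C.chart_trans_smooth q q' a b
  rw [← h2] at this
  simpa using this

end FibreCoords
end Total

section Bundles

variable {m n : ℕ} {M E F : Type*}
  [TopologicalSpace M] [ChartedSpace (X m) M]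
  [TopologicalSpace E] [ChartedSpace (X m × X n) E]
  [TopologicalSpace F] [ChartedSpace (X n) F]

/-- `T_y π : T_y E → T_{π(y)} M`. -/
abbrev ConfigBundle.tproj (B : ConfigBundle m n M E F) (y : E) :
    TangentSpace 𝓘(ℝ, X m × X n) y →L[ℝ] TangentSpace 𝓘(ℝ, X m) (B.proj y) :=
  mfderiv 𝓘(ℝ, X m × X n) 𝓘(ℝ, X m) B.proj y

/-- The `1`-jets at `y` of local sections: linear maps `γ : T_{π(y)} M → T_y E`, `T_y π ∘ γ = id`. -/
def JetFibre (B : ConfigBundle m n M E F) (y : E) : Type :=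
  {γ : TangentSpace 𝓘(ℝ, X m) (B.proj y) →L[ℝ] TangentSpace 𝓘(ℝ, X m × X n) y //
    (B.tproj y).comp γ = ContinuousLinearMap.id ℝ _}

/-- The first jet bundle `J¹π`, with projection `π¹ = TotalSpace.proj`. -/
abbrev J1 (B : ConfigBundle m n M E F) : Type _ :=
  Bundle.TotalSpace (X m →L[ℝ] X n) (JetFibre B)

/-- `Λ₂ᵐ T_y^* E`: the `m`-forms at `y` vanishing by the action of two vertical vectors. -/
def ExtMomFibre (B : ConfigBundle m n M E F) (y : E) : Type :=
  twoSemibasic m (B.tproj y)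

/-- The extended multimomentum bundle `ℳπ`, with projection `κ = TotalSpace.proj`. -/
abbrev ExtMom (B : ConfigBundle m n M E F) : Type _ :=
  Bundle.TotalSpace ((Fin m → (X n →L[ℝ] ℝ)) × ℝ) (ExtMomFibre B)

/-- `Λ₂ᵐ T_y^* E / π^* Λᵐ T_{π(y)}^* M`. -/
def RestMomFibre (B : ConfigBundle m n M E F) (y : E) : Type :=
  Quotient (basicSetoid m (B.tproj y))

/-- The restricted multimomentum bundle `J¹π^*`, with projection `τ = TotalSpace.proj`. -/
abbrev RestMom (B : ConfigBundle m n M E F) : Type _ :=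
  Bundle.TotalSpace (Fin m → (X n →L[ℝ] ℝ)) (RestMomFibre B)

variable {B : ConfigBundle m n M E F}

namespace AdaptedChart

theorem fst_mem_source (a b : AdaptedChart B) {u : X m × X n}
    (hu : u ∈ (a.e.symm.trans b.e).source) :
    (chE a b u).1 ∈ (b.c.symm.trans a.c).source := by
  rw [OpenPartialHomeomorph.trans_source] at hu ⊢
  have h1 : u ∈ a.e.target := hu.1
  have h2 : a.e.symm u ∈ b.e.source := hu.2
  have h3 : (chE a b u).1 = b.c (B.proj (a.e.symm u)) := b.fst_e _ h2
  have h4 := b.mapsTo _ h2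
  rw [h3]
  refine ⟨b.c.map_source h4, ?_⟩
  change b.c.symm (b.c _) ∈ a.c.source
  rw [b.c.left_inv h4]
  exact a.mapsTo _ (a.e.map_target h1)

theorem chE_mem_source (a b : AdaptedChart B) {u : X m × X n}
    (hu : u ∈ (a.e.symm.trans b.e).source) : chE a b u ∈ (b.e.symm.trans a.e).source := by
  rw [OpenPartialHomeomorph.trans_source] at hu ⊢
  have h1 : u ∈ a.e.target := hu.1
  have h2 : a.e.symm u ∈ b.e.source := hu.2
  refine ⟨b.e.map_source h2, ?_⟩
  change b.e.symm (b.e _) ∈ a.e.source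
  rw [b.e.left_inv h2]
  exact a.e.map_target h1

theorem tproj_Dinv (a : AdaptedChart B) {y : E} (h : y ∈ a.e.source) (z : X m × X n) :
    a.d (B.proj y) (B.tproj y (a.Dinv y z)) = z.1 := by
  rw [← a.fst_D h, a.D_Dinv h]

theorem tproj_eq_zero (a : AdaptedChart B) {y : E} (h : y ∈ a.e.source) {z : X m × X n}
    (hz : z.1 = 0) : B.tproj y (a.Dinv y z) = 0 := by
  rw [← a.dinv_d (a.mapsTo y h) (B.tproj y (a.Dinv y z)), tproj_Dinv a h, hz, map_zero]

theorem comp_Dinv_mem (a : AdaptedChart B) {y : E} (h : y ∈ a.e.source)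
    {α : TangentSpace 𝓘(ℝ, X m × X n) y [⋀^Fin m]→L[ℝ] ℝ} (hα : α ∈ twoSemibasic m (B.tproj y)) :
    α.compContinuousLinearMap (a.Dinv y) ∈ twoSemibasic m (fstL m n) := by
  intro v i j hij hi hj
  exact hα _ i j hij (tproj_eq_zero a h hi) (tproj_eq_zero a h hj)

theorem comp_D_mem (a : AdaptedChart B) {y : E} (h : y ∈ a.e.source)
    {α : (X m × X n) [⋀^Fin m]→L[ℝ] ℝ} (hα : α ∈ twoSemibasic m (fstL m n)) :
    α.compContinuousLinearMap (a.D y) ∈ twoSemibasic m (B.tproj y) := by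
  intro v i j hij hi hj
  refine hα _ i j hij ?_ ?_
  · change (a.D y (v i)).1 = 0
    rw [a.fst_D h]; exact (congrArg _ hi).trans (map_zero _)
  · change (a.D y (v j)).1 = 0
    rw [a.fst_D h]; exact (congrArg _ hj).trans (map_zero _)

theorem fderiv_chE_smooth (a b : AdaptedChart B) :
    ContDiffOn ℝ ∞ (fderiv ℝ (chE a b)) (a.e.symm.trans b.e).source :=
  (a.chE_smooth b).fderiv_of_isOpen (a.e.symm.trans b.e).open_source (by simp)

theorem fderiv_chM_smooth (a b : AdaptedChart B) :
    ContDiffOn ℝ ∞ (fderiv ℝ (chM a b)) (a.c.symm.trans b.c).source :=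
  (a.chM_smooth b).fderiv_of_isOpen (a.c.symm.trans b.c).open_source (by simp)

end AdaptedChart

/-- The coordinates `v^A_ν` on jets. -/
def jetCoords (B : ConfigBundle m n M E F) : FibreCoords B (X m →L[ℝ] X n) (JetFibre B) where
  coord a y γ := (ContinuousLinearMap.snd ℝ (X m) (X n)).comp
    ((a.D y).comp (γ.1.comp (a.dinv (B.proj y))))
  inv a y h A := ⟨(a.Dinv y).comp
    (((ContinuousLinearMap.id ℝ (X m)).prod A).comp (a.d (B.proj y))), by
      ext v
      change B.tproj y (a.Dinv y (a.d (B.proj y) v, A (a.d (B.proj y) v))) = v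
      rw [← a.dinv_d (a.mapsTo y h) (B.tproj y _), a.tproj_Dinv h]
      exact a.dinv_d (a.mapsTo y h) v⟩
  coord_inv a y h A := by
    ext1 v
    change (a.D y (a.Dinv y (a.d _ (a.dinv _ v), A (a.d _ (a.dinv _ v))))).2 = A v
    rw [a.D_Dinv h, a.d_dinv (a.mapsTo y h)]
  inv_coord a y h γ := by
    refine Subtype.ext ?_
    refine ContinuousLinearMap.ext fun v => ?_
    change a.Dinv y (a.d _ v, (a.D y (γ.1 (a.dinv _ (a.d _ v)))).2) = γ.1 v
    rw [a.dinv_d (a.mapsTo y h)]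
    have h1 : (a.D y (γ.1 v)).1 = a.d (B.proj y) v := by
      rw [a.fst_D h]
      exact congrArg (a.d (B.proj y)) (congrArg (fun L => L v) γ.2)
    rw [← h1]
    exact a.Dinv_D h _
  trans a b u := (ContinuousLinearMap.snd ℝ (X m) (X n)).comp
    ((fderiv ℝ (a.chE b) u.1).comp (((ContinuousLinearMap.id ℝ (X m)).prod u.2).comp
      (fderiv ℝ (b.chM a) (a.chE b u.1).1)))
  trans_smooth a b := by
    have h1 : ContDiffOn ℝ ∞ (fun u : (X m × X n) × (X m →L[ℝ] X n) => fderiv ℝ (a.chE b) u.1)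
        ((a.e.symm.trans b.e).source ×ˢ Set.univ) :=
      (a.fderiv_chE_smooth b).comp contDiffOn_fst fun u hu => hu.1
    have h2 : ContDiffOn ℝ ∞ (fun u : (X m × X n) × (X m →L[ℝ] X n) =>
        fderiv ℝ (b.chM a) (a.chE b u.1).1) ((a.e.symm.trans b.e).source ×ˢ Set.univ) :=
      (b.fderiv_chM_smooth a).comp
        (contDiff_fst.comp_contDiffOn ((a.chE_smooth b).comp contDiffOn_fst fun u hu => hu.1))
        fun u hu => a.fst_mem_source b hu.1
    have h3 : ContDiffOn ℝ ∞ (fun u : (X m × X n) × (X m →L[ℝ] X n) =>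
        (ContinuousLinearMap.id ℝ (X m)).prod u.2) ((a.e.symm.trans b.e).source ×ˢ Set.univ) := by
      have : (fun u : (X m × X n) × (X m →L[ℝ] X n) => (ContinuousLinearMap.id ℝ (X m)).prod u.2)
          = fun u => ContinuousLinearMap.inl ℝ (X m) (X n)
            + (ContinuousLinearMap.inr ℝ (X m) (X n)).comp u.2 := by
        funext u
        refine ContinuousLinearMap.ext fun v => ?_
        simp
      rw [this]
      exact contDiffOn_const.add (contDiffOn_const.clm_comp contDiffOn_snd)
    exact contDiffOn_const.clm_comp (h1.clm_comp (h3.clm_comp h2))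
  trans_eq a b y ha hb A := by
    have hx : (a.chE b (a.e y)).1 = b.c (B.proj y) := by
      change (b.e (a.e.symm (a.e y))).1 = _
      rw [a.e.left_inv ha, b.fst_e y hb]
    refine ContinuousLinearMap.ext fun v => ?_
    change (b.D y (a.Dinv y (a.d _ (b.dinv _ v), A (a.d _ (b.dinv _ v))))).2
      = (fderiv ℝ (a.chE b) (a.e y) (fderiv ℝ (b.chM a) (a.chE b (a.e y)).1 v,
          A (fderiv ℝ (b.chM a) (a.chE b (a.e y)).1 v))).2
    rw [hx, ← b.d_dinv_change a (b.mapsTo y hb) (a.mapsTo y ha), a.D_Dinv_change b ha hb]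

theorem modelForm_smooth {W : Type*} [NormedAddCommGroup W] [NormedSpace ℝ W] {s : Set W}
    {p : W → Fin m → (X n →L[ℝ] ℝ)} {p₀ : W → ℝ} {v : W → Fin m → X m × X n}
    (hp : ContDiffOn ℝ ∞ p s) (hp₀ : ContDiffOn ℝ ∞ p₀ s)
    (hv : ∀ i, ContDiffOn ℝ ∞ (fun w => v w i) s) :
    ContDiffOn ℝ ∞ (fun w => modelForm (p w) (p₀ w) (v w)) s := by
  simp only [modelForm_apply]
  have hvol : ContDiff ℝ ∞ (fun x : Fin m → X m => stdVol m x) :=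
    (stdVol m).toContinuousMultilinearMap.contDiff
  refine ContDiffOn.add (ContDiffOn.sum fun i _ => ?_) (hp₀.mul ?_)
  · refine hvol.comp_contDiffOn (contDiffOn_pi.mpr fun j => ?_)
    by_cases hj : j = i
    · subst hj
      simp only [Function.update_self]
      refine ContDiffOn.sum fun ν _ => ?_
      have h : ContDiffOn ℝ ∞ (fun w => p w ν (v w j).2) s :=
        (contDiffOn_pi.mp hp ν).clm_apply (contDiff_snd.comp_contDiffOn (hv j))
      exact h.smul (contDiffOn_const (c := (stdB ν : X m)))
    · simp only [Function.update_of_ne hj]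
      exact contDiff_fst.comp_contDiffOn (hv j)
  · exact hvol.comp_contDiffOn (contDiffOn_pi.mpr fun j => contDiff_fst.comp_contDiffOn (hv j))

theorem formMom_smooth {W : Type*} [NormedAddCommGroup W] [NormedSpace ℝ W] {s : Set W}
    {p : W → Fin m → (X n →L[ℝ] ℝ)} {p₀ : W → ℝ} {L : W → (X m × X n) →L[ℝ] (X m × X n)}
    (hp : ContDiffOn ℝ ∞ p s) (hp₀ : ContDiffOn ℝ ∞ p₀ s) (hL : ContDiffOn ℝ ∞ L s) :
    ContDiffOn ℝ ∞ (fun w => formMom ((modelForm (p w) (p₀ w)).compContinuousLinearMap (L w))) s := by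
  refine contDiffOn_pi.mpr fun ν => contDiffOn_clm_apply.mpr fun y => ?_
  simp only [formMom_apply]
  exact modelForm_smooth hp hp₀ fun i => hL.clm_apply contDiffOn_const

/-- The coordinates `(p^ν_A, p)` on `Λ₂ᵐ T^*E`, for which
`α = p^ν_A dy^A ∧ d^{m-1}x_ν + p dᵐx`. -/
def extMomCoords (B : ConfigBundle m n M E F) :
    FibreCoords B ((Fin m → (X n →L[ℝ] ℝ)) × ℝ) (ExtMomFibre B) where
  coord a y α := (formMom (α.1.compContinuousLinearMap (a.Dinv y)),
    formEnergy (α.1.compContinuousLinearMap (a.Dinv y)))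
  inv a y h p := ⟨(modelForm p.1 p.2).compContinuousLinearMap (a.D y),
    a.comp_D_mem h (modelForm_mem _ _)⟩
  coord_inv a y h p := by
    have : ((modelForm p.1 p.2).compContinuousLinearMap (a.D y)).compContinuousLinearMap (a.Dinv y)
        = modelForm p.1 p.2 := by
      refine ContinuousAlternatingMap.ext fun v => ?_
      change modelForm p.1 p.2 (fun i => a.D y (a.Dinv y (v i))) = _
      simp only [a.D_Dinv h]
    change (formMom _, formEnergy _) = p
    rw [this, formMom_modelForm, formEnergy_modelForm]
  inv_coord a y h α := by
    refine Subtype.ext ?_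
    change (modelForm (formMom _) (formEnergy _)).compContinuousLinearMap (a.D y) = α.1
    rw [modelForm_coords (a.comp_Dinv_mem h α.2)]
    refine ContinuousAlternatingMap.ext fun v => ?_
    change α.1 (fun i => a.Dinv y (a.D y (v i))) = _
    simp only [a.Dinv_D h]
  trans a b u :=
    (formMom ((modelForm u.2.1 u.2.2).compContinuousLinearMap
        (fderiv ℝ (b.chE a) (a.chE b u.1))),
      formEnergy ((modelForm u.2.1 u.2.2).compContinuousLinearMap
        (fderiv ℝ (b.chE a) (a.chE b u.1))))
  trans_smooth a b := by
    have hL : ContDiffOn ℝ ∞ (fun u : (X m × X n) × ((Fin m → (X n →L[ℝ] ℝ)) × ℝ) =>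
        fderiv ℝ (b.chE a) (a.chE b u.1)) ((a.e.symm.trans b.e).source ×ˢ Set.univ) :=
      (b.fderiv_chE_smooth a).comp ((a.chE_smooth b).comp contDiffOn_fst fun u hu => hu.1)
        fun u hu => a.chE_mem_source b hu.1
    have hp : ContDiffOn ℝ ∞ (fun u : (X m × X n) × ((Fin m → (X n →L[ℝ] ℝ)) × ℝ) => u.2.1)
        ((a.e.symm.trans b.e).source ×ˢ Set.univ) :=
      (contDiff_fst.comp contDiff_snd).contDiffOn
    have hp₀ : ContDiffOn ℝ ∞ (fun u : (X m × X n) × ((Fin m → (X n →L[ℝ] ℝ)) × ℝ) => u.2.2)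
        ((a.e.symm.trans b.e).source ×ˢ Set.univ) :=
      (contDiff_snd.comp contDiff_snd).contDiffOn
    exact (formMom_smooth hp hp₀ hL).prodMk
      (modelForm_smooth hp hp₀ fun i => hL.clm_apply contDiffOn_const)
  trans_eq a b y ha hb p := by
    have : ((modelForm p.1 p.2).compContinuousLinearMap (a.D y)).compContinuousLinearMap (b.Dinv y)
        = (modelForm p.1 p.2).compContinuousLinearMap
          (fderiv ℝ (b.chE a) (a.chE b (a.e y))) := by
      refine ContinuousAlternatingMap.ext fun v => ?_
      change modelForm p.1 p.2 (fun i => a.D y (b.Dinv y (v i)))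
        = modelForm p.1 p.2 (fun i => fderiv ℝ (b.chE a) (b.e (a.e.symm (a.e y))) (v i))
      simp only [b.D_Dinv_change a hb ha, a.e.left_inv ha]
    change (formMom _, formEnergy _) = (formMom _, formEnergy _)
    rw [this]

open Classical in
/-- The coordinates `p^ν_A` on `Λ₂ᵐ T^*E / π^* Λᵐ T^*M`. -/
def restMomCoords (B : ConfigBundle m n M E F) :
    FibreCoords B (Fin m → (X n →L[ℝ] ℝ)) (RestMomFibre B) where
  coord a y q := if h : y ∈ a.e.source then
    Quotient.lift (s := basicSetoid m (B.tproj y))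
      (fun α => formMom (α.1.compContinuousLinearMap (a.Dinv y))) (by
        rintro α α' ⟨β, hβ⟩
        funext ν
        ext1 w
        change α.1 (fun i => a.Dinv y (hvArgs ν w i)) = α'.1 (fun i => a.Dinv y (hvArgs ν w i))
        rw [hβ, ContinuousAlternatingMap.add_apply, add_eq_left]
        refine β.map_coord_zero ν ?_
        refine a.tproj_eq_zero h ?_
        simp [hvArgs]) q
    else 0
  inv a y h p := Quotient.mk _ ⟨(modelForm p 0).compContinuousLinearMap (a.D y),
    a.comp_D_mem h (modelForm_mem _ _)⟩
  coord_inv a y h p := by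
    rw [dif_pos h]
    exact congrArg Prod.fst ((extMomCoords B).coord_inv a y h (p, 0))
  inv_coord a y h q := by
    rw [dif_pos h]
    obtain ⟨α, rfl⟩ := Quotient.exists_rep q
    refine Quotient.sound ?_
    set c : ℝ := formEnergy (α.1.compContinuousLinearMap (a.Dinv y)) with hc
    refine ⟨-(c • (stdVol m).compContinuousLinearMap (a.d (B.proj y))), ?_⟩
    have h1 := congrArg Subtype.val ((extMomCoords B).inv_coord a y h α)
    refine ContinuousAlternatingMap.ext fun v => ?_
    have h2 : modelForm (formMom (α.1.compContinuousLinearMap (a.Dinv y))) c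
        (fun i => a.D y (v i)) = α.1 v := congrArg (fun f => f v) h1
    change modelForm (formMom (α.1.compContinuousLinearMap (a.Dinv y))) 0
        (fun i => a.D y (v i))
      = α.1 v + -(c * stdVol m (fun i => a.d (B.proj y) (B.tproj y (v i))))
    rw [← h2, modelForm_apply, modelForm_apply]
    simp only [a.fst_D h]
    ring
  trans a b u := formMom ((modelForm u.2 0).compContinuousLinearMap
    (fderiv ℝ (b.chE a) (a.chE b u.1)))
  trans_smooth a b := by
    have hL : ContDiffOn ℝ ∞ (fun u : (X m × X n) × (Fin m → (X n →L[ℝ] ℝ)) =>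
        fderiv ℝ (b.chE a) (a.chE b u.1)) ((a.e.symm.trans b.e).source ×ˢ Set.univ) :=
      (b.fderiv_chE_smooth a).comp ((a.chE_smooth b).comp contDiffOn_fst fun u hu => hu.1)
        fun u hu => a.chE_mem_source b hu.1
    exact formMom_smooth contDiffOn_snd contDiffOn_const hL
  trans_eq a b y ha hb p := by
    rw [dif_pos hb]
    exact congrArg Prod.fst ((extMomCoords B).trans_eq a b y ha hb (p, 0))

variable [IsManifold 𝓘(ℝ, X m) ∞ M] [IsManifold 𝓘(ℝ, X n) ∞ F]

instance : TopologicalSpace (J1 B) := (jetCoords B).topology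
instance : ChartedSpace ((X m × X n) × (X m →L[ℝ] X n)) (J1 B) := (jetCoords B).chartedSpace
instance : IsManifold 𝓘(ℝ, (X m × X n) × (X m →L[ℝ] X n)) ∞ (J1 B) := (jetCoords B).isManifold

instance : TopologicalSpace (ExtMom B) := (extMomCoords B).topology
instance : ChartedSpace ((X m × X n) × ((Fin m → (X n →L[ℝ] ℝ)) × ℝ)) (ExtMom B) :=
  (extMomCoords B).chartedSpace
instance : IsManifold 𝓘(ℝ, (X m × X n) × ((Fin m → (X n →L[ℝ] ℝ)) × ℝ)) ∞ (ExtMom B) :=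
  (extMomCoords B).isManifold

instance : TopologicalSpace (RestMom B) := (restMomCoords B).topology
instance : ChartedSpace ((X m × X n) × (Fin m → (X n →L[ℝ] ℝ))) (RestMom B) :=
  (restMomCoords B).chartedSpace
instance : IsManifold 𝓘(ℝ, (X m × X n) × (Fin m → (X n →L[ℝ] ℝ))) ∞ (RestMom B) :=
  (restMomCoords B).isManifold

end Bundles

section Forms

/-- Differential `k`-forms (without regularity) on a manifold `N` modelled on `K`. -/
abbrev DForm (K : Type*) [NormedAddCommGroup K] [NormedSpace ℝ K] (N : Type*) [TopologicalSpace N]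
    [ChartedSpace K N] (k : ℕ) : Type _ :=
  ∀ q : N, TangentSpace 𝓘(ℝ, K) q [⋀^Fin k]→L[ℝ] ℝ

/-- The pull-back `f^* Θ`. -/
def pullback {K K' N N' : Type*} [NormedAddCommGroup K] [NormedSpace ℝ K] [TopologicalSpace N]
    [ChartedSpace K N] [NormedAddCommGroup K'] [NormedSpace ℝ K'] [TopologicalSpace N']
    [ChartedSpace K' N'] {k : ℕ} (f : N → N') (Θ : DForm K' N' k) : DForm K N k :=
  fun q => (Θ (f q)).compContinuousLinearMap (mfderiv 𝓘(ℝ, K) 𝓘(ℝ, K') f q)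

variable {m : ℕ} {M : Type*} [TopologicalSpace M] [ChartedSpace (X m) M]

/-- The function `g` with `ω = g dx¹ ∧ ⋯ ∧ dxᵐ` in the chart `c`. -/
def chartCoeff (vol : DForm (X m) M m) (c : OpenPartialHomeomorph M (X m)) (u : X m) : ℝ :=
  vol (c.symm u) fun i => mfderiv 𝓘(ℝ, X m) 𝓘(ℝ, X m) c.symm u (stdB i)

/-- `ω` is a (smooth, nowhere vanishing) volume form. -/
structure IsVolumeForm (vol : DForm (X m) M m) : Prop where
  ne_zero : ∀ x, vol x ≠ 0
  smooth : ∀ c ∈ IsManifold.maximalAtlas 𝓘(ℝ, X m) ∞ M, ContDiffOn ℝ ∞ (chartCoeff vol c) c.target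

theorem exists_chart_cover (m : ℕ) (M : Type*) [TopologicalSpace M] [ChartedSpace (X m) M]
    [SecondCountableTopology M] [Nonempty M] :
    ∃ p : ℕ → M, ⋃ i, (chartAt (X m) (p i)).source = Set.univ := by
  obtain ⟨s, hs, hcov⟩ := TopologicalSpace.countable_cover_nhds
    (f := fun x : M => (chartAt (X m) x).source) fun x => chart_source_mem_nhds (X m) x
  have hne : s.Nonempty := by
    by_contra h
    rw [Set.not_nonempty_iff_eq_empty] at h
    subst h
    have : (Classical.arbitrary M) ∈ (∅ : Set M) := by
      simpa using hcov.symm.subset (Set.mem_univ (Classical.arbitrary M))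
    exact this
  obtain ⟨p, rfl⟩ := hs.exists_eq_range hne
  exact ⟨p, by simpa using hcov⟩

variable [SecondCountableTopology M] [Nonempty M]

/-- A sequence of charts whose domains cover `M`. -/
def coverChart (m : ℕ) (M : Type*) [TopologicalSpace M] [ChartedSpace (X m) M]
    [SecondCountableTopology M] [Nonempty M] (i : ℕ) : OpenPartialHomeomorph M (X m) :=
  chartAt (X m) ((exists_chart_cover m M).choose i)

variable [MeasurableSpace M]

/-- The measure defined by the volume form `ω` on `M` (oriented by `ω`): in a chart it is
`|g| dx¹⋯dxᵐ`, where `ω = g dx¹ ∧ ⋯ ∧ dxᵐ`. It is glued from the charts of a countable cover, each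
one used on the part of its domain that the previous ones do not cover. -/
def volMeasure (vol : DForm (X m) M m) : MeasureTheory.Measure M :=
  MeasureTheory.Measure.sum fun i : ℕ =>
    ((((MeasureTheory.volume.restrict (coverChart m M i).target).withDensity fun u =>
      ENNReal.ofReal |chartCoeff vol (coverChart m M i) u|).map (coverChart m M i).symm).restrict
        (disjointed (fun j => (coverChart m M j).source) i))

/-- The function `f` with `α = f ω`. -/
def formDensity (vol α : DForm (X m) M m) (x : M) : ℝ :=
  α x (fun i => stdB i) / vol x (fun i => stdB i)

/-- Convergence of `∫_M α`. -/
def FormIntegrable (vol α : DForm (X m) M m) : Prop :=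
  MeasureTheory.Integrable (formDensity vol α) (volMeasure vol)

/-- The integral `∫_M α` of an `m`-form over `M`, oriented by `ω`. -/
def formIntegral (vol α : DForm (X m) M m) : ℝ :=
  ∫ x, formDensity vol α x ∂(volMeasure vol)

end Forms

section Variations

variable {m : ℕ} {M : Type*} [TopologicalSpace M] [ChartedSpace (X m) M]
  {K P : Type*} [NormedAddCommGroup K] [NormedSpace ℝ K] [TopologicalSpace P] [ChartedSpace K P]

/-- The set `Γ(M, P)` of smooth (global) sections of `p : P → M`. -/
structure SmoothSection (m : ℕ) {M : Type*} [TopologicalSpace M] [ChartedSpace (X m) M]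
    (K : Type*) [NormedAddCommGroup K] [NormedSpace ℝ K] [ChartedSpace K P]
    (p : P → M) where
  toFun : M → P
  smooth : ContMDiff 𝓘(ℝ, X m) 𝓘(ℝ, K) ∞ toFun
  proj_toFun : ∀ x, p (toFun x) = x

/-- `Z` is a smooth, compactly supported, `p`-vertical vector field on `P`, and `σ` is its
one-parameter group. (The field `proj_flow` is a consequence of the others; it makes it evident that
`σ_t` acts on sections.) -/
structure IsVerticalFlow (m : ℕ) {M : Type*} [TopologicalSpace M] [ChartedSpace (X m) M]
    [IsManifold 𝓘(ℝ, K) ∞ P] (p : P → M)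
    (Z : ∀ q : P, TangentSpace 𝓘(ℝ, K) q) (σ : ℝ → P → P) : Prop where
  smooth : ContMDiff 𝓘(ℝ, K) 𝓘(ℝ, K).tangent ∞
    (fun q => (⟨q, Z q⟩ : TangentBundle 𝓘(ℝ, K) P))
  vertical : ∀ q, mfderiv 𝓘(ℝ, K) 𝓘(ℝ, X m) p q (Z q) = 0
  compact_support : ∃ C : Set P, IsCompact C ∧ ∀ q ∉ C, Z q = 0
  flow_smooth : ContMDiff (𝓘(ℝ, ℝ).prod 𝓘(ℝ, K)) 𝓘(ℝ, K) ∞ (fun z : ℝ × P => σ z.1 z.2)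
  flow_zero : ∀ q, σ 0 q = q
  flow_integral : ∀ q, IsMIntegralCurve (I := 𝓘(ℝ, K)) (fun t => σ t q) Z
  proj_flow : ∀ t q, p (σ t q) = p q

/-- The variation `σ_t ∘ φ` of a section. -/
def SmoothSection.vary [IsManifold 𝓘(ℝ, K) ∞ P] {p : P → M} (φ : SmoothSection m K p)
    {Z : ∀ q : P, TangentSpace 𝓘(ℝ, K) q} {σ : ℝ → P → P} (h : IsVerticalFlow m p Z σ) (t : ℝ) :
    SmoothSection m K p where
  toFun x := σ t (φ.toFun x)
  smooth := h.flow_smooth.comp (contMDiff_const.prodMk φ.smooth)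
  proj_toFun x := by rw [h.proj_flow, φ.proj_toFun]

end Variations

section Mechanics

variable {m n : ℕ} {M E F : Type*}
  [TopologicalSpace M] [ChartedSpace (X m) M] [IsManifold 𝓘(ℝ, X m) ∞ M]
  [TopologicalSpace E] [ChartedSpace (X m × X n) E] [IsManifold 𝓘(ℝ, X m × X n) ∞ E]
  [TopologicalSpace F] [ChartedSpace (X n) F] [IsManifold 𝓘(ℝ, X n) ∞ F]
  {B : ConfigBundle m n M E F}

/-- The canonical lifting `j¹φ`. -/
def j1 (φ : SmoothSection m (X m × X n) B.proj) (x : M) : J1 B :=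
  ⟨φ.toFun x, ⟨mfderiv 𝓘(ℝ, X m) 𝓘(ℝ, X m × X n) φ.toFun x, by
    have h1 := (B.mdifferentiable_proj (φ.toFun x)).hasMFDerivAt.comp x
      ((φ.smooth x).mdifferentiableAt (by simp)).hasMFDerivAt
    have h2 : B.proj ∘ φ.toFun = id := funext φ.proj_toFun
    rw [h2] at h1
    have h3 := hasMFDerivAt_unique h1 (hasMFDerivAt_id x)
    exact h3⟩⟩

/-- The linear maps `η : T_{π(y)} M → V_y π` into the vertical space, on which the affine space of
`1`-jets at `y` is modelled. -/
def verticalHom (B : ConfigBundle m n M E F) (y : E) : Submodule ℝ (X m →L[ℝ] (X m × X n)) where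
  carrier := {η | ∀ v, B.tproj y (η v) = 0}
  add_mem' := by
    intro a b ha hb v
    exact ((B.tproj y).map_add (a v) (b v)).trans (by rw [ha, hb, add_zero])
  zero_mem' := fun v => (B.tproj y).map_zero
  smul_mem' := by
    intro c a ha v
    exact ((B.tproj y).map_smul c (a v)).trans (by rw [ha, smul_zero])

/-- The affine action `γ + η`. -/
def JetFibre.add {y : E} (γ : JetFibre B y) (η : verticalHom B y) : JetFibre B y :=
  ⟨Add.add (α := X m →L[ℝ] (X m × X n)) γ.1 η.1, by
    refine ContinuousLinearMap.ext fun v => ?_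
    refine ((B.tproj y).map_add (γ.1 v) (η.1 v)).trans ?_
    rw [η.2 v, add_zero]
    exact congrArg (fun L => L v) γ.2⟩

/-- The fibre derivative of `£` at the jet `j = (y, γ)`, i.e. the differential of `£` along the
vertical lifts of `η : T_{π(y)} M → V_y π`; locally `η ↦ (∂£/∂v^A_ν) η^A_ν`. -/
def fibreDeriv (L : J1 B → ℝ) (j : J1 B) : verticalHom B j.proj →L[ℝ] ℝ :=
  fderiv ℝ (fun η : verticalHom B j.proj => L ⟨j.proj, j.snd.add η⟩) 0

/-- `Z ↦ Z - γ(T π Z)`; locally `(dy^A - v^A_ν dx^ν) ⊗ ∂/∂y^A`. -/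
def verticalPart (j : J1 B) : (X m × X n) →L[ℝ] (X m × X n) :=
  ContinuousLinearMap.id ℝ _ - j.snd.1.comp (B.tproj j.proj)

theorem tproj_verticalPart (j : J1 B) (z : X m × X n) :
    B.tproj j.proj (verticalPart j z) = 0 := by
  refine ((B.tproj j.proj).map_sub z (j.snd.1 (B.tproj j.proj z))).trans ?_
  rw [sub_eq_zero]
  exact (congrArg (fun L => L (B.tproj j.proj z)) j.snd.2).symm

/-- `Z ↦ e^μ ⊗ (Z - γ(T π Z))`, where `e^μ` is the dual of the basis `e_μ` of `T_{π(y)} M`. -/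
def tensorVertical (j : J1 B) (μ : Fin m) : (X m × X n) →L[ℝ] verticalHom B j.proj :=
  ((ContinuousLinearMap.smulRightL ℝ (X m) (X m × X n) (EuclideanSpace.proj μ)).comp
    (verticalPart j)).codRestrict (verticalHom B j.proj) fun z v =>
      ((B.tproj j.proj).map_smul (v μ) (verticalPart j z)).trans
        (by rw [tproj_verticalPart, smul_zero])

/-- The contraction of `d£` with the vertical endomorphism:
`Z ↦ ∑_μ d£(e^μ ⊗ (Z - γ(T π Z))) e_μ`; locally
`(∂£/∂v^A_μ) (dy^A - v^A_ν dx^ν) ⊗ ∂/∂x^μ`. -/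
def momentum (L : J1 B → ℝ) (j : J1 B) :
    TangentSpace 𝓘(ℝ, X m × X n) j.proj →L[ℝ] TangentSpace 𝓘(ℝ, X m) (B.proj j.proj) :=
  (∑ μ : Fin m, ((fibreDeriv L j).comp (tensorVertical j μ)).smulRight (stdB μ) :
    (X m × X n) →L[ℝ] X m)

/-- `T_j π¹ : T_j J¹π → T_y E`. -/
abbrev tproj1 (j : J1 B) : TangentSpace 𝓘(ℝ, (X m × X n) × (X m →L[ℝ] X n)) j →L[ℝ]
    TangentSpace 𝓘(ℝ, X m × X n) j.proj :=
  mfderiv 𝓘(ℝ, (X m × X n) × (X m →L[ℝ] X n)) 𝓘(ℝ, X m × X n)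
    (Bundle.TotalSpace.proj : J1 B → E) j

/-- The Poincaré–Cartan form `Θ_ℒ = i(𝒱)ℒ + ℒ` of the Lagrangian density `ℒ = £ ω`; locally
`(∂£/∂v^A_ν) (dy^A - v^A_μ dx^μ) ∧ i(∂/∂x^ν) ω + £ ω`. -/
def poincareCartan (vol : DForm (X m) M m) (L : J1 B → ℝ) :
    DForm ((X m × X n) × (X m →L[ℝ] X n)) (J1 B) m := fun j =>
  insertForm (vol (B.proj j.proj)) ((B.tproj j.proj).comp (tproj1 j))
      ((momentum L j).comp (tproj1 j))
    + L j • (vol (B.proj j.proj)).compContinuousLinearMap ((B.tproj j.proj).comp (tproj1 j))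

/-- The extended Legendre map `J¹π → ℳπ`. It satisfies the defining relation
`FL~(j)(Z_1, …, Z_m) = Θ_ℒ(j)(Z'_1, …, Z'_m)` for all `Z'_i` with `T π¹ Z'_i = Z_i`:
see `extLegendre_apply`. -/
def extLegendre (vol : DForm (X m) M m) (L : J1 B → ℝ) (j : J1 B) : ExtMom B :=
  ⟨j.proj, ⟨insertForm (vol (B.proj j.proj)) (B.tproj j.proj) (momentum L j)
    + L j • (vol (B.proj j.proj)).compContinuousLinearMap (B.tproj j.proj),
    Submodule.add_mem _ (insertForm_mem _ _ _) (Submodule.smul_mem _ _ (comp_mem _ _))⟩⟩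

theorem extLegendre_apply (vol : DForm (X m) M m) (L : J1 B → ℝ) (j : J1 B)
    (Z : Fin m → TangentSpace 𝓘(ℝ, (X m × X n) × (X m →L[ℝ] X n)) j) :
    (extLegendre vol L j).snd.1 (fun i => tproj1 j (Z i)) = poincareCartan vol L j Z := by
  rw [poincareCartan, ContinuousAlternatingMap.add_apply, insertForm_apply]
  refine (ContinuousAlternatingMap.add_apply _ _ _).trans ?_
  rw [insertForm_apply]
  rfl

/-- The projection `μ : ℳπ → J¹π^*`. -/
def toRest (α : ExtMom B) : RestMom B := ⟨α.proj, Quotient.mk _ α.snd⟩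

/-- The restricted Legendre map `FL : J¹π → J¹π^*`. -/
def legendre (vol : DForm (X m) M m) (L : J1 B → ℝ) (j : J1 B) : RestMom B :=
  toRest (extLegendre vol L j)

/-- Hyper-regularity: `FL` is a global diffeomorphism. -/
def IsHyperRegular (vol : DForm (X m) M m) (L : J1 B → ℝ) : Prop :=
  ∃ Φ : Diffeomorph 𝓘(ℝ, (X m × X n) × (X m →L[ℝ] X n))
    𝓘(ℝ, (X m × X n) × (Fin m → (X n →L[ℝ] ℝ))) (J1 B) (RestMom B) ∞, ⇑Φ = legendre vol L

/-- The Hamiltonian section `h = FL~ ∘ FL⁻¹ : J¹π^* → ℳπ` of a hyper-regular Lagrangian system. -/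
def hamiltonianSection {vol : DForm (X m) M m} {L : J1 B → ℝ} (H : IsHyperRegular vol L) :
    RestMom B → ExtMom B :=
  extLegendre vol L ∘ H.choose.symm

/-- The tautological form `Θ` on `ℳπ`. -/
def tautForm (B : ConfigBundle m n M E F) :
    DForm ((X m × X n) × ((Fin m → (X n →L[ℝ] ℝ)) × ℝ)) (ExtMom B) m := fun α =>
  α.snd.1.compContinuousLinearMap
    (mfderiv 𝓘(ℝ, (X m × X n) × ((Fin m → (X n →L[ℝ] ℝ)) × ℝ)) 𝓘(ℝ, X m × X n)
      (Bundle.TotalSpace.proj : ExtMom B → E) α)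

/-- The Hamilton–Cartan form `Θ_h = h^* Θ`. -/
def hamiltonCartan (h : RestMom B → ExtMom B) :
    DForm ((X m × X n) × (Fin m → (X n →L[ℝ] ℝ))) (RestMom B) m :=
  pullback h (tautForm B)

/-- `τ̄ = π ∘ τ : J¹π^* → M`. -/
def restProj (B : ConfigBundle m n M E F) (q : RestMom B) : M := B.proj q.proj

variable [SecondCountableTopology M] [Nonempty M] [MeasurableSpace M]

/-- The Hamilton principle: `φ` is critical for `φ ↦ ∫_M (j¹φ)^* Θ_ℒ`. -/
def HamiltonPrinciple (vol : DForm (X m) M m) (L : J1 B → ℝ)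
    (φ : SmoothSection m (X m × X n) B.proj) : Prop :=
  FormIntegrable vol (pullback (j1 φ) (poincareCartan vol L)) ∧
  ∀ (Z : ∀ y : E, TangentSpace 𝓘(ℝ, X m × X n) y) (σ : ℝ → E → E)
    (hσ : IsVerticalFlow m B.proj Z σ),
    HasDerivAt (fun t => formIntegral vol (pullback (j1 (φ.vary hσ t)) (poincareCartan vol L))) 0 0

/-- The Hamilton–Jacobi principle: `ψ` is critical for `ψ ↦ ∫_M ψ^* Θ_h`. -/
def HamiltonJacobiPrinciple (vol : DForm (X m) M m) (h : RestMom B → ExtMom B)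
    (ψ : SmoothSection m ((X m × X n) × (Fin m → (X n →L[ℝ] ℝ))) (restProj B)) : Prop :=
  FormIntegrable vol (pullback ψ.toFun (hamiltonCartan h)) ∧
  ∀ (Z : ∀ q : RestMom B, TangentSpace 𝓘(ℝ, (X m × X n) × (Fin m → (X n →L[ℝ] ℝ))) q)
    (σ : ℝ → RestMom B → RestMom B) (hσ : IsVerticalFlow m (restProj B) Z σ),
    HasDerivAt (fun t => formIntegral vol (pullback (ψ.vary hσ t).toFun (hamiltonCartan h))) 0 0

end Mechanics

end FieldTheory

end

open FieldTheory

/-! A section $J$ of $J^1\pi\to M$ lies over a section $\phi$ of $\pi$. In adapted coordinates let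
$v$ be the fibre coordinate of $J$ and $A$ the matrix of $T\phi$; the two agree exactly when
$J=j^1\phi$. Evaluating the extended Legendre map at $J$ on the tangent vectors of $\phi$ gives,
relative to $\omega$, the density $£+\frac{\partial £}{\partial v}(A-v)$ (`extLegendre_section`,
`jetDensity_eq`). Both action functionals are integrals of this one density: with $J=j^1\phi$ for
the Hamilton principle (`formDensity_poincareCartan`), and, because $\Theta$ is tautological, with
$J=FL^{-1}\circ\psi$ for the Hamilton–Jacobi principle (`formDensity_hamiltonCartan`). Variations of
either kind thus become families of sections of $J^1\pi\to M$ that are constant off a compact set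
(`IsJetFamily`).

The derivative of the density at $t=0$ has two terms (`firstVar_eq`): the linearised Lagrangian on
the prolongation of the base variation $\eta$, and the derivative of $\partial £/\partial v$ applied
to $A-v$. If $J_0=j^1\phi$, the second term vanishes, so the first variation depends linearly on
$\eta$ alone, even when the other members of the family are not holonomic (`firstVar_holonomic`).
Consequently variations of $j^1\phi$ by jets of sections and variations in $J^1\pi^*$ test the same
condition, expressed by `IsLocallyCritical`. A partition of unity passes from this local condition
to all families (`IsLocallyCritical.integral_eq_zero`), hence to both principles. In the other
direction, a solution of the Hamilton principle is tested with flows along the coordinate fields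
$\partial/\partial y^A$.

For a solution $\psi$ of the Hamilton–Jacobi principle, hyper-regularity allows the momenta to be
varied alone. Then $\eta=0$ and only the second term remains (`firstVar_momentum`), so the
fundamental lemma of the calculus of variations forces $A=v$, that is
$FL^{-1}\circ\psi=j^1(\tau\circ\psi)$ (`HamiltonJacobiPrinciple.holonomic`). Variation along
$\partial/\partial y^A$ in $J^1\pi^*$ then gives local criticality of $\tau\circ\psi$.

Each test requires a compactly supported vertical field with a global smooth flow and prescribed
velocity along the section. Such flows are written down explicitly (`exists_verticalFlow_tangent`),
from a flow on the line supported in $[-1,1]$. -/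

noncomputable section

namespace FieldTheory

/-! ### An explicit smooth flow on the line, supported in $[-1,1]$. -/

/-- A smooth odd increasing diffeomorphism from `(-1, 1)` onto `ℝ`, equal to `exp (1 / (1 - s))`
near `1`. -/
def lineTime (s : ℝ) : ℝ :=
  Real.smoothTransition (s + 1 / 2) * Real.exp (1 / (1 - s))
    - Real.smoothTransition (-s + 1 / 2) * Real.exp (1 / (1 + s))

theorem lineTime_neg (s : ℝ) : lineTime (-s) = -lineTime s := by
  simp only [lineTime, neg_neg, sub_neg_eq_add, ← sub_eq_add_neg]
  ring

theorem lineTime_of_half_le {s : ℝ} (h : 1 / 2 ≤ s) : lineTime s = Real.exp (1 / (1 - s)) := by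
  rw [lineTime, Real.smoothTransition.one_of_one_le (by linarith),
    Real.smoothTransition.zero_of_nonpos (by linarith)]
  ring

theorem contDiffAt_lineTime {s : ℝ} (h : s ∈ Set.Ioo (-1 : ℝ) 1) : ContDiffAt ℝ ∞ lineTime s := by
  have h1 : 1 - s ≠ 0 := by linarith [h.2]
  have h2 : 1 + s ≠ 0 := by linarith [h.1]
  have hS : ContDiff ℝ ∞ Real.smoothTransition := Real.smoothTransition.contDiff
  unfold lineTime
  refine ContDiffAt.sub (ContDiffAt.mul ?_ ?_) (ContDiffAt.mul ?_ ?_)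
  · exact (hS.comp (contDiff_id.add contDiff_const)).contDiffAt
  · exact (contDiffAt_const.div (contDiffAt_const.sub contDiffAt_id) h1).exp
  · exact (hS.comp (contDiff_neg.add contDiff_const)).contDiffAt
  · exact (contDiffAt_const.div (contDiffAt_const.add contDiffAt_id) h2).exp

theorem deriv_lineTime_pos {s : ℝ} (h : s ∈ Set.Ioo (-1 : ℝ) 1) : 0 < deriv lineTime s := by
  have h1 : 0 < 1 - s := by linarith [h.2]
  have h2 : 0 < 1 + s := by linarith [h.1]
  have hS : Differentiable ℝ Real.smoothTransition :=
    (Real.smoothTransition.contDiff (n := 1)).differentiable (by simp)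
  have hm : ∀ x, 0 ≤ deriv Real.smoothTransition x := fun x =>
    Real.smoothTransition.monotone.deriv_nonneg
  have d1 : HasDerivAt (fun s : ℝ => Real.smoothTransition (s + 1 / 2))
      (deriv Real.smoothTransition (s + 1 / 2)) s := by
    exact (hS (s + 1 / 2)).hasDerivAt.comp_add_const s (1 / 2)
  have d2 : HasDerivAt (fun s : ℝ => Real.smoothTransition (-s + 1 / 2))
      (-deriv Real.smoothTransition (-s + 1 / 2)) s := by
    have h : HasDerivAt (fun s : ℝ => -s + 1 / 2) (-1) s := (hasDerivAt_neg s).add_const (1 / 2)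
    have h' : HasDerivAt (Real.smoothTransition ∘ fun s : ℝ => -s + 1 / 2) _ s :=
      HasDerivAt.comp s (hS (-s + 1 / 2)).hasDerivAt h
    rw [mul_neg_one] at h'
    exact h'
  have d3 : HasDerivAt (fun s : ℝ => Real.exp (1 / (1 - s)))
      (Real.exp (1 / (1 - s)) * (1 / (1 - s) ^ 2)) s := by
    have := (((hasDerivAt_id s).const_sub 1).inv (by simpa using h1.ne')).exp
    simpa [one_div] using this
  have d4 : HasDerivAt (fun s : ℝ => Real.exp (1 / (1 + s)))
      (Real.exp (1 / (1 + s)) * (-1 / (1 + s) ^ 2)) s := by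
    have := (((hasDerivAt_id s).const_add 1).inv (by simpa using h2.ne')).exp
    simpa [one_div] using this
  have d := (d1.mul d3).sub (d2.mul d4)
  have e : deriv lineTime s = _ := HasDerivAt.deriv (f := lineTime) d
  rw [e]
  have a1 := mul_nonneg (hm (s + 1 / 2)) (Real.exp_pos (1 / (1 - s))).le
  have a2 := mul_nonneg (hm (-s + 1 / 2)) (Real.exp_pos (1 / (1 + s))).le
  have q1 : 0 < Real.exp (1 / (1 - s)) * (1 / (1 - s) ^ 2) := by positivity
  have q2 : 0 < Real.exp (1 / (1 + s)) * (1 / (1 + s) ^ 2) := by positivity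
  have b1 := mul_nonneg (Real.smoothTransition.nonneg (s + 1 / 2)) q1.le
  have b2 := mul_nonneg (Real.smoothTransition.nonneg (-s + 1 / 2)) q2.le
  have e2 : Real.exp (1 / (1 + s)) * (-1 / (1 + s) ^ 2)
      = -(Real.exp (1 / (1 + s)) * (1 / (1 + s) ^ 2)) := by ring
  rw [e2]
  -- All terms of the derivative are nonnegative, and at every $s$ at least one of the two cutoffs
  -- is strictly positive.
  rcases le_or_gt 0 s with h0 | h0
  · have := mul_pos (Real.smoothTransition.pos_of_pos (x := s + 1 / 2) (by linarith)) q1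
    linarith
  · have := mul_pos (Real.smoothTransition.pos_of_pos (x := -s + 1 / 2) (by linarith)) q2
    linarith

theorem strictMonoOn_lineTime : StrictMonoOn lineTime (Set.Ioo (-1) 1) := by
  refine strictMonoOn_of_deriv_pos (convex_Ioo _ _)
    (fun s hs => (contDiffAt_lineTime hs).continuousAt.continuousWithinAt) fun s hs => ?_
  rw [interior_Ioo] at hs
  exact deriv_lineTime_pos hs

theorem exists_lineTime_eq (z : ℝ) : ∃ s ∈ Set.Ioo (-1 : ℝ) 1, lineTime s = z := by
  -- Since $A\ge 2$, the point $1-1/A$ lies in $[1/2,1)$, where `lineTime` takes the value $e^A\ge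
  -- A+1>|z|$.
  set A := |z| + 2 with hA
  have hA2 : 2 ≤ A := by linarith [abs_nonneg z]
  have hr : 1 / A ≤ 1 / 2 := one_div_le_one_div_of_le (by norm_num) hA2
  have hr0 : 0 < 1 / A := by positivity
  have h1 : |z| ≤ lineTime (1 - 1 / A) := by
    rw [lineTime_of_half_le (by linarith)]
    have : 1 / (1 - (1 - 1 / A)) = A := by field_simp; ring
    rw [this]
    linarith [Real.add_one_le_exp A]
  have h2 : lineTime (-(1 - 1 / A)) ≤ -|z| := by rw [lineTime_neg]; linarith
  have hsub : Set.Icc (-(1 - 1 / A)) (1 - 1 / A) ⊆ Set.Ioo (-1) 1 := fun x hx =>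
    ⟨by linarith [hx.1], by linarith [hx.2]⟩
  have hc : ContinuousOn lineTime (Set.Icc (-(1 - 1 / A)) (1 - 1 / A)) := fun x hx =>
    (contDiffAt_lineTime (hsub hx)).continuousAt.continuousWithinAt
  obtain ⟨s, hs, h⟩ := intermediate_value_Icc (by linarith) hc
    (show z ∈ Set.Icc _ _ from ⟨h2.trans (neg_abs_le z), (le_abs_self z).trans h1⟩)
  exact ⟨s, hsub hs, h⟩

/-- The inverse of `lineTime`. -/
def linePos (z : ℝ) : ℝ := (exists_lineTime_eq z).choose

theorem linePos_mem (z : ℝ) : linePos z ∈ Set.Ioo (-1 : ℝ) 1 := (exists_lineTime_eq z).choose_spec.1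

theorem lineTime_linePos (z : ℝ) : lineTime (linePos z) = z := (exists_lineTime_eq z).choose_spec.2

theorem linePos_eq {s z : ℝ} (h : s ∈ Set.Ioo (-1 : ℝ) 1) (hz : lineTime s = z) :
    linePos z = s :=
  strictMonoOn_lineTime.injOn (linePos_mem z) h ((lineTime_linePos z).trans hz.symm)

theorem hasDerivAt_lineTime {s : ℝ} (h : s ∈ Set.Ioo (-1 : ℝ) 1) :
    HasDerivAt lineTime (deriv lineTime s) s :=
  ((contDiffAt_lineTime h).differentiableAt (by simp)).hasDerivAt

/-- The inverse function theorem gives a smooth local inverse with values in $(-1,1)$ near each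
point; injectivity of `lineTime` there identifies it with `linePos`. -/
theorem contDiff_linePos : ContDiff ℝ ∞ linePos := by
  rw [contDiff_iff_contDiffAt]
  intro z
  set s := linePos z with hs
  have hm : s ∈ Set.Ioo (-1 : ℝ) 1 := linePos_mem z
  have hsm := contDiffAt_lineTime hm
  have hd : HasFDerivAt lineTime
      ((ContinuousLinearEquiv.unitsEquivAut ℝ (Units.mk0 _ (deriv_lineTime_pos hm).ne') :
        ℝ ≃L[ℝ] ℝ) : ℝ →L[ℝ] ℝ) s := by
    refine (hasDerivAt_lineTime hm).hasFDerivAt.congr_fderiv ?_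
    ext
    simp
  have key := hsm.to_localInverse hd (by simp)
  have hz : lineTime s = z := lineTime_linePos z
  rw [hz] at key
  refine key.congr_of_eventuallyEq ?_
  have hst := hsm.hasStrictFDerivAt' hd (by simp)
  have h1 : ∀ᶠ y in 𝓝 z, lineTime (hsm.localInverse hd (by simp) y) = y := by
    have := hst.eventually_right_inverse
    rw [hz] at this
    exact this
  have h2 : ∀ᶠ y in 𝓝 z, hsm.localInverse hd (by simp) y ∈ Set.Ioo (-1 : ℝ) 1 := by
    have hcont := key.continuousAt
    have hv : hsm.localInverse hd (by simp) z = s := by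
      have := hst.localInverse_apply_image
      rw [hz] at this
      exact this
    refine hcont.eventually ?_
    rw [hv]
    exact isOpen_Ioo.mem_nhds hm
  filter_upwards [h1, h2] with y hy1 hy2
  exact linePos_eq hy2 hy1

open Classical in
/-- A smooth one-parameter group of diffeomorphisms of `ℝ`, supported in `[-1, 1]`. -/
def lineFlow (t s : ℝ) : ℝ := if s ∈ Set.Ioo (-1 : ℝ) 1 then linePos (lineTime s + t) else s

theorem lineFlow_of_mem {t s : ℝ} (h : s ∈ Set.Ioo (-1 : ℝ) 1) :
    lineFlow t s = linePos (lineTime s + t) := if_pos h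

theorem lineFlow_of_notMem {t s : ℝ} (h : s ∉ Set.Ioo (-1 : ℝ) 1) : lineFlow t s = s := if_neg h

theorem lineFlow_mem {t s : ℝ} (h : s ∈ Set.Ioo (-1 : ℝ) 1) :
    lineFlow t s ∈ Set.Ioo (-1 : ℝ) 1 := by
  rw [lineFlow_of_mem h]; exact linePos_mem _

theorem lineFlow_zero (s : ℝ) : lineFlow 0 s = s := by
  by_cases h : s ∈ Set.Ioo (-1 : ℝ) 1
  · rw [lineFlow_of_mem h, add_zero, linePos_eq h rfl]
  · exact lineFlow_of_notMem h

theorem lineFlow_add (t t' s : ℝ) : lineFlow (t + t') s = lineFlow t (lineFlow t' s) := by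
  by_cases h : s ∈ Set.Ioo (-1 : ℝ) 1
  · rw [lineFlow_of_mem (lineFlow_mem h), lineFlow_of_mem h, lineFlow_of_mem h, lineTime_linePos]
    congr 1; ring
  · rw [lineFlow_of_notMem h, lineFlow_of_notMem h, lineFlow_of_notMem h]

theorem lineFlow_neg (t s : ℝ) : lineFlow (-t) (-s) = -lineFlow t s := by
  by_cases h : s ∈ Set.Ioo (-1 : ℝ) 1
  · have h' : -s ∈ Set.Ioo (-1 : ℝ) 1 := ⟨by linarith [h.2], by linarith [h.1]⟩
    have hm := linePos_mem (lineTime s + t)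
    rw [lineFlow_of_mem h, lineFlow_of_mem h']
    refine linePos_eq ⟨by linarith [hm.2], by linarith [hm.1]⟩ ?_
    rw [lineTime_neg, lineTime_neg, lineTime_linePos]; ring
  · have h' : -s ∉ Set.Ioo (-1 : ℝ) 1 := fun h' => h ⟨by linarith [h'.2], by linarith [h'.1]⟩
    rw [lineFlow_of_notMem h, lineFlow_of_notMem h']

/-- In the coordinate `lineTime` the flow is a translation, so its speed is the reciprocal of a
positive derivative. The speed never vanishes in the interior and can be divided out when a velocity
is prescribed. -/
theorem hasDerivAt_lineFlow {s : ℝ} (h : s ∈ Set.Ioo (-1 : ℝ) 1) :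
    HasDerivAt (fun t => lineFlow t s) (deriv lineTime s)⁻¹ 0 := by
  have h1 : HasDerivAt linePos (deriv lineTime s)⁻¹ (lineTime s) := by
    have := hasDerivAt_lineTime h
    refine HasDerivAt.of_local_left_inverse (f := lineTime) ?_ ?_ (deriv_lineTime_pos h).ne' ?_
    · exact contDiff_linePos.continuous.continuousAt
    · rwa [linePos_eq h rfl]
    · exact Filter.Eventually.of_forall lineTime_linePos
  have h2 : HasDerivAt (fun t => lineTime s + t) 1 0 := by
    simpa using (hasDerivAt_id (0 : ℝ)).const_add (lineTime s)
  have h3 : HasDerivAt linePos (deriv lineTime s)⁻¹ (lineTime s + 0) := by rwa [add_zero]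
  refine ((h3.comp (0 : ℝ) h2).congr_deriv (mul_one _)).congr_of_eventuallyEq ?_
  exact Filter.Eventually.of_forall fun t => lineFlow_of_mem h

/-- Put $r=1-s$ and let $E(r)=e^{-1/r}$, extended by $0$ to $r\le 0$. Solving $e^{1/r'}=e^{1/r}+t$
gives $r'=r/(1+r\log(1+tE(r)))$. This is smooth across $r=0$ and reduces to $r'=r$ for $r\le 0$,
where the flow is the identity; this is why `lineTime` grows like $e^{1/r}$ at the end of the
interval. -/
theorem lineFlow_near_one (t₀ : ℝ) :
    ContDiffAt ℝ ∞ (fun z : ℝ × ℝ => lineFlow z.1 z.2) (t₀, 1) := by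
  have hE : ContDiff ℝ ∞ expNegInvGlue := expNegInvGlue.contDiff
  have hEz : ContDiff ℝ ∞ (fun z : ℝ × ℝ => 1 + z.1 * expNegInvGlue (1 - z.2)) :=
    contDiff_const.add (contDiff_fst.mul (hE.comp (contDiff_const.sub contDiff_snd)))
  have e0 : (1 : ℝ) + t₀ * expNegInvGlue (1 - 1) = 1 := by
    rw [sub_self, expNegInvGlue.zero, mul_zero, add_zero]
  set D : ℝ × ℝ → ℝ := fun z => 1 + (1 - z.2) * Real.log (1 + z.1 * expNegInvGlue (1 - z.2)) with hD
  have hDs : ContDiffAt ℝ ∞ D (t₀, 1) := by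
    refine contDiffAt_const.add (ContDiffAt.mul (contDiff_const.sub contDiff_snd).contDiffAt ?_)
    refine hEz.contDiffAt.log ?_
    simp only [e0]; norm_num
  have hD1 : D (t₀, 1) = 1 := by simp [hD]
  set R : ℝ × ℝ → ℝ := fun z => (1 - z.2) / D z with hR
  have hRs : ContDiffAt ℝ ∞ R (t₀, 1) :=
    ContDiffAt.div (contDiff_const.sub contDiff_snd).contDiffAt hDs (by rw [hD1]; norm_num)
  have hR0 : R (t₀, 1) = 0 := by simp [hR]
  have key : ContDiffAt ℝ ∞ (fun z => 1 - R z) (t₀, 1) := contDiffAt_const.sub hRs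
  refine key.congr_of_eventuallyEq ?_
  have c1 : ∀ᶠ z in 𝓝 (t₀, (1 : ℝ)), 0 < 1 + z.1 * expNegInvGlue (1 - z.2) :=
    hEz.continuous.continuousAt.eventually (lt_mem_nhds (by simp only [e0]; norm_num))
  have c2 : ∀ᶠ z in 𝓝 (t₀, (1 : ℝ)), 0 < D z :=
    hDs.continuousAt.eventually (lt_mem_nhds (by rw [hD1]; norm_num))
  have c3 : ∀ᶠ z in 𝓝 (t₀, (1 : ℝ)), R z < 1 / 2 :=
    hRs.continuousAt.eventually (gt_mem_nhds (by rw [hR0]; norm_num))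
  have c4 : ∀ᶠ z in 𝓝 (t₀, (1 : ℝ)), 1 / 2 < z.2 :=
    continuous_snd.continuousAt.eventually (lt_mem_nhds (by norm_num))
  filter_upwards [c1, c2, c3, c4] with z h1 h2 h3 h4
  by_cases hs : z.2 < 1
  · have hm : z.2 ∈ Set.Ioo (-1 : ℝ) 1 := ⟨by linarith, hs⟩
    have hr : 0 < 1 - z.2 := by linarith
    have hRp : 0 < R z := div_pos hr h2
    rw [lineFlow_of_mem hm]
    refine linePos_eq ⟨by linarith, by linarith⟩ ?_
    rw [lineTime_of_half_le (by linarith), lineTime_of_half_le h4.le, sub_sub_cancel]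
    have hE1 : expNegInvGlue (1 - z.2) = Real.exp (-(1 / (1 - z.2))) := by
      simp [expNegInvGlue, not_le.mpr hr]
    have : 1 / R z = 1 / (1 - z.2) + Real.log (1 + z.1 * expNegInvGlue (1 - z.2)) := by
      rw [hR]; simp only [hD, one_div_div]
      field_simp
    rw [this, Real.exp_add, Real.exp_log h1, hE1, Real.exp_neg]
    field_simp
  · have hm : z.2 ∉ Set.Ioo (-1 : ℝ) 1 := fun h => hs h.2
    have hE0 : expNegInvGlue (1 - z.2) = 0 := expNegInvGlue.zero_of_nonpos (by linarith)
    rw [lineFlow_of_notMem hm]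
    simp [hR, hD, hE0]

theorem contDiff_lineFlow : ContDiff ℝ ∞ (fun z : ℝ × ℝ => lineFlow z.1 z.2) := by
  rw [contDiff_iff_contDiffAt]
  rintro ⟨t, s⟩
  rcases lt_trichotomy s 1 with h1 | rfl | h1
  · rcases lt_trichotomy (-1) s with h2 | rfl | h2
    · have hm : s ∈ Set.Ioo (-1 : ℝ) 1 := ⟨h2, h1⟩
      have : ContDiffAt ℝ ∞ (fun z : ℝ × ℝ => linePos (lineTime z.2 + z.1)) (t, s) := by
        refine contDiff_linePos.contDiffAt.comp _ (ContDiffAt.add ?_ contDiff_fst.contDiffAt)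
        exact ContDiffAt.comp (t, s) (contDiffAt_lineTime hm) contDiff_snd.contDiffAt
      refine this.congr_of_eventuallyEq ?_
      filter_upwards [continuous_snd.continuousAt.eventually (isOpen_Ioo.mem_nhds hm)] with z hz
      exact lineFlow_of_mem hz
    -- The end $-1$ reduces to the end $1$ by the oddness `lineFlow_neg`.
    · have h := lineFlow_near_one (-t)
      have h' : ContDiffAt ℝ ∞ (fun z : ℝ × ℝ => (-z.1, -z.2)) (t, -1) :=
        (contDiff_fst.neg.prodMk contDiff_snd.neg).contDiffAt
      have e : ((-t, (1 : ℝ)) : ℝ × ℝ) = (fun z : ℝ × ℝ => (-z.1, -z.2)) (t, -1) := by simp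
      rw [e] at h
      have := (ContDiffAt.comp (t, (-1 : ℝ)) h h').neg
      refine this.congr_of_eventuallyEq (Filter.Eventually.of_forall fun z => ?_)
      simp [lineFlow_neg]
    · refine contDiff_snd.contDiffAt.congr_of_eventuallyEq ?_
      filter_upwards [continuous_snd.continuousAt.eventually (gt_mem_nhds h2)] with z hz
      exact lineFlow_of_notMem fun h => lt_asymm hz h.1
  · exact lineFlow_near_one t
  · refine contDiff_snd.contDiffAt.congr_of_eventuallyEq ?_
    filter_upwards [continuous_snd.continuousAt.eventually (lt_mem_nhds h1)] with z hz
    exact lineFlow_of_notMem fun h => lt_asymm hz h.2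


/-! ### The line flow carried to a normed space along a vector. -/

section Slide

variable {K : Type*} [NormedAddCommGroup K] [NormedSpace ℝ K]

/-- The projection onto `u₀ + ker ℓ` along `w`. -/
def slideProj (ℓ : K →L[ℝ] ℝ) (w u₀ u : K) : K := u - ℓ (u - u₀) • w

/-- The shift along `w` by the flow of the line, rescaled to `|ℓ (u - u₀)| < r`. -/
def slide (ℓ : K →L[ℝ] ℝ) (w u₀ : K) (r c : ℝ) (u : K) : K :=
  u + (r * lineFlow c (ℓ (u - u₀) / r) - ℓ (u - u₀)) • w

/-- The compact region inside of which `slide` is used. -/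
def slideBox (ℓ : K →L[ℝ] ℝ) (w u₀ : K) (r : ℝ) : Set K :=
  {u | |ℓ (u - u₀)| ≤ r ∧ slideProj ℓ w u₀ u ∈ Metric.closedBall u₀ r}

variable {ℓ : K →L[ℝ] ℝ} {w u₀ : K} {r : ℝ}

theorem slide_coord (hw : ℓ w = 1) (c : ℝ) (u : K) :
    ℓ (slide ℓ w u₀ r c u - u₀) = r * lineFlow c (ℓ (u - u₀) / r) := by
  rw [slide, add_sub_right_comm, map_add, map_smul, hw, smul_eq_mul]; ring

theorem slideProj_slide (hw : ℓ w = 1) (c : ℝ) (u : K) :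
    slideProj ℓ w u₀ (slide ℓ w u₀ r c u) = slideProj ℓ w u₀ u := by
  rw [slideProj, slide_coord hw, slide, slideProj]; module

theorem slide_zero (hr : 0 < r) (u : K) : slide ℓ w u₀ r 0 u = u := by
  rw [slide, lineFlow_zero, mul_div_cancel₀ _ hr.ne', sub_self, zero_smul, add_zero]

theorem slide_add (hw : ℓ w = 1) (hr : 0 < r) (c c' : ℝ) (u : K) :
    slide ℓ w u₀ r (c + c') u = slide ℓ w u₀ r c (slide ℓ w u₀ r c' u) := by
  rw [slide, slide, slide_coord hw, mul_div_cancel_left₀ _ hr.ne', lineFlow_add, slide]; module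

theorem slide_eq_self (hr : 0 < r) {u : K} (h : r < |ℓ (u - u₀)|) (c : ℝ) :
    slide ℓ w u₀ r c u = u := by
  rw [slide, lineFlow_of_notMem, mul_div_cancel₀ _ hr.ne', sub_self, zero_smul, add_zero]
  rintro ⟨h1, h2⟩
  rw [lt_div_iff₀ hr] at h1
  rw [div_lt_iff₀ hr] at h2
  exact absurd (abs_lt.mpr ⟨by linarith, by linarith⟩) (not_lt.mpr h.le)

theorem slide_mem_box (hw : ℓ w = 1) (hr : 0 < r) {u : K} (h : u ∈ slideBox ℓ w u₀ r) (c : ℝ) :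
    slide ℓ w u₀ r c u ∈ slideBox ℓ w u₀ r := by
  refine ⟨?_, by rw [slideProj_slide hw]; exact h.2⟩
  rw [slide_coord hw]
  by_cases hm : ℓ (u - u₀) / r ∈ Set.Ioo (-1 : ℝ) 1
  · rw [abs_mul, abs_of_pos hr]
    have := lineFlow_mem (t := c) hm
    have : |lineFlow c (ℓ (u - u₀) / r)| ≤ 1 := abs_le.mpr ⟨this.1.le, this.2.le⟩
    nlinarith
  · rw [lineFlow_of_notMem hm, mul_div_cancel₀ _ hr.ne']
    exact h.1

theorem contDiff_slide : ContDiff ℝ ∞ (fun z : ℝ × K => slide ℓ w u₀ r z.1 z.2) := by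
  have h : ContDiff ℝ ∞ (fun z : ℝ × K => ℓ (z.2 - u₀)) :=
    ℓ.contDiff.comp (contDiff_snd.sub contDiff_const)
  refine contDiff_snd.add (ContDiff.smul (ContDiff.sub (contDiff_const.mul ?_) h) contDiff_const)
  exact contDiff_lineFlow.comp (contDiff_fst.prodMk (h.div_const r))

theorem contDiff_slideProj : ContDiff ℝ ∞ (slideProj ℓ w u₀) :=
  contDiff_id.sub ((ℓ.contDiff.comp (contDiff_id.sub contDiff_const)).smul contDiff_const)

theorem hasDerivAt_slide (hr : 0 < r) {u : K} (h : |ℓ (u - u₀)| < r) (b : ℝ) :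
    HasDerivAt (fun t : ℝ => slide ℓ w u₀ r (t * b) u)
      ((r * ((deriv lineTime (ℓ (u - u₀) / r))⁻¹ * b)) • w) 0 := by
  have hm : ℓ (u - u₀) / r ∈ Set.Ioo (-1 : ℝ) 1 := by
    rw [abs_lt] at h
    exact ⟨by rw [lt_div_iff₀ hr]; linarith, by rw [div_lt_iff₀ hr]; linarith⟩
  have h1 : HasDerivAt (fun t : ℝ => t * b) b 0 := by
    simpa using (hasDerivAt_id (0 : ℝ)).mul_const b
  have h2 : HasDerivAt (fun t => lineFlow t (ℓ (u - u₀) / r))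
      (deriv lineTime (ℓ (u - u₀) / r))⁻¹ (0 * b) := by
    rw [zero_mul]; exact hasDerivAt_lineFlow hm
  have h3 := HasDerivAt.comp (0 : ℝ) h2 h1
  exact (((h3.const_mul r).sub_const (ℓ (u - u₀))).smul_const w).const_add u

/-- A point splits as its projection along $w$ plus a multiple of $w$. The radius fixes how small
$r$ must be for the box to fit into the target of a chart. -/
theorem slideBox_subset_ball :
    slideBox ℓ w u₀ r ⊆ Metric.closedBall u₀ (r * (1 + ‖w‖)) := by
  rintro u ⟨h1, h2⟩
  rw [mem_closedBall_iff_norm] at h2 ⊢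
  have e : u - u₀ = (slideProj ℓ w u₀ u - u₀) + ℓ (u - u₀) • w := by rw [slideProj]; module
  calc ‖u - u₀‖ ≤ ‖slideProj ℓ w u₀ u - u₀‖ + ‖ℓ (u - u₀) • w‖ := by
        conv_lhs => rw [e]
        exact norm_add_le _ _
    _ ≤ r + r * ‖w‖ := by
        rw [norm_smul, Real.norm_eq_abs]
        gcongr
    _ = _ := by ring

theorem isCompact_slideBox [FiniteDimensional ℝ K] :
    IsCompact (slideBox ℓ w u₀ r) := by
  refine (isCompact_closedBall u₀ (r * (1 + ‖w‖))).of_isClosed_subset ?_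
    slideBox_subset_ball
  have h1 : IsClosed {u : K | |ℓ (u - u₀)| ≤ r} := isClosed_le (by fun_prop) continuous_const
  exact h1.inter (Metric.isClosed_closedBall.preimage contDiff_slideProj.continuous)

end Slide

/-! ### Vertical fields with explicit flows and prescribed velocity along a section. -/

section Flow

variable {m : ℕ} {M : Type*} [TopologicalSpace M] [ChartedSpace (X m) M]
  {K P : Type*} [NormedAddCommGroup K] [NormedSpace ℝ K] [TopologicalSpace P] [ChartedSpace K P]
  [IsManifold 𝓘(ℝ, K) ∞ P]

/-- The velocity field of a one-parameter group. -/
def velocity (σ : ℝ → P → P) (q : P) : TangentSpace 𝓘(ℝ, K) q :=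
  (mfderiv 𝓘(ℝ, ℝ) 𝓘(ℝ, K) (fun t => σ t q) 0 (1 : ℝ) : K)

/-- A smooth one-parameter group of fibre-preserving maps, with compact support, is the flow of a
compactly supported vertical vector field. -/
theorem isVerticalFlow_velocity {p : P → M} (hp : ContMDiff 𝓘(ℝ, K) 𝓘(ℝ, X m) ∞ p)
    {σ : ℝ → P → P}
    (hσ : ContMDiff (𝓘(ℝ, ℝ).prod 𝓘(ℝ, K)) 𝓘(ℝ, K) ∞ (fun z : ℝ × P => σ z.1 z.2))
    (h0 : ∀ q, σ 0 q = q) (hadd : ∀ t t' q, σ (t + t') q = σ t (σ t' q))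
    (hproj : ∀ t q, p (σ t q) = p q) {C : Set P} (hC : IsCompact C)
    (hCσ : ∀ q ∉ C, ∀ t, σ t q = q) : IsVerticalFlow m p (velocity (K := K) σ) σ := by
  have hcurve : ∀ q, ContMDiff 𝓘(ℝ, ℝ) 𝓘(ℝ, K) ∞ (fun t => σ t q) := fun q =>
    hσ.comp (contMDiff_id.prodMk contMDiff_const)
  have hd : ∀ q t, HasMFDerivAt 𝓘(ℝ, ℝ) 𝓘(ℝ, K) (fun t => σ t q) t
      (mfderiv 𝓘(ℝ, ℝ) 𝓘(ℝ, K) (fun t => σ t q) t) := fun q t =>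
    ((hcurve q t).mdifferentiableAt (by simp)).hasMFDerivAt
  refine ⟨?_, ?_, ⟨C, hC, ?_⟩, hσ, h0, ?_, hproj⟩
  -- The velocity field is the tangent map of $\sigma$ applied to the unit vector in time at $0$
  -- paired with the zero section, hence smooth.
  · have h1 := hσ.contMDiff_tangentMap (m := ∞) (by simp)
    have h2 : ContMDiff 𝓘(ℝ, K) ((𝓘(ℝ, ℝ).prod 𝓘(ℝ, K))).tangent ∞ (fun q : P =>
        (equivTangentBundleProd 𝓘(ℝ, ℝ) ℝ 𝓘(ℝ, K) P).symm
          ((⟨0, (1 : ℝ)⟩ : TangentBundle 𝓘(ℝ, ℝ) ℝ),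
            Bundle.zeroSection K (TangentSpace 𝓘(ℝ, K) : P → Type _) q)) := by
      refine contMDiff_equivTangentBundleProd_symm.comp (contMDiff_const.prodMk ?_)
      exact Bundle.contMDiff_zeroSection ℝ _
    have h3 := h1.comp h2
    refine h3.congr fun q => ?_
    refine Bundle.TotalSpace.ext (h0 q).symm ?_
    refine heq_of_eq ?_
    have h4 : HasMFDerivAt 𝓘(ℝ, ℝ) 𝓘(ℝ, K) (fun t : ℝ => σ t q) 0 _ :=
      ((hσ (0, q)).mdifferentiableAt (by simp)).hasMFDerivAt.comp (0 : ℝ)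
        ((hasMFDerivAt_id (I := 𝓘(ℝ, ℝ)) (0 : ℝ)).prodMk (hasMFDerivAt_const q (0 : ℝ)))
    exact congrArg (fun L => L (1 : ℝ)) h4.mfderiv
  · intro q
    have h1 : HasMFDerivAt 𝓘(ℝ, K) 𝓘(ℝ, X m) p (σ 0 q) (mfderiv 𝓘(ℝ, K) 𝓘(ℝ, X m) p (σ 0 q)) :=
      ((hp _).mdifferentiableAt (by simp)).hasMFDerivAt
    have h2 := h1.comp (0 : ℝ) (hd q 0)
    have h3 : p ∘ (fun t => σ t q) = fun _ => p q := funext fun t => hproj t q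
    rw [h3] at h2
    have h4 := congrArg (fun L => L (1 : ℝ)) (hasMFDerivAt_unique h2 (hasMFDerivAt_const _ _))
    rw [h0 q] at h4
    exact h4
  · intro q hq
    have : (fun t => σ t q) = fun _ => q := funext fun t => hCσ q hq t
    have h := hd q 0
    rw [this] at h
    have h4 := congrArg (fun L => L (1 : ℝ)) (hasMFDerivAt_unique h (hasMFDerivAt_const q (0 : ℝ)))
    unfold velocity
    rw [this]
    exact h4
  · intro q t
    -- The group law $\sigma_s=\sigma_{s-t}\circ\sigma_t$ transports the derivative at time $0$ to
    -- time $t$.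
    have h1 : HasMFDerivAt 𝓘(ℝ, ℝ) 𝓘(ℝ, ℝ) (fun s : ℝ => s - t) t (ContinuousLinearMap.id ℝ ℝ) :=
      ((hasFDerivAt_id t).sub_const t).hasMFDerivAt
    have h2 := hd (σ t q) (t - t)
    have h3 : HasMFDerivAt 𝓘(ℝ, ℝ) 𝓘(ℝ, K) ((fun s => σ s (σ t q)) ∘ fun s : ℝ => s - t) t _ :=
      HasMFDerivAt.comp t h2 h1
    have h4 : (fun s => σ s (σ t q)) ∘ (fun s : ℝ => s - t) = fun s => σ s q := by
      funext s
      change σ (s - t) (σ t q) = _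
      rw [← hadd, sub_add_cancel]
    rw [h4, sub_self] at h3
    have key : ∀ A : ℝ →L[ℝ] K, A = (1 : ℝ →L[ℝ] ℝ).smulRight (A 1) := fun A => by
      ext; simp
    exact h3.congr_mfderiv (key _)

/-- Test flows: for a section `s` and a direction `w` that is vertical in the chart `e`, there are
vertical flows with velocity `η w` along `s`, for every `η` supported near a given point. -/
theorem exists_verticalFlow_tangent [FiniteDimensional ℝ K] [T2Space P] {p : P → M}
    (hp : ContMDiff 𝓘(ℝ, K) 𝓘(ℝ, X m) ∞ p) (s : SmoothSection m K p)
    (e : OpenPartialHomeomorph P K) (he : ContMDiffOn 𝓘(ℝ, K) 𝓘(ℝ, K) ∞ e e.source)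
    (he' : ContMDiffOn 𝓘(ℝ, K) 𝓘(ℝ, K) ∞ e.symm e.target) {w : K} {ℓ : K →L[ℝ] ℝ} (hw : ℓ w = 1)
    (hvert : ∀ q ∈ e.source, ∀ q' ∈ e.source, ∀ a : ℝ, e q' = e q + a • w → p q' = p q)
    {x₀ : M} (hx₀ : s.toFun x₀ ∈ e.source) :
    ∃ U : Set M, IsOpen U ∧ x₀ ∈ U ∧ (∀ x ∈ U, s.toFun x ∈ e.source) ∧
      ∀ η : M → ℝ, ContMDiff 𝓘(ℝ, X m) 𝓘(ℝ, ℝ) ∞ η → tsupport η ⊆ U →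
        ∃ (Z : ∀ q : P, TangentSpace 𝓘(ℝ, K) q) (σ : ℝ → P → P) (_ : IsVerticalFlow m p Z σ),
          (∀ x ∈ U, (∀ t, σ t (s.toFun x) ∈ e.source) ∧
            HasDerivAt (fun t => e (σ t (s.toFun x))) (η x • w) 0) ∧
          ∀ x ∉ tsupport η, ∀ t, σ t (s.toFun x) = s.toFun x := by
  classical
  set u₀ := e (s.toFun x₀) with hu₀
  obtain ⟨ρ, hρ, hball⟩ := Metric.nhds_basis_closedBall.mem_iff.mp
    (e.open_target.mem_nhds (e.map_source hx₀))
  -- With this radius the whole box lies in the closed ball of radius $\rho$, which is contained in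
  -- the target of $e$.
  set r : ℝ := ρ / (1 + ‖w‖) with hr_def
  have h1w : 0 < 1 + ‖w‖ := by positivity
  have hr : 0 < r := div_pos hρ h1w
  have hbox : slideBox ℓ w u₀ r ⊆ e.target := by
    refine slideBox_subset_ball.trans ?_
    rwa [hr_def, div_mul_cancel₀ _ h1w.ne']
  let b : ContDiffBump u₀ := ⟨r / 2, r, by positivity, by linarith⟩
  have hproj0 : slideProj ℓ w u₀ u₀ = u₀ := by simp [slideProj]
  have hcs : Continuous s.toFun := s.smooth.continuous
  obtain ⟨U, hUsub, hUo, hxU⟩ : ∃ U ⊆ {x | s.toFun x ∈ e.source ∧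
      |ℓ (e (s.toFun x) - u₀)| < r ∧ slideProj ℓ w u₀ (e (s.toFun x)) ∈ Metric.ball u₀ (r / 2)},
      IsOpen U ∧ x₀ ∈ U := by
    refine mem_nhds_iff.mp ?_
    have c1 : ContinuousAt (fun x => e (s.toFun x)) x₀ :=
      ContinuousAt.comp (g := e) (e.continuousAt hx₀) hcs.continuousAt
    have c2 : ContinuousAt (fun x => |ℓ (e (s.toFun x) - u₀)|) x₀ :=
      (ℓ.continuous.continuousAt.comp (c1.sub continuousAt_const)).abs
    have c3 : ContinuousAt (fun x => slideProj ℓ w u₀ (e (s.toFun x))) x₀ :=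
      ContinuousAt.comp (g := slideProj ℓ w u₀)
        (contDiff_slideProj (ℓ := ℓ) (w := w) (u₀ := u₀)).continuous.continuousAt c1
    refine Filter.inter_mem (hcs.continuousAt.preimage_mem_nhds (e.open_source.mem_nhds hx₀))
      (Filter.inter_mem (c2.eventually (gt_mem_nhds ?_))
        (c3.eventually (p := fun u => u ∈ Metric.ball u₀ (r / 2)) ?_))
    · simpa [hu₀] using hr
    · change ∀ᶠ y in 𝓝 (slideProj ℓ w u₀ u₀), _
      rw [hproj0]
      exact Metric.ball_mem_nhds _ (by positivity)
  refine ⟨U, hUo, hxU, fun x hx => (hUsub hx).1, fun η hη hηU => ?_⟩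
  -- The factor after $\eta$ is the reciprocal of the speed of `slide` at the section, so that the
  -- resulting velocity is $\eta\,w$.
  set γ : M → ℝ := fun x => η x * (deriv lineTime (ℓ (e (s.toFun x) - u₀) / r) / r) with hγ
  have hIoo : ∀ x ∈ U, ℓ (e (s.toFun x) - u₀) / r ∈ Set.Ioo (-1 : ℝ) 1 := fun x hx => by
    have h := abs_lt.mp (hUsub hx).2.1
    exact ⟨by rw [lt_div_iff₀ hr]; linarith, by rw [div_lt_iff₀ hr]; linarith⟩
  have hγs : ContMDiff 𝓘(ℝ, X m) 𝓘(ℝ, ℝ) ∞ γ := by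
    -- The derivative of `lineTime` is controlled only over $U$; this suffices because $\eta$ is
    -- supported in $U$.
    refine contMDiff_of_tsupport fun x hx => ?_
    have hxU : x ∈ U := hηU (closure_mono (fun y hy => by
      rw [Function.mem_support] at hy ⊢
      exact left_ne_zero_of_mul hy) hx)
    have h1 : ContMDiffAt 𝓘(ℝ, X m) 𝓘(ℝ, K) ∞ (fun x => e (s.toFun x)) x :=
      ContMDiffAt.comp x (he.contMDiffAt (e.open_source.mem_nhds (hUsub hxU).1)) (s.smooth x)
    have h2 : ContDiff ℝ ∞ (fun u : K => ℓ (u - u₀) / r) :=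
      (ℓ.contDiff.comp (contDiff_id.sub contDiff_const)).div_const r
    have h3 : ContDiffAt ℝ ∞ (fun z => deriv lineTime z / r)
        (ℓ (e (s.toFun x) - u₀) / r) := by
      refine ContDiffAt.div_const ?_ r
      have h : ContDiffOn ℝ ∞ lineTime (Set.Ioo (-1) 1) := fun z hz =>
        (contDiffAt_lineTime hz).contDiffWithinAt
      exact (h.deriv_of_isOpen isOpen_Ioo (by simp)).contDiffAt (isOpen_Ioo.mem_nhds (hIoo x hxU))
    have h4 : ContMDiffAt 𝓘(ℝ, X m) 𝓘(ℝ, ℝ) ∞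
        (fun x => deriv lineTime (ℓ (e (s.toFun x) - u₀) / r) / r) x :=
      (ContDiffAt.comp (g := fun z => deriv lineTime z / r) (e (s.toFun x)) h3
        h2.contDiffAt).contMDiffAt.comp x h1
    exact (hη x).mul h4
  -- The rate depends only on $p(q)$ and on the projection along $w$, both of which are invariant
  -- under the flow. It is therefore constant on orbits, and time rescaling by $\beta$ keeps the
  -- group law.
  set β : P → ℝ := fun q => γ (p q) * b (slideProj ℓ w u₀ (e q)) with hβ
  set σ : ℝ → P → P := fun t q =>
    if q ∈ e.source then e.symm (slide ℓ w u₀ r (t * β q) (e q)) else q with hσ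
  -- Off the box either the bump vanishes, so the rate is zero, or $|\ell|>r$ and the line flow is
  -- trivial.
  have hfix : ∀ q ∈ e.source, e q ∉ slideBox ℓ w u₀ r → ∀ t,
      slide ℓ w u₀ r (t * β q) (e q) = e q := by
    intro q hq hnb t
    by_cases h1 : |ℓ (e q - u₀)| ≤ r
    · have h2 : b (slideProj ℓ w u₀ (e q)) = 0 := by
        refine b.zero_of_le_dist ?_
        by_contra h
        exact hnb ⟨h1, Metric.mem_closedBall.mpr (not_le.mp h).le⟩
      simp only [hβ, h2, mul_zero, slide_zero hr]
    · exact slide_eq_self hr (not_le.mp h1) _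
  have htgt : ∀ q ∈ e.source, ∀ t, slide ℓ w u₀ r (t * β q) (e q) ∈ e.target := by
    intro q hq t
    by_cases h : e q ∈ slideBox ℓ w u₀ r
    · exact hbox (slide_mem_box hw hr h _)
    · rw [hfix q hq h]; exact e.map_source hq
  have hσin : ∀ q ∈ e.source, ∀ t, σ t q = e.symm (slide ℓ w u₀ r (t * β q) (e q)) :=
    fun q hq t => if_pos hq
  have hσout : ∀ q ∉ e.source, ∀ t, σ t q = q := fun q hq t => if_neg hq
  have hσsrc : ∀ q ∈ e.source, ∀ t, σ t q ∈ e.source := fun q hq t => by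
    rw [hσin q hq]; exact e.map_target (htgt q hq t)
  have hσe : ∀ q ∈ e.source, ∀ t, e (σ t q) = slide ℓ w u₀ r (t * β q) (e q) := fun q hq t => by
    rw [hσin q hq, e.right_inv (htgt q hq t)]
  have hσp : ∀ t q, p (σ t q) = p q := by
    intro t q
    by_cases hq : q ∈ e.source
    · exact hvert q hq _ (hσsrc q hq t) _ (by rw [hσe q hq]; rfl)
    · rw [hσout q hq]
  have hσβ : ∀ q ∈ e.source, ∀ t, β (σ t q) = β q := by
    intro q hq t
    simp only [hβ, hσp, hσe q hq, slideProj_slide hw]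
  set C : Set P := e.symm '' slideBox ℓ w u₀ r with hCdef
  have hC : IsCompact C := isCompact_slideBox.image_of_continuousOn (e.continuousOn_symm.mono hbox)
  have hCσ : ∀ q ∉ C, ∀ t, σ t q = q := by
    intro q hq t
    by_cases hqs : q ∈ e.source
    · rw [hσin q hqs, hfix q hqs fun h => hq ⟨e q, h, e.left_inv hqs⟩, e.left_inv hqs]
    · exact hσout q hqs t
  have hCs : C ⊆ e.source := by
    rintro _ ⟨u, hu, rfl⟩
    exact e.map_target (hbox hu)
  -- Near the compact set $C$ the chart formula applies; off $C$, which is closed since $P$ is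
  -- Hausdorff, $\sigma$ is locally the identity.
  have hσs : ContMDiff (𝓘(ℝ, ℝ).prod 𝓘(ℝ, K)) 𝓘(ℝ, K) ∞ (fun z : ℝ × P => σ z.1 z.2) := by
    rintro ⟨t, q⟩
    by_cases hq : q ∈ C
    · have hqs := hCs hq
      have hsrc : ∀ᶠ z in 𝓝 (t, q), z.2 ∈ e.source :=
        continuous_snd.continuousAt.preimage_mem_nhds (e.open_source.mem_nhds hqs)
      have h1 : ContMDiffAt (𝓘(ℝ, ℝ).prod 𝓘(ℝ, K)) 𝓘(ℝ, K) ∞ (fun z : ℝ × P => e z.2) (t, q) :=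
        ContMDiffAt.comp (t, q) (he.contMDiffAt (e.open_source.mem_nhds hqs)) contMDiffAt_snd
      have h2 : ContMDiffAt (𝓘(ℝ, ℝ).prod 𝓘(ℝ, K)) 𝓘(ℝ, ℝ) ∞ (fun z : ℝ × P => z.1 * β z.2)
          (t, q) := by
        refine contMDiffAt_fst.mul (ContMDiffAt.mul ?_ ?_)
        · exact (hγs.comp hp).contMDiffAt.comp (t, q) contMDiffAt_snd
        · exact (b.contDiff.comp contDiff_slideProj).contMDiff.contMDiffAt.comp (t, q) h1
      have h3 : ContMDiffAt (𝓘(ℝ, ℝ).prod 𝓘(ℝ, K)) 𝓘(ℝ, K) ∞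
          (fun z : ℝ × P => slide ℓ w u₀ r (z.1 * β z.2) (e z.2)) (t, q) :=
        (contDiff_slide (ℓ := ℓ) (w := w) (u₀ := u₀) (r := r)).contMDiff.contMDiffAt.comp (t, q)
          (h2.prodMk_space h1)
      have h4 : ContMDiffAt (𝓘(ℝ, ℝ).prod 𝓘(ℝ, K)) 𝓘(ℝ, K) ∞
          (fun z : ℝ × P => e.symm (slide ℓ w u₀ r (z.1 * β z.2) (e z.2))) (t, q) :=
        ContMDiffAt.comp (t, q)
          (he'.contMDiffAt (e.open_target.mem_nhds (htgt q hqs t))) h3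
      refine h4.congr_of_eventuallyEq ?_
      filter_upwards [hsrc] with z hz using hσin z.2 hz z.1
    · refine contMDiffAt_snd.congr_of_eventuallyEq ?_
      filter_upwards [continuous_snd.continuousAt.preimage_mem_nhds
        (hC.isClosed.isOpen_compl.mem_nhds hq)] with z hz using hCσ z.2 hz z.1
  have hσ0 : ∀ q, σ 0 q = q := by
    intro q
    by_cases hq : q ∈ e.source
    · rw [hσin q hq, zero_mul, slide_zero hr, e.left_inv hq]
    · exact hσout q hq 0
  have hσadd : ∀ t t' q, σ (t + t') q = σ t (σ t' q) := by
    intro t t' q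
    by_cases hq : q ∈ e.source
    · rw [hσin _ (hσsrc q hq t'), hσe q hq, hσβ q hq, hσin q hq, ← slide_add hw hr, add_mul]
    · rw [hσout q hq t', hσout q hq, hσout q hq]
  refine ⟨_, σ, isVerticalFlow_velocity hp hσs hσ0 hσadd hσp hC hCσ, fun x hx => ?_,
    fun x hx t => ?_⟩
  · obtain ⟨h1, h2, h3⟩ := hUsub hx
    refine ⟨hσsrc _ h1, ?_⟩
    have hd := hasDerivAt_slide (w := w) hr h2 (β (s.toFun x))
    -- On $U$ the bump equals $1$, because $U$ was chosen with projections in the ball of half the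
    -- radius.
    have hb : b (slideProj ℓ w u₀ (e (s.toFun x))) = 1 :=
      b.one_of_mem_closedBall (Metric.ball_subset_closedBall h3)
    have hpos := deriv_lineTime_pos (hIoo x hx)
    have hval : r * ((deriv lineTime (ℓ (e (s.toFun x) - u₀) / r))⁻¹ * β (s.toFun x)) = η x := by
      simp only [hβ, hγ, hb, s.proj_toFun]
      field_simp
    rw [hval] at hd
    refine hd.congr_of_eventuallyEq (Filter.Eventually.of_forall fun t => ?_)
    exact hσe _ h1 t
  · have hη0 : η x = 0 := image_eq_zero_of_notMem_tsupport hx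
    by_cases hq : s.toFun x ∈ e.source
    · have : β (s.toFun x) = 0 := by simp [hβ, hγ, s.proj_toFun, hη0]
      rw [hσin _ hq, this, mul_zero, slide_zero hr, e.left_inv hq]
    · exact hσout _ hq t

end Flow


/-! ### Forms of top degree and determinants. -/

section TopForms

variable {m : ℕ}

/-- Every top-degree form is a multiple of the standard volume form. -/
theorem alternating_eq_stdVol (α : X m [⋀^Fin m]→L[ℝ] ℝ) (v : Fin m → X m) :
    α v = α (fun i => stdB i) * stdVol m v := by
  set b := (EuclideanSpace.basisFun (Fin m) ℝ).toBasis with hb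
  have hbs : (⇑b : Fin m → X m) = fun i => stdB i := by
    funext i; simp [hb]
  have h1 := AlternatingMap.eq_smul_basis_det b α.toAlternatingMap
  have h2 := AlternatingMap.eq_smul_basis_det b (stdVol m).toAlternatingMap
  have h1' : α v = α (fun i => stdB i) * b.det v := by
    have := congrArg (fun f => f v) h1
    simp only [hbs] at this
    exact this
  have h2' : stdVol m v = stdVol m (fun i => stdB i) * b.det v := by
    have := congrArg (fun f => f v) h2
    simp only [hbs] at this
    exact this
  rw [h1', h2', stdVol_std, one_mul]

theorem stdVol_comp (A : X m →L[ℝ] X m) (v : Fin m → X m) :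
    stdVol m (fun i => A (v i)) = A.det * stdVol m v := by
  set b := (EuclideanSpace.basisFun (Fin m) ℝ).toBasis with hb
  have h2 := AlternatingMap.eq_smul_basis_det b (stdVol m).toAlternatingMap
  have h3 : ∀ v, stdVol m v = (stdVol m).toAlternatingMap b * b.det v := fun v =>
    congrArg (fun f => f v) h2
  rw [h3, h3 v]
  have := b.det_comp (A : X m →ₗ[ℝ] X m) v
  change _ * b.det (⇑(A : X m →ₗ[ℝ] X m) ∘ v) = _
  rw [this]
  ring

theorem alternating_comp (α : X m [⋀^Fin m]→L[ℝ] ℝ) (A : X m →L[ℝ] X m) (v : Fin m → X m) :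
    α (fun i => A (v i)) = A.det * α v := by
  rw [alternating_eq_stdVol, stdVol_comp, alternating_eq_stdVol α v]; ring

theorem alternating_std_ne_zero {α : X m [⋀^Fin m]→L[ℝ] ℝ} (h : α ≠ 0) :
    α (fun i => stdB i) ≠ 0 := by
  intro h0
  refine h (ContinuousAlternatingMap.ext fun v => ?_)
  rw [alternating_eq_stdVol, h0, zero_mul]; rfl

/-- Since $A\circ A'$ is the identity, $\alpha(e)=\alpha(AA'e)=\det A\,\det A'\,\alpha(e)=\det
A'\,\alpha(Ae)$, so vanishing on the vectors $Ae_i$ would force $\alpha=0$. -/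
theorem alternating_comp_std_ne_zero {α : X m [⋀^Fin m]→L[ℝ] ℝ} (h : α ≠ 0) {A A' : X m →L[ℝ] X m}
    (hA : ∀ z, A (A' z) = z) : α (fun i => A (stdB i)) ≠ 0 := by
  intro h0
  refine alternating_std_ne_zero h ?_
  have h1 := alternating_comp α A (fun i => A' (stdB i))
  simp only [hA] at h1
  rw [h1, alternating_comp, mul_left_comm, ← alternating_comp α A, h0, mul_zero]

end TopForms

/-! ### The measure of a volume form: independence of charts, local finiteness, positivity on open
sets. -/

section Measure

open MeasureTheory

variable {m : ℕ} {M : Type*} [TopologicalSpace M] [ChartedSpace (X m) M]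
  [IsManifold 𝓘(ℝ, X m) ∞ M] {vol : DForm (X m) M m}

theorem chart_mdifferentiable {c : OpenPartialHomeomorph M (X m)}
    (hc : c ∈ IsManifold.maximalAtlas 𝓘(ℝ, X m) ∞ M) : c.MDifferentiable 𝓘(ℝ, X m) 𝓘(ℝ, X m) :=
  ⟨(contMDiffOn_of_mem_maximalAtlas hc).mdifferentiableOn (by simp),
    (contMDiffOn_symm_of_mem_maximalAtlas hc).mdifferentiableOn (by simp)⟩

theorem chartCoeff_ne_zero (hvol : IsVolumeForm vol) {c : OpenPartialHomeomorph M (X m)}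
    (hc : c ∈ IsManifold.maximalAtlas 𝓘(ℝ, X m) ∞ M) {u : X m} (hu : u ∈ c.target) :
    chartCoeff vol c u ≠ 0 := by
  refine alternating_comp_std_ne_zero (hvol.ne_zero (c.symm u))
    (A' := mfderiv 𝓘(ℝ, X m) 𝓘(ℝ, X m) c (c.symm u)) fun z => ?_
  have h := (chart_mdifferentiable hc).symm_comp_deriv (c.map_target hu)
  rw [c.right_inv hu] at h
  exact congrArg (fun L => L z) h

/-- Near $u$, $c^{-1}=c'^{-1}\circ(c'\circ c^{-1})$; the chain rule and the determinant rule for top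
forms give the transformation law. The two conclusions are what the change of variables formula
consumes. -/
theorem chartCoeff_change {c c' : OpenPartialHomeomorph M (X m)}
    (hc : c ∈ IsManifold.maximalAtlas 𝓘(ℝ, X m) ∞ M)
    (hc' : c' ∈ IsManifold.maximalAtlas 𝓘(ℝ, X m) ∞ M) {u : X m} (hu : u ∈ c.target)
    (hu' : c.symm u ∈ c'.source) :
    HasFDerivAt (c' ∘ c.symm) (fderiv ℝ (c' ∘ c.symm) u) u ∧
    chartCoeff vol c u = (fderiv ℝ (c' ∘ c.symm) u).det * chartCoeff vol c' (c' (c.symm u)) := by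
  have h1 : ContMDiffAt 𝓘(ℝ, X m) 𝓘(ℝ, X m) ∞ (c' ∘ c.symm) u :=
    (contMDiffAt_of_mem_maximalAtlas hc' hu').comp u (contMDiffAt_symm_of_mem_maximalAtlas hc hu)
  have h2 : HasFDerivAt (c' ∘ c.symm) (fderiv ℝ (c' ∘ c.symm) u) u :=
    (h1.contDiffAt.differentiableAt (by simp)).hasFDerivAt
  refine ⟨h2, ?_⟩
  have hcu : c'.symm (c' (c.symm u)) = c.symm u := c'.left_inv hu'
  have h3 : HasMFDerivAt 𝓘(ℝ, X m) 𝓘(ℝ, X m) c'.symm (c' (c.symm u))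
      (mfderiv 𝓘(ℝ, X m) 𝓘(ℝ, X m) c'.symm (c' (c.symm u))) :=
    ((chart_mdifferentiable hc').mdifferentiableAt_symm (c'.map_source hu')).hasMFDerivAt
  have h4 : HasMFDerivAt 𝓘(ℝ, X m) 𝓘(ℝ, X m) (c'.symm ∘ (c' ∘ c.symm)) u _ :=
    HasMFDerivAt.comp u h3 h2.hasMFDerivAt
  have h5 : HasMFDerivAt 𝓘(ℝ, X m) 𝓘(ℝ, X m) c.symm u _ := h4.congr_of_eventuallyEq (by
    have hn : ∀ᶠ y in 𝓝 u, c.symm y ∈ c'.source :=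
      (c.continuousAt_symm hu).preimage_mem_nhds (c'.open_source.mem_nhds hu')
    filter_upwards [hn] with y hy using (c'.left_inv hy).symm)
  have h6 := h5.mfderiv
  have key := alternating_comp ((vol (c'.symm (c' (c.symm u)))).compContinuousLinearMap
    (mfderiv 𝓘(ℝ, X m) 𝓘(ℝ, X m) c'.symm (c' (c.symm u)))) (fderiv ℝ (c' ∘ c.symm) u)
    (fun i => stdB i)
  refine Eq.trans ?_ key
  unfold chartCoeff
  rw [h6]
  have h7 : ∀ x y : M, x = y → ∀ v : Fin m → X m, (show X m [⋀^Fin m]→L[ℝ] ℝ from vol x) v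
      = (show X m [⋀^Fin m]→L[ℝ] ℝ from vol y) v := by
    rintro x _ rfl v; rfl
  exact h7 _ _ hcu.symm _

/-- The measure `|vol|` in the chart `c`. -/
def chartVol (vol : DForm (X m) M m) (c : OpenPartialHomeomorph M (X m)) (S : Set M) : ENNReal :=
  ∫⁻ u in c.target ∩ c.symm ⁻¹' S, ENNReal.ofReal |chartCoeff vol c u|

variable [MeasurableSpace M] [BorelSpace M]

theorem measurableSet_chart_preimage (c : OpenPartialHomeomorph M (X m)) {S : Set M}
    (hS : MeasurableSet S) : MeasurableSet (c.target ∩ c.symm ⁻¹' S) := by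
  have h := (continuousOn_iff_continuous_domRestrict.mp c.continuousOn_symm).measurable hS
  have := c.open_target.measurableSet.subtype_image h
  convert this using 1
  ext u
  simp [and_comm]

/-- The transition map carries one coordinate image of $S$ onto the other, and its Jacobian is
absorbed by the transformation law of the coefficient of $\omega$. -/
theorem chartVol_change {c c' : OpenPartialHomeomorph M (X m)}
    (hc : c ∈ IsManifold.maximalAtlas 𝓘(ℝ, X m) ∞ M)
    (hc' : c' ∈ IsManifold.maximalAtlas 𝓘(ℝ, X m) ∞ M) {S : Set M} (hS : MeasurableSet S)
    (h : S ⊆ c.source) (h' : S ⊆ c'.source) : chartVol vol c S = chartVol vol c' S := by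
  set A := c.target ∩ c.symm ⁻¹' S with hA
  have himg : (c' ∘ c.symm) '' A = c'.target ∩ c'.symm ⁻¹' S := by
    ext v
    constructor
    · rintro ⟨u, ⟨hu, huS⟩, rfl⟩
      exact ⟨c'.map_source (h' huS), by
        change c'.symm (c' (c.symm u)) ∈ S
        rw [c'.left_inv (h' huS)]; exact huS⟩
    · rintro ⟨hv, hvS⟩
      refine ⟨c (c'.symm v), ⟨c.map_source (h hvS), ?_⟩, ?_⟩
      · change c.symm (c (c'.symm v)) ∈ S
        rw [c.left_inv (h hvS)]; exact hvS
      · change c' (c.symm (c (c'.symm v))) = v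
        rw [c.left_inv (h hvS), c'.right_inv hv]
  have hinj : Set.InjOn (c' ∘ c.symm) A := by
    rintro u ⟨hu, huS⟩ v ⟨hv, hvS⟩ huv
    exact c.symm.injOn hu hv (c'.injOn (h' huS) (h' hvS) huv)
  have key := lintegral_image_eq_lintegral_abs_det_fderiv_mul volume
    (measurableSet_chart_preimage c hS)
    (fun u hu => (chartCoeff_change (vol := vol) hc hc' hu.1 (h' hu.2)).1.hasFDerivWithinAt) hinj
    (fun u => ENNReal.ofReal |chartCoeff vol c' u|)
  rw [himg] at key
  unfold chartVol
  rw [key]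
  refine setLIntegral_congr_fun (measurableSet_chart_preimage c hS) fun u hu => ?_
  rw [(chartCoeff_change hc hc' hu.1 (h' hu.2)).2, abs_mul, ENNReal.ofReal_mul (abs_nonneg _)]
  rfl

variable [SecondCountableTopology M] [Nonempty M]

theorem coverChart_mem (i : ℕ) :
    coverChart m M i ∈ IsManifold.maximalAtlas 𝓘(ℝ, X m) ∞ M :=
  IsManifold.chart_mem_maximalAtlas _

/-- This removes the dependence on the chosen countable cover: each disjoint piece of $S$ is
computed in a chart of the cover, moved to $c$ by `chartVol_change`, and the pieces are added up. -/
theorem volMeasure_apply {c : OpenPartialHomeomorph M (X m)}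
    (hc : c ∈ IsManifold.maximalAtlas 𝓘(ℝ, X m) ∞ M) {S : Set M} (hS : MeasurableSet S)
    (h : S ⊆ c.source) : volMeasure vol S = chartVol vol c S := by
  have hD : ∀ i, MeasurableSet (disjointed (fun j => (coverChart m M j).source) i) := fun i =>
    MeasurableSet.disjointed (fun j => (coverChart m M j).open_source.measurableSet) i
  have hcover : ⋃ i, disjointed (fun j => (coverChart m M j).source) i = Set.univ := by
    rw [iUnion_disjointed]; exact (exists_chart_cover m M).choose_spec
  set D := disjointed (fun j => (coverChart m M j).source) with hDdef
  have h1 : volMeasure vol S = ∑' i, chartVol vol c (S ∩ D i) := by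
    rw [volMeasure, Measure.sum_apply _ hS]
    refine tsum_congr fun i => ?_
    have hSi : MeasurableSet (S ∩ D i) := hS.inter (hD i)
    rw [Measure.restrict_apply hS, Measure.map_apply_of_aemeasurable _ hSi, withDensity_apply',
      Measure.restrict_restrict' (coverChart m M i).open_target.measurableSet, Set.inter_comm]
    · refine chartVol_change (coverChart_mem i) hc hSi (fun x hx => ?_) (fun x hx => h hx.1)
      exact disjointed_subset _ i hx.2
    · exact ((coverChart m M i).continuousOn_symm.aemeasurable
        (coverChart m M i).open_target.measurableSet).mono_ac
        (withDensity_absolutelyContinuous _ _)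
  have h2 : c.target ∩ c.symm ⁻¹' S = ⋃ i, (c.target ∩ c.symm ⁻¹' (S ∩ D i)) := by
    rw [← Set.inter_iUnion, ← Set.preimage_iUnion, ← Set.inter_iUnion, hcover, Set.inter_univ]
  rw [h1, chartVol, h2, lintegral_iUnion (fun i => measurableSet_chart_preimage c (hS.inter (hD i)))]
  · rfl
  · intro i j hij
    refine Set.disjoint_left.mpr fun u hu hu' => ?_
    exact Set.disjoint_left.mp (disjoint_disjointed (fun j => (coverChart m M j).source) hij)
      hu.2.2 hu'.2.2

/-- The measure of a volume form is finite on compact sets. -/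
theorem isLocallyFiniteMeasure_volMeasure (hvol : IsVolumeForm vol) :
    IsLocallyFiniteMeasure (volMeasure vol) := by
  refine ⟨fun x => ?_⟩
  set c := chartAt (X m) x with hcdef
  have hc : c ∈ IsManifold.maximalAtlas 𝓘(ℝ, X m) ∞ M := IsManifold.chart_mem_maximalAtlas x
  have hx : x ∈ c.source := mem_chart_source _ x
  have hg : ContinuousAt (chartCoeff vol c) (c x) :=
    (hvol.smooth c hc).continuousOn.continuousAt (c.open_target.mem_nhds (c.map_source hx))
  have hn : ∀ᶠ u in 𝓝 (c x), |chartCoeff vol c u| < |chartCoeff vol c (c x)| + 1 ∧ u ∈ c.target :=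
    (hg.abs.eventually (gt_mem_nhds (lt_add_one _))).and
      (c.open_target.mem_nhds (c.map_source hx))
  obtain ⟨ε, hε, hball⟩ := Metric.mem_nhds_iff.mp hn
  have hopen : IsOpen (c.source ∩ c ⁻¹' Metric.ball (c x) ε) :=
    c.isOpen_inter_preimage Metric.isOpen_ball
  refine ⟨_, hopen.mem_nhds ⟨hx, Metric.mem_ball_self hε⟩, ?_⟩
  rw [volMeasure_apply hc hopen.measurableSet Set.inter_subset_left, chartVol]
  have hsub : c.target ∩ c.symm ⁻¹' (c.source ∩ c ⁻¹' Metric.ball (c x) ε)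
      ⊆ Metric.ball (c x) ε := by
    rintro u ⟨hu, -, hu'⟩
    rw [Set.mem_preimage, c.right_inv hu] at hu'
    exact hu'
  calc _ ≤ ∫⁻ u in Metric.ball (c x) ε, ENNReal.ofReal |chartCoeff vol c u| :=
        lintegral_mono_set hsub
    _ ≤ ∫⁻ _ in Metric.ball (c x) ε, ENNReal.ofReal (|chartCoeff vol c (c x)| + 1) := by
        refine setLIntegral_mono' measurableSet_ball fun u hu => ?_
        exact ENNReal.ofReal_le_ofReal (hball hu).1.le
    _ < ⊤ := by
        rw [setLIntegral_const]
        exact ENNReal.mul_lt_top ENNReal.ofReal_lt_top measure_ball_lt_top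

/-- The measure of a volume form is positive on nonempty open sets. -/
theorem isOpenPosMeasure_volMeasure (hvol : IsVolumeForm vol) :
    (volMeasure vol).IsOpenPosMeasure := by
  refine ⟨fun U hU ⟨x, hx⟩ => ?_⟩
  set c := chartAt (X m) x with hcdef
  have hc : c ∈ IsManifold.maximalAtlas 𝓘(ℝ, X m) ∞ M := IsManifold.chart_mem_maximalAtlas x
  have hxc : x ∈ c.source := mem_chart_source _ x
  have hS : IsOpen (U ∩ c.source) := hU.inter c.open_source
  refine ne_bot_of_le_ne_bot ?_ (measure_mono (Set.inter_subset_left (s := U) (t := c.source)))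
  rw [volMeasure_apply hc hS.measurableSet Set.inter_subset_right, chartVol]
  have hct := c.map_source hxc
  have hg : ContinuousAt (chartCoeff vol c) (c x) :=
    (hvol.smooth c hc).continuousOn.continuousAt (c.open_target.mem_nhds hct)
  have hpos := abs_pos.mpr (chartCoeff_ne_zero hvol hc hct)
  have h1 : ∀ᶠ u in 𝓝 (c x), |chartCoeff vol c (c x)| / 2 < |chartCoeff vol c u| :=
    hg.abs.eventually (lt_mem_nhds (half_lt_self hpos))
  have h2 : ∀ᶠ u in 𝓝 (c x), c.symm u ∈ U ∩ c.source := by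
    refine (c.continuousAt_symm hct).preimage_mem_nhds ?_
    rw [c.left_inv hxc]
    exact hS.mem_nhds ⟨hx, hxc⟩
  obtain ⟨ε, hε, hball⟩ := Metric.mem_nhds_iff.mp
    ((h1.and h2).and (c.open_target.mem_nhds hct))
  -- On a small ball the coefficient stays above half its nonzero value at the centre, so the
  -- integral dominates a positive multiple of the volume of the ball.
  have hlow : ENNReal.ofReal (|chartCoeff vol c (c x)| / 2) * volume (Metric.ball (c x) ε)
      ≤ ∫⁻ u in c.target ∩ c.symm ⁻¹' (U ∩ c.source), ENNReal.ofReal |chartCoeff vol c u| := by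
    rw [← setLIntegral_const]
    refine (setLIntegral_mono' measurableSet_ball fun u hu => ?_).trans
      (lintegral_mono_set fun u hu => ⟨(hball hu).2, (hball hu).1.2⟩)
    exact ENNReal.ofReal_le_ofReal (hball hu).1.1.le
  refine ne_bot_of_le_ne_bot ?_ hlow
  refine mul_ne_zero ?_ (Metric.measure_ball_pos volume _ hε).ne'
  rw [Ne, ENNReal.ofReal_eq_zero, not_le]
  positivity

end Measure


/-! ### Induced charts and smooth maps on the total spaces. -/

section Total

variable {m n : ℕ} {M E F : Type*}
  [TopologicalSpace M] [ChartedSpace (X m) M] [IsManifold 𝓘(ℝ, X m) ∞ M]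
  [TopologicalSpace E] [ChartedSpace (X m × X n) E]
  [TopologicalSpace F] [ChartedSpace (X n) F] [IsManifold 𝓘(ℝ, X n) ∞ F]
  {B : ConfigBundle m n M E F} {G : Type*} [NormedAddCommGroup G]
  [NormedSpace ℝ G] {T : E → Type*}

namespace FibreCoords

variable (C : FibreCoords B G T)

/-- The induced coordinates as a chart of the total space. -/
def homeo (q₀ : Bundle.TotalSpace G T) (a : AdaptedChart B) :
    letI := C.topology
    OpenPartialHomeomorph (Bundle.TotalSpace G T) ((X m × X n) × G) :=
  C.core.openPartialHomeomorph (C.chart q₀ a) ⟨q₀, a, rfl⟩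

theorem homeo_mem (q₀ : Bundle.TotalSpace G T) (a : AdaptedChart B) :
    letI := C.topology
    letI := C.chartedSpace
    C.homeo q₀ a ∈ IsManifold.maximalAtlas 𝓘(ℝ, (X m × X n) × G) ∞ (Bundle.TotalSpace G T) := by
  let := C.topology
  let := C.chartedSpace
  have := C.isManifold
  refine IsManifold.subset_maximalAtlas ?_
  change _ ∈ ⋃ (e : PartialEquiv _ _) (he : e ∈ C.core.atlas),
      {C.core.openPartialHomeomorph e he}
  simp only [Set.mem_iUnion, Set.mem_singleton_iff]
  exact ⟨_, ⟨q₀, a, rfl⟩, rfl⟩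

theorem contMDiffOn_homeo (q₀ : Bundle.TotalSpace G T) (a : AdaptedChart B) :
    letI := C.topology
    letI := C.chartedSpace
    ContMDiffOn 𝓘(ℝ, (X m × X n) × G) 𝓘(ℝ, (X m × X n) × G) ∞ (C.homeo q₀ a)
      (C.homeo q₀ a).source := by
  let := C.topology
  let := C.chartedSpace
  exact contMDiffOn_of_mem_maximalAtlas (C.homeo_mem q₀ a)

theorem contMDiffOn_homeo_symm (q₀ : Bundle.TotalSpace G T) (a : AdaptedChart B) :
    letI := C.topology
    letI := C.chartedSpace
    ContMDiffOn 𝓘(ℝ, (X m × X n) × G) 𝓘(ℝ, (X m × X n) × G) ∞ (C.homeo q₀ a).symm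
      (C.homeo q₀ a).target := by
  let := C.topology
  let := C.chartedSpace
  exact contMDiffOn_symm_of_mem_maximalAtlas (C.homeo_mem q₀ a)

theorem contMDiff_proj :
    letI := C.topology
    letI := C.chartedSpace
    ContMDiff 𝓘(ℝ, (X m × X n) × G) 𝓘(ℝ, X m × X n) ∞
      (Bundle.TotalSpace.proj : Bundle.TotalSpace G T → E) := by
  let := C.topology
  let := C.chartedSpace
  intro q
  obtain ⟨a, ha⟩ := B.exists_adaptedChart q.proj
  have hq : q ∈ (C.homeo q a).source := ha
  have h1 := (C.contMDiffOn_homeo q a).contMDiffAt ((C.homeo q a).open_source.mem_nhds hq)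
  have h2 : ContMDiffAt 𝓘(ℝ, (X m × X n) × G) 𝓘(ℝ, X m × X n) ∞ (fun q' => (C.homeo q a q').1) q :=
    contDiff_fst.contMDiff.contMDiffAt.comp q h1
  have h3 := ContMDiffAt.comp q
    (a.e_symm_smooth.contMDiffAt (a.e.open_target.mem_nhds (a.e.map_source ha))) h2
  refine h3.congr_of_eventuallyEq ?_
  filter_upwards [(C.homeo q a).open_source.mem_nhds hq] with q' hq'
  exact (a.e.left_inv hq').symm

/-- Points over different base points are separated in $E$; points over the same base point lie in
one induced chart. On $J^1\pi^*$ this makes compact supports closed and integral curves unique. -/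
theorem t2Space [T2Space E] : @T2Space _ C.topology := by
  let := C.topology
  let := C.chartedSpace
  have hc : Continuous (Bundle.TotalSpace.proj : Bundle.TotalSpace G T → E) :=
    C.contMDiff_proj.continuous
  refine ⟨fun q q' hne => ?_⟩
  by_cases hp : q.proj = q'.proj
  · obtain ⟨a, ha⟩ := B.exists_adaptedChart q.proj
    have hq : q ∈ (C.homeo q a).source := ha
    have hq' : q'.proj ∈ a.e.source := hp ▸ ha
    obtain ⟨u, v, hu, hv, hqu, hqv, huv⟩ := t2_separation
      ((C.homeo q a).injOn.ne hq hq' hne)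
    exact ⟨_, _, (C.homeo q a).isOpen_inter_preimage hu, (C.homeo q a).isOpen_inter_preimage hv,
      ⟨hq, hqu⟩, ⟨hq', hqv⟩, Set.disjoint_left.mpr fun z hz hz' =>
        Set.disjoint_left.mp huv hz.2 hz'.2⟩
  · obtain ⟨u, v, hu, hv, hqu, hqv, huv⟩ := t2_separation hp
    exact ⟨_, _, hu.preimage hc, hv.preimage hc, hqu, hqv, huv.preimage _⟩

variable {C}

/-- A map into the total space is smooth if its base map is and its fibre coordinates are. -/
theorem contMDiffAt_of_coords {K N : Type*} [NormedAddCommGroup K] [NormedSpace ℝ K] {H : Type*}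
    [TopologicalSpace H] {I : ModelWithCorners ℝ K H} [TopologicalSpace N] [ChartedSpace H N]
    {f : N → Bundle.TotalSpace G T} {z : N} {a : AdaptedChart B}
    (ha : (f z).proj ∈ a.e.source)
    (hp : ContMDiffAt I 𝓘(ℝ, X m × X n) ∞ (fun z => (f z).proj) z)
    (hg : ContMDiffAt I 𝓘(ℝ, G) ∞ (fun z => C.coord a (f z).proj (f z).snd) z) :
    letI := C.topology
    letI := C.chartedSpace
    ContMDiffAt I 𝓘(ℝ, (X m × X n) × G) ∞ f z := by
  let := C.topology
  let := C.chartedSpace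
  have h1 : ContMDiffAt I 𝓘(ℝ, X m × X n) ∞ (fun z => a.e (f z).proj) z :=
    ContMDiffAt.comp z (a.e_smooth.contMDiffAt (a.e.open_source.mem_nhds ha)) hp
  have hsrc : ∀ᶠ z' in 𝓝 z, (f z').proj ∈ a.e.source :=
    hp.continuousAt.preimage_mem_nhds (a.e.open_source.mem_nhds ha)
  have hz : f z ∈ (C.homeo (f z) a).source := ha
  have h2 := ContMDiffAt.comp z
    ((C.contMDiffOn_homeo_symm (f z) a).contMDiffAt ((C.homeo (f z) a).open_target.mem_nhds
      ((C.homeo (f z) a).map_source hz))) (h1.prodMk_space hg)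
  refine h2.congr_of_eventuallyEq ?_
  filter_upwards [hsrc] with z' hz'
  exact ((C.homeo (f z) a).left_inv hz').symm

/-- The fibre coordinates of a smooth map are smooth. -/
theorem contMDiffAt_coords {K N : Type*} [NormedAddCommGroup K] [NormedSpace ℝ K] {H : Type*}
    [TopologicalSpace H] {I : ModelWithCorners ℝ K H} [TopologicalSpace N] [ChartedSpace H N]
    {f : N → Bundle.TotalSpace G T} {z : N} {a : AdaptedChart B}
    (ha : (f z).proj ∈ a.e.source) :
    letI := C.topology
    letI := C.chartedSpace
    ContMDiffAt I 𝓘(ℝ, (X m × X n) × G) ∞ f z →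
    ContMDiffAt I 𝓘(ℝ, (X m × X n) × G) ∞
      (fun z => (a.e (f z).proj, C.coord a (f z).proj (f z).snd)) z := by
  let := C.topology
  let := C.chartedSpace
  intro hf
  have hz : f z ∈ (C.homeo (f z) a).source := ha
  exact ContMDiffAt.comp z
    ((C.contMDiffOn_homeo (f z) a).contMDiffAt ((C.homeo (f z) a).open_source.mem_nhds hz)) hf

end FibreCoords

end Total


/-! ### The Lagrangian and its fibre derivative in adapted coordinates. -/

section Coordinates

variable {m n : ℕ} {M E F : Type*}
  [TopologicalSpace M] [ChartedSpace (X m) M] [IsManifold 𝓘(ℝ, X m) ∞ M]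
  [TopologicalSpace E] [ChartedSpace (X m × X n) E] [IsManifold 𝓘(ℝ, X m × X n) ∞ E]
  [TopologicalSpace F] [ChartedSpace (X n) F] [IsManifold 𝓘(ℝ, X n) ∞ F]
  {B : ConfigBundle m n M E F}

/-- The value of a form at a point, as a form on the model space. -/
def volAt (vol : DForm (X m) M m) (x : M) : X m [⋀^Fin m]→L[ℝ] ℝ := vol x

namespace AdaptedChart

variable (a : AdaptedChart B)

/-- `T_y e`, as a map between model spaces. -/
def DL (y : E) : (X m × X n) →L[ℝ] (X m × X n) := a.D y

/-- `(T_y e)⁻¹`, as a map between model spaces. -/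
def DinvL (y : E) : (X m × X n) →L[ℝ] (X m × X n) := a.Dinv y

/-- `T_x c`, as a map between model spaces. -/
def dL (x : M) : X m →L[ℝ] X m := a.d x

/-- `(T_x c)⁻¹`, as a map between model spaces. -/
def dinvL (x : M) : X m →L[ℝ] X m := a.dinv x

theorem DL_DinvL {y : E} (h : y ∈ a.e.source) (z : X m × X n) : a.DL y (a.DinvL y z) = z :=
  a.D_Dinv h z

theorem DinvL_DL {y : E} (h : y ∈ a.e.source) (z : X m × X n) : a.DinvL y (a.DL y z) = z :=
  a.Dinv_D h z

theorem dL_dinvL {x : M} (h : x ∈ a.c.source) (z : X m) : a.dL x (a.dinvL x z) = z :=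
  a.d_dinv h z

theorem dinvL_dL {x : M} (h : x ∈ a.c.source) (z : X m) : a.dinvL x (a.dL x z) = z :=
  a.dinv_d h z

/-- The coordinates `(x, y, v)` of a jet. -/
def jetCoord (j : J1 B) : (X m × X n) × (X m →L[ℝ] X n) :=
  (a.e j.proj, (jetCoords B).coord a j.proj j.snd)

/-- The matrix of a vertical-valued map in adapted coordinates, as a function of this map. -/
def vertCoord (y : E) : (X m →L[ℝ] (X m × X n)) →L[ℝ] (X m →L[ℝ] X n) :=
  ((ContinuousLinearMap.compL ℝ (X m) (X m × X n) (X n))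
      ((ContinuousLinearMap.snd ℝ (X m) (X n)).comp (a.DL y))).comp
    ((ContinuousLinearMap.compL ℝ (X m) (X m) (X m × X n)).flip (a.dinvL (B.proj y)))

theorem vertCoord_apply (y : E) (η : X m →L[ℝ] (X m × X n)) (v : X m) :
    a.vertCoord y η v = (a.DL y (η (a.dinvL (B.proj y) v))).2 := rfl

end AdaptedChart

/-- The Lagrangian in adapted coordinates. -/
def locL (L : J1 B → ℝ) (a : AdaptedChart B) (u : (X m × X n) × (X m →L[ℝ] X n)) : ℝ :=
  open Classical in
  if h : u.1 ∈ a.e.target then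
    L ⟨a.e.symm u.1, (jetCoords B).inv a (a.e.symm u.1) (a.e.map_target h) u.2⟩ else 0

variable {L : J1 B → ℝ} {a : AdaptedChart B}

theorem locL_jetCoord {j : J1 B} (h : j.proj ∈ a.e.source) : locL L a (a.jetCoord j) = L j := by
  have hm : (a.jetCoord j).1 ∈ a.e.target := a.e.map_source h
  rw [locL, dif_pos hm]
  exact congrArg L ((jetCoords B).mk_inv a (a.e.left_inv h) _ j.snd)

theorem contDiffAt_locL (hL : ContMDiff 𝓘(ℝ, (X m × X n) × (X m →L[ℝ] X n)) 𝓘(ℝ, ℝ) ∞ L)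
    {u : (X m × X n) × (X m →L[ℝ] X n)} (hu : u.1 ∈ a.e.target) :
    ContDiffAt ℝ ∞ (locL L a) u := by
  set q₀ : J1 B := ⟨a.e.symm u.1, (jetCoords B).inv a (a.e.symm u.1) (a.e.map_target hu) u.2⟩
  have hut : u ∈ ((jetCoords B).homeo q₀ a).target := ⟨hu, trivial⟩
  have h1 := (((jetCoords B).contMDiffOn_homeo_symm q₀ a).contMDiffAt
    (((jetCoords B).homeo q₀ a).open_target.mem_nhds hut))
  have h2 : ContMDiffAt 𝓘(ℝ, (X m × X n) × (X m →L[ℝ] X n)) 𝓘(ℝ, ℝ) ∞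
      (L ∘ ((jetCoords B).homeo q₀ a).symm) u := (hL _).comp u h1
  refine h2.contDiffAt.congr_of_eventuallyEq ?_
  filter_upwards [((jetCoords B).homeo q₀ a).open_target.mem_nhds hut] with u' hu'
  have e : ((jetCoords B).homeo q₀ a).symm u'
      = ⟨a.e.symm u'.1, (jetCoords B).inv a (a.e.symm u'.1) (a.e.map_target hu'.1) u'.2⟩ :=
    dif_pos hu'.1
  rw [locL, dif_pos hu'.1, Function.comp_apply, e]

/-- The momenta `∂£/∂v` in adapted coordinates. -/
def locMom (L : J1 B → ℝ) (a : AdaptedChart B) (u : (X m × X n) × (X m →L[ℝ] X n)) :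
    (X m →L[ℝ] X n) →L[ℝ] ℝ :=
  (fderiv ℝ (locL L a) u).comp (ContinuousLinearMap.inr ℝ (X m × X n) (X m →L[ℝ] X n))

theorem locMom_apply (u : (X m × X n) × (X m →L[ℝ] X n)) (A : X m →L[ℝ] X n) :
    locMom L a u A = fderiv ℝ (locL L a) u (0, A) := rfl

theorem contDiffAt_locMom (hL : ContMDiff 𝓘(ℝ, (X m × X n) × (X m →L[ℝ] X n)) 𝓘(ℝ, ℝ) ∞ L)
    {u : (X m × X n) × (X m →L[ℝ] X n)} (hu : u.1 ∈ a.e.target) :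
    ContDiffAt ℝ ∞ (locMom L a) u :=
  ((contDiffAt_locL hL hu).fderiv_right (m := ∞) (by simp)).clm_comp contDiffAt_const

/-- The intrinsic fibre derivative is taken at $0$ in the vector space modelling the affine fibre of
jets. The coordinates are affine along that fibre, so it becomes a partial derivative composed with
their linear part. -/
theorem fderiv_comp_affine {V W G : Type*} [NormedAddCommGroup V] [NormedSpace ℝ V]
    [NormedAddCommGroup W] [NormedSpace ℝ W] [NormedAddCommGroup G] [NormedSpace ℝ G]
    {l : W × G → ℝ} {u : W × G} (hl : DifferentiableAt ℝ l u) (S : V →L[ℝ] G) {f : V → ℝ}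
    (hf : ∀ η, f η = l (u.1, u.2 + S η)) (η : V) : fderiv ℝ f 0 η = fderiv ℝ l u (0, S η) := by
  have h2 : HasFDerivAt (fun η : V => (u.1, u.2 + S η)) ((0 : V →L[ℝ] W).prod S) 0 :=
    (hasFDerivAt_const _ _).prodMk (S.hasFDerivAt.const_add _)
  have h1 : HasFDerivAt l (fderiv ℝ l u) (u.1, u.2 + S 0) := by
    rw [map_zero, add_zero]; exact hl.hasFDerivAt
  have h3 := HasFDerivAt.comp (0 : V) h1 h2
  have h4 : f = l ∘ fun η : V => (u.1, u.2 + S η) := funext hf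
  rw [h4, h3.fderiv]
  rfl

theorem jetCoord_add (j : J1 B) (η : verticalHom B j.proj) :
    a.jetCoord ⟨j.proj, j.snd.add η⟩
      = ((a.jetCoord j).1, (a.jetCoord j).2 + a.vertCoord j.proj η.1) :=
  Prod.ext rfl ((a.vertCoord j.proj).map_add _ _)

theorem fibreDeriv_eq (hL : ContMDiff 𝓘(ℝ, (X m × X n) × (X m →L[ℝ] X n)) 𝓘(ℝ, ℝ) ∞ L)
    {j : J1 B} (h : j.proj ∈ a.e.source) (η : verticalHom B j.proj) :
    fibreDeriv L j η = locMom L a (a.jetCoord j) (a.vertCoord j.proj η.1) := by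
  have h1 : DifferentiableAt ℝ (locL L a) (a.jetCoord j) :=
    (contDiffAt_locL hL (a.e.map_source h)).differentiableAt (by simp)
  refine fderiv_comp_affine h1 ((a.vertCoord j.proj).comp (verticalHom B j.proj).subtypeL)
    (fun η => ?_) η
  refine (locL_jetCoord (a := a) (j := (⟨j.proj, j.snd.add η⟩ : J1 B)) h).symm.trans ?_
  rw [jetCoord_add]
  rfl

/-- The map `e^ν ⊗ w`. -/
abbrev tens (ν : Fin m) (w : X n) : X m →L[ℝ] X n := (EuclideanSpace.proj ν).smulRight w

theorem sum_tens (A : X m →L[ℝ] X n) : ∑ ν, tens ν (A (stdB ν)) = A := by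
  refine ContinuousLinearMap.ext fun v => ?_
  rw [sum_apply]
  conv_rhs => rw [← (EuclideanSpace.basisFun (Fin m) ℝ).sum_repr v, map_sum]
  refine Finset.sum_congr rfl fun ν _ => ?_
  simp

/-- The tensor $\sum_\mu e^\mu\otimes e_\mu$ does not depend on the basis. Hence the model basis of
$T_xM$ used to define `momentum` may be replaced by the coordinate basis of the adapted chart. -/
theorem momentum_coord (hL : ContMDiff 𝓘(ℝ, (X m × X n) × (X m →L[ℝ] X n)) 𝓘(ℝ, ℝ) ∞ L)
    {j : J1 B} (h : j.proj ∈ a.e.source) (z : X m × X n) (ν : Fin m) :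
    a.dL (B.proj j.proj) (momentum L j z) ν
      = locMom L a (a.jetCoord j) (tens ν (a.DL j.proj (verticalPart j z)).2) := by
  have h1 : momentum L j z = ∑ μ, fibreDeriv L j (tensorVertical j μ z) • (stdB μ : X m) := by
    change (∑ μ : Fin m, ((fibreDeriv L j).comp (tensorVertical j μ)).smulRight (stdB μ) :
      (X m × X n) →L[ℝ] X m) z = _
    rw [sum_apply]
    rfl
  set w := (a.DL j.proj (verticalPart j z)).2 with hw
  have h2 : ∀ μ, a.vertCoord j.proj (tensorVertical j μ z).1
      = ((EuclideanSpace.proj μ).comp (a.dinvL (B.proj j.proj))).smulRight w := by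
    intro μ
    refine ContinuousLinearMap.ext fun v => ?_
    rw [AdaptedChart.vertCoord_apply]
    change (a.DL j.proj ((a.dinvL (B.proj j.proj) v) μ • verticalPart j z)).2 = _
    rw [map_smul]
    rfl
  -- This is the change of basis: $\sum_\mu (dc\,e_\mu)^\nu\, e^\mu\circ dc^{-1}=e^\nu$.
  have h3 : ∑ μ, (a.dL (B.proj j.proj) (stdB μ)) ν •
      ((EuclideanSpace.proj μ).comp (a.dinvL (B.proj j.proj))).smulRight w = tens ν w := by
    refine ContinuousLinearMap.ext fun v => ?_
    rw [sum_apply]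
    have e : (∑ μ, (a.dinvL (B.proj j.proj) v) μ • (stdB μ : X m)) = a.dinvL (B.proj j.proj) v := by
      conv_rhs => rw [← (EuclideanSpace.basisFun (Fin m) ℝ).sum_repr (a.dinvL (B.proj j.proj) v)]
      refine Finset.sum_congr rfl fun ν _ => ?_
      simp
    have e2 := congrArg (fun u => (a.dL (B.proj j.proj) u) ν) e
    simp only [map_sum, map_smul, a.dL_dinvL (a.mapsTo _ h)] at e2
    change _ = v ν • w
    rw [← e2]
    simp only [PiLp.smul_apply, WithLp.ofLp_sum, Finset.sum_apply, Finset.sum_smul, smul_eq_mul]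
    refine Finset.sum_congr rfl fun μ _ => ?_
    simp [smul_smul, mul_comm]
  rw [h1, map_sum, ← h3, map_sum]
  simp only [map_smul, WithLp.ofLp_sum, Finset.sum_apply, PiLp.smul_apply, smul_eq_mul]
  refine Finset.sum_congr rfl fun μ _ => ?_
  rw [fibreDeriv_eq hL h, h2, mul_comm]

end Coordinates


/-! ### The trace as a derivation on forms of top degree. -/

section Trace

variable {m : ℕ}

theorem alternating_update_std (α : X m [⋀^Fin m]→L[ℝ] ℝ) (i : Fin m) (z : X m) :
    α (Function.update (fun j => stdB j) i z) = z i * α (fun j => stdB j) := by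
  have hz : z = ∑ μ, z μ • (stdB μ : X m) := by
    conv_lhs => rw [← (EuclideanSpace.basisFun (Fin m) ℝ).sum_repr z]
    refine Finset.sum_congr rfl fun ν _ => ?_
    simp
  have h := α.toMultilinearMap.map_update_sum Finset.univ i
    (fun μ => z μ • (stdB μ : X m)) (fun j => (stdB j : X m))
  rw [← hz] at h
  refine h.trans ?_
  rw [Finset.sum_eq_single i]
  · change α _ = _
    rw [ContinuousAlternatingMap.map_update_smul, Function.update_eq_self, smul_eq_mul]
  · intro μ _ hμ
    change α _ = _
    rw [ContinuousAlternatingMap.map_update_smul]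
    rw [α.map_eq_zero_of_eq _ (i := i) (j := μ) (by simp [hμ]) hμ.symm, smul_zero]
  · simp

/-- Both sides are top-degree alternating in $V$, so it is enough to compare them on the standard
basis, where the $i$-th summand picks out the $i$-th diagonal entry of $A$. -/
theorem sum_alternating_update (α : X m [⋀^Fin m]→L[ℝ] ℝ) (A : X m →L[ℝ] X m) (V : Fin m → X m) :
    ∑ i, α (Function.update V i (A (V i))) = (∑ i, (A (stdB i)) i) * α V := by
  have h := insertForm_apply α (ContinuousLinearMap.id ℝ (X m)) A V
  refine h.symm.trans ?_
  rw [alternating_eq_stdVol, insertForm_apply, alternating_eq_stdVol α V, Finset.sum_mul,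
    Finset.sum_mul]
  refine Finset.sum_congr rfl fun i _ => ?_
  have := alternating_update_std α i (A (stdB i))
  rw [← mul_assoc, ← this]
  rfl

end Trace

/-! ### The Legendre maps in coordinates. -/

section Legendre

variable {m n : ℕ} {M E F : Type*}
  [TopologicalSpace M] [ChartedSpace (X m) M] [IsManifold 𝓘(ℝ, X m) ∞ M]
  [TopologicalSpace E] [ChartedSpace (X m × X n) E] [IsManifold 𝓘(ℝ, X m × X n) ∞ E]
  [TopologicalSpace F] [ChartedSpace (X n) F] [IsManifold 𝓘(ℝ, X n) ∞ F]
  {B : ConfigBundle m n M E F} {L : J1 B → ℝ} {a : AdaptedChart B} {vol : DForm (X m) M m}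

/-- `T_y π`, as a map between model spaces. -/
def tprojL (B : ConfigBundle m n M E F) (y : E) : (X m × X n) →L[ℝ] X m := B.tproj y

/-- The momentum map of `£`, as a map between model spaces. -/
def momentumL (L : J1 B → ℝ) (j : J1 B) : (X m × X n) →L[ℝ] X m := momentum L j

/-- A jet, as a map between model spaces. -/
def jetL (j : J1 B) : X m →L[ℝ] (X m × X n) := j.snd.1

/-- The coefficient of the volume form in adapted coordinates. -/
def volCoeff (vol : DForm (X m) M m) (a : AdaptedChart B) (x : M) : ℝ :=
  volAt vol x (fun i => a.dinvL x (stdB i))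

theorem volAt_dinvL (x : M) (V : Fin m → X m) :
    volAt vol x (fun i => a.dinvL x (V i)) = volCoeff vol a x * stdVol m V :=
  alternating_eq_stdVol ((volAt vol x).compContinuousLinearMap (a.dinvL x)) V

theorem volCoeff_ne_zero (hvol : IsVolumeForm vol) {x : M} (h : x ∈ a.c.source) :
    volCoeff vol a x ≠ 0 := by
  refine alternating_comp_std_ne_zero (α := volAt vol x) (hvol.ne_zero x) (A := a.dinvL x)
    (A' := a.dL x) fun z => a.dinvL_dL h z

theorem contMDiffAt_volCoeff (hvol : IsVolumeForm vol) {x : M} (h : x ∈ a.c.source) :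
    ContMDiffAt 𝓘(ℝ, X m) 𝓘(ℝ, ℝ) ∞ (volCoeff vol a) x := by
  have hc : a.c ∈ IsManifold.maximalAtlas 𝓘(ℝ, X m) ∞ M :=
    a.c.mem_maximalAtlas_of_contMDiffOn a.c_smooth a.c_symm_smooth
  have h1 : ContMDiffAt 𝓘(ℝ, X m) 𝓘(ℝ, ℝ) ∞ (chartCoeff vol a.c) (a.c x) :=
    ((hvol.smooth a.c hc).contDiffAt (a.c.open_target.mem_nhds (a.c.map_source h))).contMDiffAt
  have h2 := h1.comp x (a.c_smooth.contMDiffAt (a.c.open_source.mem_nhds h))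
  refine h2.congr_of_eventuallyEq ?_
  filter_upwards [a.c.open_source.mem_nhds h] with y hy
  have key : ∀ z, y = z → ∀ v, volAt vol y v = volAt vol z v := by rintro _ rfl v; rfl
  exact key _ (a.c.left_inv hy).symm _

/-- This is the coordinate expression $g\big(\tfrac{\partial £}{\partial v^A_\nu}(dy^A-v^A_\mu
dx^\mu)\wedge d^{m-1}x_\nu+£\,d^mx\big)$. The adapted chart need not be unimodular for $\omega$,
hence the coefficient $g$, which is `volCoeff`. -/
theorem extLegendre_DinvL (hL : ContMDiff 𝓘(ℝ, (X m × X n) × (X m →L[ℝ] X n)) 𝓘(ℝ, ℝ) ∞ L)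
    {j : J1 B} (h : j.proj ∈ a.e.source) (V : Fin m → X m × X n) :
    (extLegendre vol L j).snd.1 (fun i => a.DinvL j.proj (V i))
      = volCoeff vol a (B.proj j.proj) *
        ((∑ i, stdVol m (Function.update (fun k => (V k).1) i
          (∑ ν, locMom L a (a.jetCoord j)
            (tens ν ((V i).2 - (a.jetCoord j).2 (V i).1)) • stdB ν)))
          + locL L a (a.jetCoord j) * stdVol m (fun k => (V k).1)) := by
  have hx := a.mapsTo _ h
  have hP : ∀ z : X m × X n, tprojL B j.proj (a.DinvL j.proj z) = a.dinvL (B.proj j.proj) z.1 := by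
    intro z
    have h1 := a.tproj_Dinv h z
    have h2 := a.dinv_d hx (B.tproj j.proj (a.Dinv j.proj z))
    rw [h1] at h2
    exact h2.symm
  have hver : ∀ z : X m × X n, (a.DL j.proj (verticalPart j (a.DinvL j.proj z))).2
      = z.2 - (a.jetCoord j).2 z.1 := by
    intro z
    have e1 : verticalPart j (a.DinvL j.proj z)
        = a.DinvL j.proj z - jetL j (a.dinvL (B.proj j.proj) z.1) := by
      rw [← hP]; rfl
    rw [e1, map_sub, a.DL_DinvL h]
    rfl
  -- The momentum vector is expanded in the coordinate basis, where `momentum_coord` gives its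
  -- components.
  have hK : ∀ z : X m × X n, momentumL L j (a.DinvL j.proj z) = a.dinvL (B.proj j.proj)
      (∑ ν, locMom L a (a.jetCoord j) (tens ν (z.2 - (a.jetCoord j).2 z.1)) • stdB ν) := by
    intro z
    refine (a.dinvL_dL hx (momentumL L j (a.DinvL j.proj z))).symm.trans ?_
    refine congrArg (a.dinvL (B.proj j.proj)) ?_
    have e2 : ∀ v : X m, v = ∑ μ, v μ • (stdB μ : X m) := fun v => by
      conv_lhs => rw [← (EuclideanSpace.basisFun (Fin m) ℝ).sum_repr v]
      refine Finset.sum_congr rfl fun ν _ => ?_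
      simp
    rw [e2 (a.dL (B.proj j.proj) (momentumL L j (a.DinvL j.proj z)))]
    refine Finset.sum_congr rfl fun ν _ => ?_
    rw [← hver]
    exact congrArg (· • (stdB ν : X m)) (momentum_coord hL h _ ν)
  have h1 : (extLegendre vol L j).snd.1 (fun i => a.DinvL j.proj (V i))
      = (∑ i, volAt vol (B.proj j.proj) (Function.update
          (fun k => tprojL B j.proj (a.DinvL j.proj (V k))) i
          (momentumL L j (a.DinvL j.proj (V i)))))
        + L j * volAt vol (B.proj j.proj) (fun k => tprojL B j.proj (a.DinvL j.proj (V k))) := by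
    refine (ContinuousAlternatingMap.add_apply _ _ _).trans ?_
    exact congrArg₂ (· + ·) (insertForm_apply _ _ _ _) rfl
  rw [h1, mul_add, Finset.mul_sum, locL_jetCoord h]
  congr 1
  · refine Finset.sum_congr rfl fun i _ => ?_
    rw [hK, ← volAt_dinvL]
    congr 1
    funext k
    by_cases hk : k = i
    · subst hk; rw [Function.update_self, Function.update_self]
    · rw [Function.update_of_ne hk, Function.update_of_ne hk, hP]
  · have : (fun k => tprojL B j.proj (a.DinvL j.proj (V k)))
        = fun k => a.dinvL (B.proj j.proj) (V k).1 := funext fun k => hP _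
    rw [this, volAt_dinvL]
    ring

/-- These are the momenta $p^\nu_A=g\,\partial£/\partial v^A_\nu$: with one vertical argument in
place $\nu$, only the contraction term survives. -/
theorem extLegendre_mom (hL : ContMDiff 𝓘(ℝ, (X m × X n) × (X m →L[ℝ] X n)) 𝓘(ℝ, ℝ) ∞ L)
    {j : J1 B} (h : j.proj ∈ a.e.source) (ν : Fin m) (w : X n) :
    ((extMomCoords B).coord a j.proj (extLegendre vol L j).snd).1 ν w
      = volCoeff vol a (B.proj j.proj) * locMom L a (a.jetCoord j) (tens ν w) := by
  refine (extLegendre_DinvL hL h (hvArgs ν w)).trans ?_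
  have hν : (hvArgs ν w ν : X m × X n) = (0, w) := by simp [hvArgs]
  have h0 : stdVol m (fun j => (hvArgs ν w j : X m × X n).1) = 0 :=
    (stdVol m).map_coord_zero ν (by rw [hν])
  have hup : ∀ z : X m, Function.update (fun j => (hvArgs ν w j : X m × X n).1) ν z
      = Function.update (fun j => (stdB j : X m)) ν z := by
    intro z
    funext j
    by_cases hj : j = ν
    · subst hj; simp
    · simp [hvArgs, hj]
  rw [h0, mul_zero, add_zero, Finset.sum_eq_single ν]
  · rw [hν, hup, alternating_update_std, stdVol_std, mul_one]
    simp only [map_zero, sub_zero, WithLp.ofLp_sum, Finset.sum_apply, PiLp.smul_apply]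
    rw [Finset.sum_eq_single ν]
    · simp
    · intro μ _ hμ
      simp [hμ.symm]
    · simp
  · intro i _ hi
    refine (stdVol m).map_coord_zero ν ?_
    rw [Function.update_of_ne hi.symm, hν]
  · simp

/-- The last coordinate is $p=g\big(£-v^A_\nu\,\partial£/\partial v^A_\nu\big)$; summing the
contraction term over all places reassembles the full matrix $v$. -/
theorem extLegendre_energy (hL : ContMDiff 𝓘(ℝ, (X m × X n) × (X m →L[ℝ] X n)) 𝓘(ℝ, ℝ) ∞ L)
    {j : J1 B} (h : j.proj ∈ a.e.source) :
    ((extMomCoords B).coord a j.proj (extLegendre vol L j).snd).2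
      = volCoeff vol a (B.proj j.proj) *
        (locL L a (a.jetCoord j) - locMom L a (a.jetCoord j) (a.jetCoord j).2) := by
  refine (extLegendre_DinvL hL h (fun i => (stdB i, 0))).trans ?_
  rw [stdVol_std, mul_one]
  congr 1
  have : ∀ i : Fin m, stdVol m (Function.update (fun k => (stdB k : X m)) i
      (∑ ν, locMom L a (a.jetCoord j) (tens ν ((0 : X n) - (a.jetCoord j).2 (stdB i))) • stdB ν))
      = -locMom L a (a.jetCoord j) (tens i ((a.jetCoord j).2 (stdB i))) := by
    intro i
    rw [alternating_update_std, stdVol_std, mul_one]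
    simp only [WithLp.ofLp_sum, Finset.sum_apply, PiLp.smul_apply]
    rw [Finset.sum_eq_single i]
    · have e : tens i ((0 : X n) - (a.jetCoord j).2 (stdB i))
          = -tens i ((a.jetCoord j).2 (stdB i)) := by
        ext; simp
      rw [e, map_neg]; simp
    · intro μ _ hμ
      simp [hμ.symm]
    · simp
  simp only [this]
  rw [Finset.sum_neg_distrib, ← map_sum, sum_tens]
  ring

/-- Smoothness is read off the coordinate formulas for $p^\nu_A$ and $p$. It is needed so that the
Hamiltonian section obeys the chain rule when $\Theta_h$ is pulled back. -/
theorem contMDiff_extLegendre (hvol : IsVolumeForm vol)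
    (hL : ContMDiff 𝓘(ℝ, (X m × X n) × (X m →L[ℝ] X n)) 𝓘(ℝ, ℝ) ∞ L) :
    ContMDiff 𝓘(ℝ, (X m × X n) × (X m →L[ℝ] X n))
      𝓘(ℝ, (X m × X n) × ((Fin m → (X n →L[ℝ] ℝ)) × ℝ)) ∞ (extLegendre vol L) := by
  intro j
  obtain ⟨a, ha⟩ := B.exists_adaptedChart j.proj
  have hπ : ContMDiff 𝓘(ℝ, (X m × X n) × (X m →L[ℝ] X n)) 𝓘(ℝ, X m × X n) ∞
      (Bundle.TotalSpace.proj : J1 B → E) := (jetCoords B).contMDiff_proj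
  have hj : ContMDiffAt 𝓘(ℝ, (X m × X n) × (X m →L[ℝ] X n))
      𝓘(ℝ, (X m × X n) × (X m →L[ℝ] X n)) ∞ a.jetCoord j :=
    FibreCoords.contMDiffAt_coords (C := jetCoords B) (f := fun j : J1 B => j) (a := a) ha
      contMDiffAt_id
  have hsrc : ∀ᶠ j' in 𝓝 j, j'.proj ∈ a.e.source :=
    hπ.continuous.continuousAt.preimage_mem_nhds (a.e.open_source.mem_nhds ha)
  have hg : ContMDiffAt 𝓘(ℝ, (X m × X n) × (X m →L[ℝ] X n)) 𝓘(ℝ, ℝ) ∞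
      (fun j' : J1 B => volCoeff vol a (B.proj j'.proj)) j :=
    ContMDiffAt.comp (g := volCoeff vol a) j (contMDiffAt_volCoeff hvol (a.mapsTo _ ha))
      ((B.contMDiff_proj.comp hπ) j)
  have hu : (a.jetCoord j).1 ∈ a.e.target := a.e.map_source ha
  have hl : ContMDiffAt 𝓘(ℝ, (X m × X n) × (X m →L[ℝ] X n)) 𝓘(ℝ, ℝ) ∞
      (fun j' => locL L a (a.jetCoord j')) j :=
    ContMDiffAt.comp j (contDiffAt_locL hL hu).contMDiffAt hj
  have hm : ∀ A : J1 B → (X m →L[ℝ] X n), ContMDiffAt 𝓘(ℝ, (X m × X n) × (X m →L[ℝ] X n))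
      𝓘(ℝ, X m →L[ℝ] X n) ∞ A j → ContMDiffAt 𝓘(ℝ, (X m × X n) × (X m →L[ℝ] X n)) 𝓘(ℝ, ℝ) ∞
      (fun j' => locMom L a (a.jetCoord j') (A j')) j := fun A hA =>
    (ContMDiffAt.comp j (contDiffAt_locMom hL hu).contMDiffAt hj).clm_apply hA
  refine FibreCoords.contMDiffAt_of_coords (C := extMomCoords B) (a := a)
    (f := extLegendre vol L) ha (hπ j) ?_
  refine ContMDiffAt.prodMk_space (f := fun j' : J1 B =>
    ((extMomCoords B).coord a j'.proj (extLegendre vol L j').snd).1) (g := fun j' : J1 B =>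
    ((extMomCoords B).coord a j'.proj (extLegendre vol L j').snd).2) ?_ ?_
  · refine contMDiffAt_pi_space.mpr fun ν => ?_
    have h1 : ContMDiffAt 𝓘(ℝ, (X m × X n) × (X m →L[ℝ] X n)) 𝓘(ℝ, X n →L[ℝ] ℝ) ∞
        (fun j' : J1 B => volCoeff vol a (B.proj j'.proj) • (locMom L a (a.jetCoord j')).comp
          ((ContinuousLinearMap.smulRightL ℝ (X m) (X n)) (EuclideanSpace.proj ν))) j :=
      hg.smul ((ContMDiffAt.comp j (contDiffAt_locMom hL hu).contMDiffAt hj).clm_comp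
        contMDiffAt_const)
    refine h1.congr_of_eventuallyEq ?_
    filter_upwards [hsrc] with j' hj'
    ext1 w
    exact extLegendre_mom hL hj' ν w
  · have h1 := hm (fun j' => (a.jetCoord j').2) (contDiff_snd.contMDiff.contMDiffAt.comp j hj)
    refine (hg.mul (hl.sub h1)).congr_of_eventuallyEq ?_
    filter_upwards [hsrc] with j' hj' using extLegendre_energy hL hj'

theorem legendre_coord (hL : ContMDiff 𝓘(ℝ, (X m × X n) × (X m →L[ℝ] X n)) 𝓘(ℝ, ℝ) ∞ L)
    {j : J1 B} (h : j.proj ∈ a.e.source) (ν : Fin m) (w : X n) :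
    (restMomCoords B).coord a j.proj (legendre vol L j).snd ν w
      = volCoeff vol a (B.proj j.proj) * locMom L a (a.jetCoord j) (tens ν w) := by
  rw [← extLegendre_mom hL h]
  have : (restMomCoords B).coord a j.proj (legendre vol L j).snd
      = ((extMomCoords B).coord a j.proj (extLegendre vol L j).snd).1 := by
    refine (dif_pos h).trans ?_
    rfl
  rw [this]

end Legendre


/-! ### The common density of both action functionals. -/

section Density

variable {m n : ℕ} {M E F : Type*}
  [TopologicalSpace M] [ChartedSpace (X m) M] [IsManifold 𝓘(ℝ, X m) ∞ M]
  [TopologicalSpace E] [ChartedSpace (X m × X n) E] [IsManifold 𝓘(ℝ, X m × X n) ∞ E]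
  [TopologicalSpace F] [ChartedSpace (X n) F] [IsManifold 𝓘(ℝ, X n) ∞ F]
  {B : ConfigBundle m n M E F} {L : J1 B → ℝ} {a : AdaptedChart B} {vol : DForm (X m) M m}

/-- On vectors that project to a basis of $T_xM$, the form $\sum_\nu\theta^\nu\wedge i(e_\nu)\omega$
becomes the trace of an endomorphism times $\omega$. For the Poincaré–Cartan form that trace is
$\frac{\partial£}{\partial v}(A-v)$, the pairing with the failure of the jet to be the tangent map
$T$. -/
theorem extLegendre_section (hL : ContMDiff 𝓘(ℝ, (X m × X n) × (X m →L[ℝ] X n)) 𝓘(ℝ, ℝ) ∞ L)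
    {j : J1 B} (h : j.proj ∈ a.e.source) {T : X m →L[ℝ] (X m × X n)}
    (hT : ∀ v, tprojL B j.proj (T v) = v) :
    (extLegendre vol L j).snd.1 (fun i => T (stdB i))
      = (locL L a (a.jetCoord j)
        + locMom L a (a.jetCoord j) (a.vertCoord j.proj T - (a.jetCoord j).2))
        * volAt vol (B.proj j.proj) (fun i => stdB i) := by
  have hx := a.mapsTo _ h
  set A := a.vertCoord j.proj T with hA
  set v := (a.jetCoord j).2 with hv
  set V : Fin m → X m × X n := fun i => a.DL j.proj (T (stdB i)) with hV
  have hV1 : ∀ i, (V i).1 = a.dL (B.proj j.proj) (stdB i) := fun i =>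
    (a.fst_D h (T (stdB i))).trans (congrArg (a.dL (B.proj j.proj)) (hT (stdB i)))
  have hV2 : ∀ i, (V i).2 = A (V i).1 := fun i => by
    rw [hV1, hA, AdaptedChart.vertCoord_apply, a.dinvL_dL hx]
  have hT' : (fun i => T (stdB i)) = fun i => a.DinvL j.proj (V i) := funext fun i =>
    (a.DinvL_DL h (T (stdB i))).symm
  have h1 := extLegendre_DinvL (vol := vol) hL h V
  rw [← hT'] at h1
  refine h1.trans ?_
  set π := locMom L a (a.jetCoord j) with hπ
  -- The endomorphism $u\mapsto\sum_\nu\frac{\partial£}{\partial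
  -- v}\big(e^\nu\otimes(A-v)u\big)e_\nu$, whose trace is computed in `htr`.
  let K : X m →L[ℝ] X m := ∑ ν : Fin m, ((π.comp
    ((ContinuousLinearMap.smulRightL ℝ (X m) (X n)) (EuclideanSpace.proj ν))).comp
      (A - v)).smulRight (stdB ν)
  have hK : ∀ u, K u = ∑ ν, π (tens ν ((A - v) u)) • stdB ν := fun u => by
    simp only [K, sum_apply]
    rfl
  have hvol : volCoeff vol a (B.proj j.proj) * stdVol m (fun k => (V k).1)
      = volAt vol (B.proj j.proj) (fun i => stdB i) := by
    rw [← volAt_dinvL]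
    congr 1
    funext i
    rw [hV1, a.dinvL_dL hx]
  have hsum : ∀ i, (∑ ν, π (tens ν ((V i).2 - v (V i).1)) • (stdB ν : X m)) = K (V i).1 := by
    intro i
    rw [hK, hV2]
    rfl
  have htr : ∑ i, (K (stdB i)) i = π (A - v) := by
    conv_rhs => rw [← sum_tens (A - v), map_sum]
    refine Finset.sum_congr rfl fun i _ => ?_
    rw [hK]
    simp only [WithLp.ofLp_sum, Finset.sum_apply, PiLp.smul_apply]
    rw [Finset.sum_eq_single i]
    · simp
    · intro μ _ hμ
      simp [hμ.symm]
    · simp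
  have h2 := sum_alternating_update (stdVol m) K (fun k => (V k).1)
  have h3 : (∑ i, stdVol m (Function.update (fun k => (V k).1) i
      (∑ ν, π (tens ν ((V i).2 - v (V i).1)) • (stdB ν : X m))))
      = π (A - v) * stdVol m (fun k => (V k).1) := by
    rw [← htr, ← h2]
    exact Finset.sum_congr rfl fun i _ =>
      congrArg (fun z => stdVol m (Function.update (fun k => (V k).1) i z)) (hsum i)
  rw [← hvol]
  rw [h3]
  ring

/-- The tangent map of a map to `E`, as a map between model spaces. -/
def velL (φ : M → E) (x : M) : X m →L[ℝ] (X m × X n) :=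
  mfderiv 𝓘(ℝ, X m) 𝓘(ℝ, X m × X n) φ x

theorem tprojL_velL {φ : M → E} {x : M} (hφ : MDifferentiableAt 𝓘(ℝ, X m) 𝓘(ℝ, X m × X n) φ x)
    (hs : ∀ x, B.proj (φ x) = x) (v : X m) : tprojL B (φ x) (velL φ x v) = v := by
  have h1 := (B.mdifferentiable_proj (φ x)).hasMFDerivAt.comp x hφ.hasMFDerivAt
  have h2 : B.proj ∘ φ = id := funext hs
  rw [h2] at h1
  exact congrArg (fun L => L v) (hasMFDerivAt_unique h1 (hasMFDerivAt_id x))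

/-- This identifies $A$ with an ordinary derivative of the coordinate expression of the section, so
that calculus in $\mathbb R^m$ applies. -/
theorem vertCoord_velL {φ : M → E} {x : M}
    (hφ : MDifferentiableAt 𝓘(ℝ, X m) 𝓘(ℝ, X m × X n) φ x) (hs : B.proj (φ x) = x)
    (h : φ x ∈ a.e.source) :
    a.vertCoord (φ x) (velL φ x) = fderiv ℝ (fun u => (a.e (φ (a.c.symm u))).2) (a.c x) := by
  have hx : x ∈ a.c.source := by have := a.mapsTo _ h; rwa [hs] at this
  have hx' : a.c.symm (a.c x) = x := a.c.left_inv hx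
  have h1 : HasMFDerivAt 𝓘(ℝ, X m) 𝓘(ℝ, X m) a.c.symm (a.c x) (a.dinvL x) :=
    (a.c_mdiff.mdifferentiableAt_symm (a.c.map_source hx)).hasMFDerivAt
  have h2 : HasMFDerivAt 𝓘(ℝ, X m) 𝓘(ℝ, X m × X n) φ (a.c.symm (a.c x)) (velL φ x) := by
    rw [hx']; exact hφ.hasMFDerivAt
  have h3 : HasMFDerivAt 𝓘(ℝ, X m × X n) 𝓘(ℝ, X m × X n) a.e (φ (a.c.symm (a.c x)))
      (a.DL (φ x)) := by
    rw [hx']; exact (a.e_mdiff.mdifferentiableAt h).hasMFDerivAt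
  have h4 : HasMFDerivAt 𝓘(ℝ, X m) 𝓘(ℝ, X m × X n) (a.e ∘ (φ ∘ a.c.symm)) (a.c x)
      ((a.DL (φ x)).comp ((velL φ x).comp (a.dinvL x))) :=
    HasMFDerivAt.comp (a.c x) h3 (HasMFDerivAt.comp (a.c x) h2 h1)
  have h5 : HasFDerivAt (fun u => (a.e (φ (a.c.symm u))).2)
      ((ContinuousLinearMap.snd ℝ (X m) (X n)).comp
        ((a.DL (φ x)).comp ((velL φ x).comp (a.dinvL x)))) (a.c x) :=
    h4.hasFDerivAt.snd
  rw [h5.fderiv]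
  refine ContinuousLinearMap.ext fun v => ?_
  rw [AdaptedChart.vertCoord_apply, hs]
  rfl

theorem contMDiffAt_prod_symm {c : OpenPartialHomeomorph M (X m)}
    (hc : ContMDiffOn 𝓘(ℝ, X m) 𝓘(ℝ, X m) ∞ c.symm c.target) {t : ℝ} {u : X m}
    (hu : u ∈ c.target) :
    ContMDiffAt 𝓘(ℝ, ℝ × X m) (𝓘(ℝ, ℝ).prod 𝓘(ℝ, X m)) ∞
      (fun z : ℝ × X m => (z.1, c.symm z.2)) (t, u) := by
  have h1 : ContMDiffAt 𝓘(ℝ, ℝ × X m) 𝓘(ℝ, X m) ∞ (fun z : ℝ × X m => c.symm z.2) (t, u) :=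
    ContMDiffAt.comp (t, u) (hc.contMDiffAt (c.open_target.mem_nhds hu))
      contDiff_snd.contMDiff.contMDiffAt
  exact contDiff_fst.contMDiff.contMDiffAt.prodMk h1

theorem contMDiffAt_prod_chart (a : AdaptedChart B) {t : ℝ} {x : M} (hx : x ∈ a.c.source) :
    ContMDiffAt (𝓘(ℝ, ℝ).prod 𝓘(ℝ, X m)) 𝓘(ℝ, ℝ × X m) ∞
      (fun z : ℝ × M => (z.1, a.c z.2)) (t, x) :=
  contMDiffAt_fst.prodMk_space
    (ContMDiffAt.comp (t, x) (a.c_smooth.contMDiffAt (a.c.open_source.mem_nhds hx)) contMDiffAt_snd)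

/-- The fibre coordinates of a family of sections, in adapted coordinates. -/
def locY (a : AdaptedChart B) (Y : ℝ → M → E) (z : ℝ × X m) : X n :=
  (a.e (Y z.1 (a.c.symm z.2))).2

theorem contDiffAt_locY {Y : ℝ → M → E}
    (hY : ContMDiff (𝓘(ℝ, ℝ).prod 𝓘(ℝ, X m)) 𝓘(ℝ, X m × X n) ∞ (fun z : ℝ × M => Y z.1 z.2))
    {t : ℝ} {x : M} (hs : B.proj (Y t x) = x) (h : Y t x ∈ a.e.source) :
    ContDiffAt ℝ ∞ (locY a Y) (t, a.c x) := by
  have hx : x ∈ a.c.source := by have := a.mapsTo _ h; rwa [hs] at this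
  have hx' : a.c.symm (a.c x) = x := a.c.left_inv hx
  have h1 := contMDiffAt_prod_symm a.c_symm_smooth (t := t) (a.c.map_source hx)
  have h2 : ContMDiffAt 𝓘(ℝ, ℝ × X m) 𝓘(ℝ, X m × X n) ∞
      (fun z : ℝ × X m => Y z.1 (a.c.symm z.2)) (t, a.c x) :=
    ContMDiffAt.comp (t, a.c x) (hY _) h1
  have h3 : ContMDiffAt 𝓘(ℝ, ℝ × X m) 𝓘(ℝ, X m × X n) ∞
      (fun z : ℝ × X m => a.e (Y z.1 (a.c.symm z.2))) (t, a.c x) := by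
    refine ContMDiffAt.comp (t, a.c x) ?_ h2
    rw [hx']
    exact a.e_smooth.contMDiffAt (a.e.open_source.mem_nhds h)
  exact contDiffAt_snd.comp _ h3.contDiffAt

/-- The derivative of `locY` in the directions of the base. -/
def locA (a : AdaptedChart B) (Y : ℝ → M → E) (z : ℝ × X m) : X m →L[ℝ] X n :=
  (fderiv ℝ (locY a Y) z).comp (ContinuousLinearMap.inr ℝ ℝ (X m))

theorem contDiffAt_locA {Y : ℝ → M → E}
    (hY : ContMDiff (𝓘(ℝ, ℝ).prod 𝓘(ℝ, X m)) 𝓘(ℝ, X m × X n) ∞ (fun z : ℝ × M => Y z.1 z.2))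
    {t : ℝ} {x : M} (hs : B.proj (Y t x) = x) (h : Y t x ∈ a.e.source) :
    ContDiffAt ℝ ∞ (locA a Y) (t, a.c x) :=
  ((contDiffAt_locY hY hs h).fderiv_right (m := ∞) (by simp)).clm_comp contDiffAt_const

theorem contMDiff_slice {N K : Type*} [NormedAddCommGroup K] [NormedSpace ℝ K]
    [TopologicalSpace N] [ChartedSpace K N] {Y : ℝ → M → N}
    (hY : ContMDiff (𝓘(ℝ, ℝ).prod 𝓘(ℝ, X m)) 𝓘(ℝ, K) ∞ (fun z : ℝ × M => Y z.1 z.2)) (t : ℝ) :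
    ContMDiff 𝓘(ℝ, X m) 𝓘(ℝ, K) ∞ (Y t) :=
  hY.comp (contMDiff_const.prodMk contMDiff_id)

theorem vertCoord_family {Y : ℝ → M → E}
    (hY : ContMDiff (𝓘(ℝ, ℝ).prod 𝓘(ℝ, X m)) 𝓘(ℝ, X m × X n) ∞ (fun z : ℝ × M => Y z.1 z.2))
    {t : ℝ} {x : M} (hs : B.proj (Y t x) = x) (h : Y t x ∈ a.e.source) :
    a.vertCoord (Y t x) (velL (Y t) x) = locA a Y (t, a.c x) := by
  rw [vertCoord_velL (((contMDiff_slice hY t) x).mdifferentiableAt (by simp)) hs h]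
  have h1 : HasFDerivAt (locY a Y) (fderiv ℝ (locY a Y) (t, a.c x)) (t, a.c x) :=
    ((contDiffAt_locY hY hs h).differentiableAt (by simp)).hasFDerivAt
  have h2 : HasFDerivAt (fun u : X m => (t, u)) (ContinuousLinearMap.inr ℝ ℝ (X m)) (a.c x) :=
    hasFDerivAt_prodMk_right t (a.c x)
  exact (HasFDerivAt.comp (a.c x) h1 h2).fderiv

/-- The canonical lifting of a smooth family of sections is smooth. -/
theorem contMDiff_j1_family {φ : ℝ → SmoothSection m (X m × X n) B.proj}
    (hφ : ContMDiff (𝓘(ℝ, ℝ).prod 𝓘(ℝ, X m)) 𝓘(ℝ, X m × X n) ∞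
      (fun z : ℝ × M => (φ z.1).toFun z.2)) :
    ContMDiff (𝓘(ℝ, ℝ).prod 𝓘(ℝ, X m)) 𝓘(ℝ, (X m × X n) × (X m →L[ℝ] X n)) ∞
      (fun z : ℝ × M => j1 (φ z.1) z.2) := by
  rintro ⟨t, x⟩
  obtain ⟨a, ha⟩ := B.exists_adaptedChart ((φ t).toFun x)
  have hs := (φ t).proj_toFun x
  have hx : x ∈ a.c.source := by have := a.mapsTo _ ha; rwa [hs] at this
  refine FibreCoords.contMDiffAt_of_coords (C := jetCoords B) (a := a)
    (f := fun z : ℝ × M => j1 (φ z.1) z.2) ha (hφ (t, x)) ?_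
  have h1 := contDiffAt_locA (a := a) (Y := fun t => (φ t).toFun) hφ hs ha
  have h2 := ContMDiffAt.comp (t, x) h1.contMDiffAt (contMDiffAt_prod_chart a (t := t) hx)
  refine h2.congr_of_eventuallyEq ?_
  filter_upwards [hφ.continuous.continuousAt.preimage_mem_nhds (a.e.open_source.mem_nhds ha)]
    with z hz
  exact vertCoord_family (a := a) (Y := fun t => (φ t).toFun) hφ ((φ z.1).proj_toFun z.2) hz

theorem contMDiff_j1 (φ : SmoothSection m (X m × X n) B.proj) :
    ContMDiff 𝓘(ℝ, X m) 𝓘(ℝ, (X m × X n) × (X m →L[ℝ] X n)) ∞ (j1 φ) :=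
  contMDiff_slice (Y := fun _ => j1 φ) (contMDiff_j1_family (φ := fun _ => φ)
    (φ.smooth.comp contMDiff_snd)) 0

/-- The density, with respect to `vol`, of the Poincaré–Cartan form along a family of jets over `M`. -/
def jetDensity (vol : DForm (X m) M m) (L : J1 B → ℝ) (J : M → J1 B) (x : M) : ℝ :=
  (extLegendre vol L (J x)).snd.1 (fun i => velL (fun x => (J x).proj) x (stdB i))
    / volAt vol x (fun i => stdB i)

/-- Dividing `extLegendre_section` by the value of $\omega$ leaves no trace of $g$, so the density
has the coordinate form $£+\frac{\partial£}{\partial v}(A-v)$ in every adapted chart. -/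
theorem jetDensity_eq (hvol : IsVolumeForm vol)
    (hL : ContMDiff 𝓘(ℝ, (X m × X n) × (X m →L[ℝ] X n)) 𝓘(ℝ, ℝ) ∞ L) {J : M → J1 B}
    {x : M} (hJ : MDifferentiableAt 𝓘(ℝ, X m) 𝓘(ℝ, X m × X n) (fun x => (J x).proj) x)
    (hs : ∀ x, B.proj (J x).proj = x) (h : (J x).proj ∈ a.e.source) :
    jetDensity vol L J x = locL L a (a.jetCoord (J x)) + locMom L a (a.jetCoord (J x))
      (a.vertCoord (J x).proj (velL (fun x => (J x).proj) x) - (a.jetCoord (J x)).2) := by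
  have h1 := extLegendre_section (vol := vol) hL h (T := velL (fun x => (J x).proj) x)
    (fun v => tprojL_velL hJ hs v)
  have h2 : volAt vol (B.proj (J x).proj) (fun i => stdB i) = volAt vol x (fun i => stdB i) := by
    rw [hs]
  have h3 : volAt vol x (fun i => stdB i) ≠ 0 :=
    alternating_std_ne_zero (α := volAt vol x) (hvol.ne_zero x)
  rw [h2] at h1
  rw [jetDensity, div_eq_iff h3]
  exact h1

/-- The defining relation of the extended Legendre map moves the evaluation from $J^1\pi$ to $E$,
and $\pi^1\circ j^1\phi=\phi$ turns the projected tangent vectors into those of $\phi$. -/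
theorem formDensity_poincareCartan (φ : SmoothSection m (X m × X n) B.proj) :
    formDensity vol (pullback (j1 φ) (poincareCartan vol L)) = jetDensity vol L (j1 φ) := by
  funext x
  have h1 := HasMFDerivAt.comp x
    (((jetCoords B).contMDiff_proj (j1 φ x)).mdifferentiableAt (by simp)).hasMFDerivAt
    ((contMDiff_j1 φ x).mdifferentiableAt (by simp)).hasMFDerivAt
  have h2 := h1.mfderiv
  refine congrArg (· / volAt vol x (fun i => stdB i)) ?_
  refine (extLegendre_apply vol L (j1 φ x) _).symm.trans ?_
  refine congrArg (extLegendre vol L (j1 φ x)).snd.1 (funext fun i => ?_)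
  exact (congrArg (fun L => L (stdB i)) h2).symm

theorem legendre_symm (H : IsHyperRegular vol L) (q : RestMom B) :
    legendre vol L (H.choose.symm q) = q :=
  (congrFun H.choose_spec (H.choose.symm q)).symm.trans (H.choose.apply_symm_apply q)

theorem symm_legendre (H : IsHyperRegular vol L) (j : J1 B) :
    H.choose.symm (legendre vol L j) = j :=
  (congrArg H.choose.symm (congrFun H.choose_spec j).symm).trans (H.choose.symm_apply_apply j)

theorem proj_hamiltonian (H : IsHyperRegular vol L) (q : RestMom B) :
    (H.choose.symm q).proj = q.proj :=
  congrArg Bundle.TotalSpace.proj (legendre_symm H q)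

/-- The tautological form at $h(\psi(x))$ is that covector itself, namely
$\widetilde{FL}(FL^{-1}\psi(x))$, evaluated on vectors projected to $E$. Thus the Hamiltonian action
is the Lagrangian density along a section of $J^1\pi$ that need not be holonomic. -/
theorem formDensity_hamiltonCartan (hvol : IsVolumeForm vol)
    (hL : ContMDiff 𝓘(ℝ, (X m × X n) × (X m →L[ℝ] X n)) 𝓘(ℝ, ℝ) ∞ L) (H : IsHyperRegular vol L)
    {ψ : M → RestMom B} (hψ : ContMDiff 𝓘(ℝ, X m)
      𝓘(ℝ, (X m × X n) × (Fin m → (X n →L[ℝ] ℝ))) ∞ ψ) :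
    formDensity vol (pullback ψ (hamiltonCartan (hamiltonianSection H)))
      = jetDensity vol L (fun x => H.choose.symm (ψ x)) := by
  funext x
  have hh : ContMDiff 𝓘(ℝ, (X m × X n) × (Fin m → (X n →L[ℝ] ℝ)))
      𝓘(ℝ, (X m × X n) × ((Fin m → (X n →L[ℝ] ℝ)) × ℝ)) ∞ (hamiltonianSection H) :=
    (contMDiff_extLegendre hvol hL).comp H.choose.symm.contMDiff
  have h0 := HasMFDerivAt.comp x ((hh (ψ x)).mdifferentiableAt (by simp)).hasMFDerivAt
    ((hψ x).mdifferentiableAt (by simp)).hasMFDerivAt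
  have h1 := HasMFDerivAt.comp x
    (((extMomCoords B).contMDiff_proj (hamiltonianSection H (ψ x))).mdifferentiableAt
      (by simp)).hasMFDerivAt h0
  have h2 := h1.mfderiv
  refine congrArg (· / volAt vol x (fun i => stdB i)) ?_
  refine congrArg (extLegendre vol L (H.choose.symm (ψ x))).snd.1 (funext fun i => ?_)
  exact (congrArg (fun L => L (stdB i)) h2).symm

end Density


/-! ### Differentiation under the integral sign. -/

section Time

variable {m : ℕ} {M : Type*}
  [TopologicalSpace M] [ChartedSpace (X m) M] [IsManifold 𝓘(ℝ, X m) ∞ M]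

theorem hasDerivAt_slice {V W : Type*} [NormedAddCommGroup V] [NormedSpace ℝ V]
    [NormedAddCommGroup W] [NormedSpace ℝ W] {f : ℝ × V → W} {t : ℝ} {u : V}
    (hf : DifferentiableAt ℝ f (t, u)) :
    HasDerivAt (fun s => f (s, u)) (fderiv ℝ f (t, u) (1, 0)) t :=
  hf.hasFDerivAt.comp_hasDerivAt t ((hasDerivAt_id t).prodMk (hasDerivAt_const t u))

theorem contDiffAt_chart {f : ℝ → M → ℝ}
    (hf : ContMDiff (𝓘(ℝ, ℝ).prod 𝓘(ℝ, X m)) 𝓘(ℝ, ℝ) ∞ (fun z : ℝ × M => f z.1 z.2))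
    (x₀ : M) {t : ℝ} {x : M} (hx : x ∈ (chartAt (X m) x₀).source) :
    ContDiffAt ℝ ∞ (fun z : ℝ × X m => f z.1 ((chartAt (X m) x₀).symm z.2))
      (t, chartAt (X m) x₀ x) :=
  (ContMDiffAt.comp (t, chartAt (X m) x₀ x) (hf _) (contMDiffAt_prod_symm contMDiffOn_chart_symm
    ((chartAt (X m) x₀).map_source hx))).contDiffAt

theorem hasDerivAt_time_chart {f : ℝ → M → ℝ}
    (hf : ContMDiff (𝓘(ℝ, ℝ).prod 𝓘(ℝ, X m)) 𝓘(ℝ, ℝ) ∞ (fun z : ℝ × M => f z.1 z.2))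
    (x₀ : M) (t : ℝ) {x : M} (hx : x ∈ (chartAt (X m) x₀).source) :
    HasDerivAt (fun s => f s x) (fderiv ℝ
      (fun z : ℝ × X m => f z.1 ((chartAt (X m) x₀).symm z.2)) (t, chartAt (X m) x₀ x) (1, 0)) t := by
  have h := hasDerivAt_slice ((contDiffAt_chart hf x₀ (t := t) hx).differentiableAt (by simp))
  simpa only [(chartAt (X m) x₀).left_inv hx] using h

theorem differentiableAt_time {f : ℝ → M → ℝ}
    (hf : ContMDiff (𝓘(ℝ, ℝ).prod 𝓘(ℝ, X m)) 𝓘(ℝ, ℝ) ∞ (fun z : ℝ × M => f z.1 z.2))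
    (t : ℝ) (x : M) : DifferentiableAt ℝ (fun s => f s x) t :=
  (hasDerivAt_time_chart hf x t (mem_chart_source _ x)).differentiableAt

/-- Joint continuity in time and point is what yields one bound on $[-1,1]\times K$ for dominated
differentiation. -/
theorem continuous_deriv_time {f : ℝ → M → ℝ}
    (hf : ContMDiff (𝓘(ℝ, ℝ).prod 𝓘(ℝ, X m)) 𝓘(ℝ, ℝ) ∞ (fun z : ℝ × M => f z.1 z.2)) :
    Continuous (fun z : ℝ × M => deriv (fun s => f s z.2) z.1) := by
  rw [continuous_iff_continuousAt]
  rintro ⟨t, x⟩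
  have h1 : ContinuousAt (fderiv ℝ (fun z : ℝ × X m => f z.1 ((chartAt (X m) x).symm z.2)))
      (t, chartAt (X m) x x) :=
    ((contDiffAt_chart hf x (mem_chart_source _ x)).fderiv_right (m := ∞) (by simp)).continuousAt
  have h2 : ContinuousAt (fun z : ℝ × M => (z.1, chartAt (X m) x z.2)) (t, x) :=
    continuousAt_fst.prodMk (ContinuousAt.comp (f := Prod.snd) (x := (t, x))
      ((chartAt (X m) x).continuousAt (mem_chart_source _ x)) continuousAt_snd)
  have h3 := ContinuousAt.comp (f := fun z : ℝ × M => (z.1, chartAt (X m) x z.2)) (x := (t, x)) h1 h2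
  refine (h3.clm_apply (continuousAt_const (y := ((1, 0) : ℝ × X m)))).congr ?_
  have h4 : ∀ᶠ z : ℝ × M in 𝓝 (t, x), z.2 ∈ (chartAt (X m) x).source :=
    continuousAt_snd.preimage_mem_nhds (chart_source_mem_nhds (X m) x)
  filter_upwards [h4] with z hz
  exact (hasDerivAt_time_chart hf x z.1 hz).deriv.symm

open MeasureTheory in
/-- Differentiation under the integral sign for functions which do not depend on the parameter off a
compact set. -/
theorem hasDerivAt_integral_of_compact [T2Space M] [MeasurableSpace M] [BorelSpace M]
    [SecondCountableTopology M] {μ : Measure M} [IsLocallyFiniteMeasure μ] {f : ℝ → M → ℝ}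
    (hf : ContMDiff (𝓘(ℝ, ℝ).prod 𝓘(ℝ, X m)) 𝓘(ℝ, ℝ) ∞ (fun z : ℝ × M => f z.1 z.2))
    {K : Set M} (hK : IsCompact K) (hfK : ∀ x ∉ K, ∀ t, f t x = f 0 x) (h0 : Integrable (f 0) μ) :
    HasDerivAt (fun t => ∫ x, f t x ∂μ) (∫ x, deriv (fun t => f t x) 0 ∂μ) 0 := by
  have hc := continuous_deriv_time hf
  obtain ⟨C, hC⟩ := ((isCompact_Icc (a := (-1 : ℝ)) (b := 1)).prod hK).exists_bound_of_continuousOn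
    hc.continuousOn
  have hz : ∀ x ∉ K, ∀ t, deriv (fun s => f s x) t = 0 := fun x hx t => by
    have : (fun s => f s x) = fun _ => f 0 x := funext fun s => hfK x hx s
    rw [this, deriv_const]
  refine (hasDerivAt_integral_of_dominated_loc_of_deriv_le (s := Set.Icc (-1 : ℝ) 1)
    (bound := K.indicator fun _ => C) (F := f) (F' := fun t x => deriv (fun s => f s x) t)
    (Icc_mem_nhds (by norm_num) (by norm_num)) (Filter.Eventually.of_forall fun t => ?_) h0 ?_
    (Filter.Eventually.of_forall fun x t ht => ?_) ?_
    (Filter.Eventually.of_forall fun x t _ => ?_)).2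
  · exact (hf.continuous.comp (Continuous.prodMk_right t)).aestronglyMeasurable
  · exact (hc.comp (Continuous.prodMk_right 0)).aestronglyMeasurable
  · by_cases hx : x ∈ K
    · rw [Set.indicator_of_mem hx]
      exact hC (t, x) ⟨ht, hx⟩
    · rw [Set.indicator_of_notMem hx, hz x hx, norm_zero]
  · exact (integrable_indicator_iff hK.measurableSet).2
      (integrableOn_const hK.measure_lt_top.ne)
  · exact (differentiableAt_time hf t x).hasDerivAt

end Time

/-! ### Families of jets and the first variation formula. -/

section Family

variable {m n : ℕ} {M E F : Type*}
  [TopologicalSpace M] [ChartedSpace (X m) M] [IsManifold 𝓘(ℝ, X m) ∞ M]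
  [TopologicalSpace E] [ChartedSpace (X m × X n) E] [IsManifold 𝓘(ℝ, X m × X n) ∞ E]
  [TopologicalSpace F] [ChartedSpace (X n) F] [IsManifold 𝓘(ℝ, X n) ∞ F]
  {B : ConfigBundle m n M E F} {L : J1 B → ℝ} {a : AdaptedChart B} {vol : DForm (X m) M m}

/-- A smooth one-parameter family of sections of `J¹π → M` which is constant off `K`. -/
structure IsJetFamily (J : ℝ → M → J1 B) (K : Set M) : Prop where
  smooth : ContMDiff (𝓘(ℝ, ℝ).prod 𝓘(ℝ, X m)) 𝓘(ℝ, (X m × X n) × (X m →L[ℝ] X n)) ∞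
    (fun z : ℝ × M => J z.1 z.2)
  proj : ∀ t x, B.proj (J t x).proj = x
  compact : IsCompact K
  const : ∀ x ∉ K, ∀ t, J t x = J 0 x

namespace IsJetFamily

variable {J : ℝ → M → J1 B} {K : Set M}

theorem smooth_base (hJ : IsJetFamily J K) :
    ContMDiff (𝓘(ℝ, ℝ).prod 𝓘(ℝ, X m)) 𝓘(ℝ, X m × X n) ∞ (fun z : ℝ × M => (J z.1 z.2).proj) :=
  (jetCoords B).contMDiff_proj.comp hJ.smooth

/-- The underlying family of sections of `π`. -/
def toSection (hJ : IsJetFamily J K) (t : ℝ) : SmoothSection m (X m × X n) B.proj where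
  toFun x := (J t x).proj
  smooth := contMDiff_slice (Y := fun t x => (J t x).proj) hJ.smooth_base t
  proj_toFun := hJ.proj t

end IsJetFamily

/-- A family of jets in adapted coordinates. -/
def locJ (a : AdaptedChart B) (J : ℝ → M → J1 B) (z : ℝ × X m) : (X m × X n) × (X m →L[ℝ] X n) :=
  a.jetCoord (J z.1 (a.c.symm z.2))

/-- The density of the Poincaré–Cartan form along a family of jets, in adapted coordinates. -/
def locDensity (L : J1 B → ℝ) (a : AdaptedChart B) (J : ℝ → M → J1 B) (z : ℝ × X m) : ℝ :=
  locL L a (locJ a J z)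
    + locMom L a (locJ a J z) (locA a (fun t x => (J t x).proj) z - (locJ a J z).2)

variable {J : ℝ → M → J1 B} {K : Set M} {t : ℝ} {x : M}

theorem IsJetFamily.mem_source (hJ : IsJetFamily J K) (h : (J t x).proj ∈ a.e.source) :
    x ∈ a.c.source := by
  have := a.mapsTo _ h; rwa [hJ.proj] at this

theorem contDiffAt_locJ (hJ : IsJetFamily J K) (h : (J t x).proj ∈ a.e.source) :
    ContDiffAt ℝ ∞ (locJ a J) (t, a.c x) := by
  have hx := hJ.mem_source h
  have hx' : a.c.symm (a.c x) = x := a.c.left_inv hx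
  have h1 := contMDiffAt_prod_symm a.c_symm_smooth (t := t) (a.c.map_source hx)
  have h2 : ContMDiffAt 𝓘(ℝ, ℝ × X m) 𝓘(ℝ, (X m × X n) × (X m →L[ℝ] X n)) ∞
      (fun z : ℝ × X m => J z.1 (a.c.symm z.2)) (t, a.c x) :=
    ContMDiffAt.comp (t, a.c x) (hJ.smooth _) h1
  refine (FibreCoords.contMDiffAt_coords (C := jetCoords B) (a := a) ?_ h2).contDiffAt
  change (J t (a.c.symm (a.c x))).proj ∈ a.e.source
  rwa [hx']

theorem locJ_eq (hJ : IsJetFamily J K) (h : (J t x).proj ∈ a.e.source) :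
    locJ a J (t, a.c x) = a.jetCoord (J t x) := by
  rw [locJ, a.c.left_inv (hJ.mem_source h)]

theorem contDiffAt_locL_locJ (hL : ContMDiff 𝓘(ℝ, (X m × X n) × (X m →L[ℝ] X n)) 𝓘(ℝ, ℝ) ∞ L)
    (hJ : IsJetFamily J K) (h : (J t x).proj ∈ a.e.source) :
    ContDiffAt ℝ ∞ (locL L a) (locJ a J (t, a.c x)) := by
  rw [locJ_eq hJ h]
  exact contDiffAt_locL hL (a.e.map_source h)

theorem contDiffAt_locMom_locJ (hL : ContMDiff 𝓘(ℝ, (X m × X n) × (X m →L[ℝ] X n)) 𝓘(ℝ, ℝ) ∞ L)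
    (hJ : IsJetFamily J K) (h : (J t x).proj ∈ a.e.source) :
    ContDiffAt ℝ ∞ (locMom L a) (locJ a J (t, a.c x)) := by
  rw [locJ_eq hJ h]
  exact contDiffAt_locMom hL (a.e.map_source h)

theorem contDiffAt_locDensity (hL : ContMDiff 𝓘(ℝ, (X m × X n) × (X m →L[ℝ] X n)) 𝓘(ℝ, ℝ) ∞ L)
    (hJ : IsJetFamily J K) (h : (J t x).proj ∈ a.e.source) :
    ContDiffAt ℝ ∞ (locDensity L a J) (t, a.c x) := by
  have h1 := contDiffAt_locJ hJ h
  have h2 := contDiffAt_locA (a := a) (Y := fun t x => (J t x).proj) hJ.smooth_base (hJ.proj t x) h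
  exact ((contDiffAt_locL_locJ hL hJ h).comp _ h1).add
    (((contDiffAt_locMom_locJ hL hJ h).comp _ h1).clm_apply (h2.sub (contDiffAt_snd.comp _ h1)))

theorem jetDensity_family (hvol : IsVolumeForm vol)
    (hL : ContMDiff 𝓘(ℝ, (X m × X n) × (X m →L[ℝ] X n)) 𝓘(ℝ, ℝ) ∞ L)
    (hJ : IsJetFamily J K) (h : (J t x).proj ∈ a.e.source) :
    jetDensity vol L (J t) x = locDensity L a J (t, a.c x) := by
  rw [jetDensity_eq hvol hL (((hJ.toSection t).smooth x).mdifferentiableAt (by simp)) (hJ.proj t) h,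
    locDensity, locJ_eq hJ h,
    ← vertCoord_family (Y := fun t x => (J t x).proj) hJ.smooth_base (hJ.proj t x) h]

theorem contMDiff_jetDensity (hvol : IsVolumeForm vol)
    (hL : ContMDiff 𝓘(ℝ, (X m × X n) × (X m →L[ℝ] X n)) 𝓘(ℝ, ℝ) ∞ L)
    (hJ : IsJetFamily J K) :
    ContMDiff (𝓘(ℝ, ℝ).prod 𝓘(ℝ, X m)) 𝓘(ℝ, ℝ) ∞ (fun z : ℝ × M => jetDensity vol L (J z.1) z.2) := by
  rintro ⟨t, x⟩
  obtain ⟨a, ha⟩ := B.exists_adaptedChart (J t x).proj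
  have h1 := ContMDiffAt.comp (t, x) (contDiffAt_locDensity hL hJ ha).contMDiffAt
    (contMDiffAt_prod_chart a (t := t) (hJ.mem_source ha))
  refine h1.congr_of_eventuallyEq ?_
  filter_upwards [hJ.smooth_base.continuous.continuousAt.preimage_mem_nhds
    (a.e.open_source.mem_nhds ha)] with z hz
  exact jetDensity_family hvol hL hJ hz

theorem jetDensity_congr {J J' : M → J1 B} {x : M} (h : J =ᶠ[𝓝 x] J') :
    jetDensity vol L J x = jetDensity vol L J' x := by
  have h1 : (fun x : M => (J x).proj) =ᶠ[𝓝 x] fun x => (J' x).proj := by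
    filter_upwards [h] with z hz using congrArg _ hz
  have h2 : (velL (fun x => (J x).proj) x : X m →L[ℝ] (X m × X n)) = velL (fun x => (J' x).proj) x := h1.mfderiv_eq
  rw [jetDensity, jetDensity, h2, h.eq_of_nhds]

/-- The density involves a derivative of the underlying section, so constancy is needed on a
neighbourhood; the complement of $K$ is open because $M$ is Hausdorff. -/
theorem IsJetFamily.jetDensity_const [T2Space M] (hJ : IsJetFamily J K) (x : M) (hx : x ∉ K)
    (t : ℝ) : jetDensity vol L (J t) x = jetDensity vol L (J 0) x := by
  refine jetDensity_congr ?_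
  filter_upwards [hJ.compact.isClosed.isOpen_compl.mem_nhds hx] with z hz
  exact hJ.const z hz t

/-- The first variation of the density. -/
def firstVar (vol : DForm (X m) M m) (L : J1 B → ℝ) (J : ℝ → M → J1 B) (x : M) : ℝ :=
  deriv (fun t => jetDensity vol L (J t) x) 0

/-- The fibre coordinates of the vector field `∂J/∂t` along the underlying section. -/
def varCoord (a : AdaptedChart B) (J : ℝ → M → J1 B) (x : M) : X n :=
  deriv (fun t => (a.e (J t x).proj).2) 0

/-- The linearised Lagrangian at the jet `j`, in adapted coordinates. -/
def linL (L : J1 B → ℝ) (a : AdaptedChart B) (j : J1 B) (η : M → X n) (x : M) : ℝ :=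
  fderiv ℝ (locL L a) (a.jetCoord j) ((0, η x), fderiv ℝ (fun u => η (a.c.symm u)) (a.c x))

theorem varCoord_eq (hJ : IsJetFamily J K) (h : (J 0 x).proj ∈ a.e.source) :
    HasDerivAt (fun t => (a.e (J t x).proj).2)
        (fderiv ℝ (locY a (fun t x => (J t x).proj)) (0, a.c x) (1, 0)) 0 ∧
      varCoord a J x = fderiv ℝ (locY a (fun t x => (J t x).proj)) (0, a.c x) (1, 0) := by
  have h1 := hasDerivAt_slice ((contDiffAt_locY (a := a) (Y := fun t x => (J t x).proj)
    hJ.smooth_base (hJ.proj 0 x) h).differentiableAt (by simp))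
  have h2 : HasDerivAt (fun t => (a.e (J t x).proj).2)
        (fderiv ℝ (locY a (fun t x => (J t x).proj)) (0, a.c x) (1, 0)) 0 := by
    simpa only [locY, a.c.left_inv (hJ.mem_source h)] using h1
  exact ⟨h2, h2.deriv⟩

theorem eventually_mem_source (hJ : IsJetFamily J K) (h : (J t x).proj ∈ a.e.source) :
    ∀ᶠ u in 𝓝 (a.c x), (J t (a.c.symm u)).proj ∈ a.e.source ∧ a.c (a.c.symm u) = u := by
  have hx := hJ.mem_source h
  have h1 : ContinuousAt (fun u => (J t (a.c.symm u)).proj) (a.c x) := by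
    refine ContinuousAt.comp (g := fun x => (J t x).proj) ?_
      (a.c.continuousAt_symm (a.c.map_source hx))
    exact (hJ.toSection t).smooth.continuous.continuousAt
  have h2 : (J t (a.c.symm (a.c x))).proj ∈ a.e.source := by rwa [a.c.left_inv hx]
  filter_upwards [h1.preimage_mem_nhds (a.e.open_source.mem_nhds h2),
    a.c.open_target.mem_nhds (a.c.map_source hx)] with u hu hu'
  exact ⟨hu, a.c.right_inv hu'⟩

theorem varCoord_symm (hJ : IsJetFamily J K) (h : (J 0 x).proj ∈ a.e.source) :
    (fun u => varCoord a J (a.c.symm u)) =ᶠ[𝓝 (a.c x)]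
      fun u => fderiv ℝ (locY a (fun t x => (J t x).proj)) (0, u) (1, 0) := by
  filter_upwards [eventually_mem_source hJ h] with u hu
  rw [(varCoord_eq hJ hu.1).2, hu.2]

theorem contDiffAt_varCoord (hJ : IsJetFamily J K) (h : (J 0 x).proj ∈ a.e.source) :
    ContDiffAt ℝ ∞ (fun u => varCoord a J (a.c.symm u)) (a.c x) := by
  have h1 := (contDiffAt_locY (a := a) (Y := fun t x => (J t x).proj)
    hJ.smooth_base (hJ.proj 0 x) h).fderiv_right (m := ∞) (by simp)
  have h2 : ContDiffAt ℝ ∞ (fun u : X m => ((0 : ℝ), u)) (a.c x) :=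
    contDiffAt_const.prodMk contDiffAt_id
  exact ((ContDiffAt.comp (a.c x) h1 h2).clm_apply contDiffAt_const).congr_of_eventuallyEq
    (varCoord_symm hJ h)

/-- The first variation formula. -/
theorem firstVar_eq (hvol : IsVolumeForm vol)
    (hL : ContMDiff 𝓘(ℝ, (X m × X n) × (X m →L[ℝ] X n)) 𝓘(ℝ, ℝ) ∞ L)
    (hJ : IsJetFamily J K) (h : (J 0 x).proj ∈ a.e.source) :
    firstVar vol L J x = linL L a (J 0 x) (varCoord a J) x
      + deriv (fun t => locMom L a (a.jetCoord (J t x))) 0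
        (a.vertCoord (J 0 x).proj (velL (fun x => (J 0 x).proj) x) - (a.jetCoord (J 0 x)).2) := by
  set Y : ℝ → M → E := fun t x => (J t x).proj with hY
  set u := a.c x with hu
  have hx := hJ.mem_source h
  have hev : ∀ᶠ t in 𝓝 (0 : ℝ), (J t x).proj ∈ a.e.source := by
    have : Continuous fun t => (J t x).proj :=
      hJ.smooth_base.continuous.comp (Continuous.prodMk_left x)
    exact this.continuousAt.preimage_mem_nhds (a.e.open_source.mem_nhds h)
  have hG := hasDerivAt_slice ((contDiffAt_locJ hJ h).differentiableAt (by simp))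
  set G' := fderiv ℝ (locJ a J) (0, u) (1, 0) with hG'
  have hA := hasDerivAt_slice ((contDiffAt_locA (a := a) (Y := fun t x => (J t x).proj) hJ.smooth_base (hJ.proj 0 x)
    h).differentiableAt (by simp))
  set A' := fderiv ℝ (locA a Y) (0, u) (1, 0) with hA'
  have hl := ((contDiffAt_locL_locJ hL hJ h).differentiableAt
    (by simp)).hasFDerivAt.comp_hasDerivAt (0 : ℝ) hG
  have hp := ((contDiffAt_locMom_locJ hL hJ h).differentiableAt
    (by simp)).hasFDerivAt.comp_hasDerivAt (0 : ℝ) hG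
  set p' := (fderiv ℝ (locMom L a) (locJ a J (0, u))) G' with hp'
  have hd : HasDerivAt (fun t => locDensity L a J (t, u))
      (fderiv ℝ (locL L a) (locJ a J (0, u)) G'
        + (p' (locA a Y (0, u) - (locJ a J (0, u)).2)
          + locMom L a (locJ a J (0, u)) (A' - G'.2))) 0 :=
    hl.add (hp.clm_apply (hA.sub hG.snd))
  have hfv : firstVar vol L J x = deriv (fun t => locDensity L a J (t, u)) 0 := by
    refine Filter.EventuallyEq.deriv_eq ?_
    filter_upwards [hev] with t ht using jetDensity_family hvol hL hJ ht
  have hp2 : deriv (fun t => locMom L a (a.jetCoord (J t x))) 0 = p' := by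
    refine (Filter.EventuallyEq.deriv_eq ?_).trans hp.deriv
    filter_upwards [hev] with t ht
    rw [Function.comp_apply, locJ_eq hJ ht]
  -- Every member of the family lies over the same point of $M$, so the velocity has no component
  -- along the base.
  have hG1 : G'.1 = (0, varCoord a J x) := by
    have e1 : HasDerivAt (fun t => (a.e (J t x).proj)) G'.1 0 := by
      have e0 : HasDerivAt (fun t => (locJ a J (t, u)).1) G'.1 0 :=
        (ContinuousLinearMap.fst ℝ (X m × X n) (X m →L[ℝ] X n)).hasFDerivAt.comp_hasDerivAt
          (0 : ℝ) hG
      refine e0.congr_of_eventuallyEq ?_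
      filter_upwards [hev] with t ht
      rw [locJ_eq hJ ht]; rfl
    have e3 : HasDerivAt (fun t => (a.e (J t x).proj).2) G'.1.2 0 :=
      (ContinuousLinearMap.snd ℝ (X m) (X n)).hasFDerivAt.comp_hasDerivAt (0 : ℝ) e1
    have e4 : HasDerivAt (fun t => (a.e (J t x).proj).1) G'.1.1 0 :=
      (ContinuousLinearMap.fst ℝ (X m) (X n)).hasFDerivAt.comp_hasDerivAt (0 : ℝ) e1
    refine Prod.ext ?_ e3.deriv.symm
    have e2 : HasDerivAt (fun t => (a.e (J t x).proj).1) (0 : X m) 0 := by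
      refine (hasDerivAt_const (0 : ℝ) (a.c x)).congr_of_eventuallyEq ?_
      filter_upwards [hev] with t ht
      rw [a.fst_e _ ht, hJ.proj]
    exact e4.unique e2
  have hYsm := contDiffAt_locY (a := a) (Y := Y) hJ.smooth_base (hJ.proj 0 x) h
  -- Mixed partial derivatives commute: the time derivative of $A$ is the derivative of $\eta$ along
  -- the base.
  have hA2 : A' = fderiv ℝ (fun u => varCoord a J (a.c.symm u)) u := by
    have hF : HasFDerivAt (fderiv ℝ (locY a Y)) (fderiv ℝ (fderiv ℝ (locY a Y)) (0, u)) (0, u) :=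
      ((hYsm.fderiv_right (m := ∞) (by simp)).differentiableAt (by simp)).hasFDerivAt
    have e1 : HasFDerivAt (fun u => fderiv ℝ (locY a Y) (0, u) (1, 0))
        (((fderiv ℝ (fderiv ℝ (locY a Y)) (0, u)).flip (1, 0)).comp
          (ContinuousLinearMap.inr ℝ ℝ (X m))) u := by
      have e0 := HasFDerivAt.comp u hF (hasFDerivAt_prodMk_right (0 : ℝ) u)
      have := e0.clm_apply (hasFDerivAt_const ((1, 0) : ℝ × X m) u)
      refine this.congr_fderiv ?_
      ext v
      simp
    rw [(varCoord_symm hJ h).fderiv_eq, e1.fderiv]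
    have e2 : HasFDerivAt (locA a Y) _ (0, u) :=
      hF.clm_comp (hasFDerivAt_const (ContinuousLinearMap.inr ℝ ℝ (X m)) ((0 : ℝ), u))
    rw [hA', e2.fderiv]
    refine ContinuousLinearMap.ext fun v => ?_
    have e3 := (hYsm.isSymmSndFDerivAt (n := ∞) (by
      simpa using WithTop.coe_le_coe.2 (le_top : (2 : ℕ∞) ≤ ⊤))) (1, 0) (0, v)
    simpa using e3
  have hAv : a.vertCoord (J 0 x).proj (velL (fun x => (J 0 x).proj) x) = locA a Y (0, u) :=
    vertCoord_family (Y := Y) hJ.smooth_base (hJ.proj 0 x) h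
  have hj : locJ a J (0, u) = a.jetCoord (J 0 x) := locJ_eq hJ h
  -- The velocity of the jet is the prolongation of $\eta$ minus the vertical vector $A'-v'$. The
  -- derivative of $£$ along the latter cancels the term $\frac{\partial£}{\partial v}(A'-v')$ of
  -- the product rule.
  have hsplit : G' = ((0, varCoord a J x), A') + (0, -(A' - G'.2)) := by
    refine Prod.ext ?_ ?_
    · rw [hG1]; simp
    · simp
  have h0 : ((0 : X m × X n), -(A' - G'.2)) = -((0 : X m × X n), A' - G'.2) := by simp
  have h1 : fderiv ℝ (locL L a) (a.jetCoord (J 0 x)) G' = fderiv ℝ (locL L a)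
      (a.jetCoord (J 0 x)) ((0, varCoord a J x), A')
        - fderiv ℝ (locL L a) (a.jetCoord (J 0 x)) (0, A' - G'.2) := by
    rw [← map_sub, sub_eq_add_neg, ← h0, ← hsplit]
  rw [hfv, hd.deriv, hp2, hAv, linL, ← hA2, hj, locMom_apply, h1]
  ring

end Family


/-! ### Variations of a holonomic section and local criticality. -/

section Critical

variable {m n : ℕ} {M E F : Type*}
  [TopologicalSpace M] [ChartedSpace (X m) M] [IsManifold 𝓘(ℝ, X m) ∞ M]
  [TopologicalSpace E] [ChartedSpace (X m × X n) E] [IsManifold 𝓘(ℝ, X m × X n) ∞ E]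
  [TopologicalSpace F] [ChartedSpace (X n) F] [IsManifold 𝓘(ℝ, X n) ∞ F]
  {B : ConfigBundle m n M E F} {L : J1 B → ℝ} {a : AdaptedChart B} {vol : DForm (X m) M m}
  {J : ℝ → M → J1 B} {K : Set M} {t : ℝ} {x : M} {φ : SmoothSection m (X m × X n) B.proj}

theorem linL_congr {j : J1 B} {η η' : M → X n} (hx : x ∈ a.c.source) (h : η =ᶠ[𝓝 x] η') :
    linL L a j η x = linL L a j η' x := by
  have h1 : (fun u => η (a.c.symm u)) =ᶠ[𝓝 (a.c x)] fun u => η' (a.c.symm u) := by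
    have h2 := a.c.continuousAt_symm (a.c.map_source hx)
    rw [ContinuousAt, a.c.left_inv hx] at h2
    exact h2.eventually h
  rw [linL, linL, h.eq_of_nhds, h1.fderiv_eq]

theorem linL_zero {j : J1 B} : linL L a j (fun _ => 0) x = 0 := by
  rw [linL, fderiv_const_apply]
  exact map_zero _

theorem linL_sum {j : J1 B} {ι : Type*} (s : Finset ι) {η : ι → M → X n}
    (hη : ∀ i ∈ s, DifferentiableAt ℝ (fun u => η i (a.c.symm u)) (a.c x)) :
    linL L a j (fun x => ∑ i ∈ s, η i x) x = ∑ i ∈ s, linL L a j (η i) x := by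
  have h1 : fderiv ℝ (fun u => ∑ i ∈ s, η i (a.c.symm u)) (a.c x)
      = ∑ i ∈ s, fderiv ℝ (fun u => η i (a.c.symm u)) (a.c x) := fderiv_fun_sum hη
  simp only [linL]
  rw [h1, ← map_sum]
  congr 1
  refine Prod.ext (Prod.ext ?_ ?_) ?_
  · simp [Prod.fst_sum]
  · simp [Prod.fst_sum, Prod.snd_sum]
  · simp [Prod.snd_sum]

/-- At a holonomic jet $A-v=0$, so the variation of the momenta drops out. Nothing is asked of the
jets at $t\ne 0$; this is why Lagrangian and Hamiltonian variations can be compared. -/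
theorem firstVar_holonomic (hvol : IsVolumeForm vol)
    (hL : ContMDiff 𝓘(ℝ, (X m × X n) × (X m →L[ℝ] X n)) 𝓘(ℝ, ℝ) ∞ L)
    (hJ : IsJetFamily J K) (h0 : J 0 = j1 φ) (h : φ.toFun x ∈ a.e.source) :
    firstVar vol L J x = linL L a (j1 φ x) (varCoord a J) x := by
  have h1 := firstVar_eq (a := a) (x := x) hvol hL hJ (by rw [h0]; exact h)
  rw [h0] at h1
  have h2 : a.vertCoord (j1 φ x).proj (velL (fun x => (j1 φ x).proj) x) - (a.jetCoord (j1 φ x)).2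
      = 0 := sub_self _
  rw [h2, map_zero, add_zero] at h1
  exact h1

theorem jet_ext {j j' : J1 B} (h : j.proj = j'.proj)
    (h' : (j.snd.1 : X m →L[ℝ] (X m × X n)) = j'.snd.1) : j = j' := by
  obtain ⟨y, γ⟩ := j
  obtain ⟨y', γ'⟩ := j'
  dsimp at h
  subst h
  exact congrArg (Bundle.TotalSpace.mk y) (Subtype.ext h')

theorem j1_congr {φ φ' : SmoothSection m (X m × X n) B.proj} (h : φ.toFun =ᶠ[𝓝 x] φ'.toFun) :
    j1 φ x = j1 φ' x :=
  jet_ext h.eq_of_nhds h.mfderiv_eq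

namespace IsJetFamily

theorem firstVar_eq_zero [T2Space M] (hJ : IsJetFamily J K) (hx : x ∉ K) :
    firstVar vol L J x = 0 := by
  have : (fun t => jetDensity vol L (J t) x) = fun _ => jetDensity vol L (J 0) x :=
    funext fun t => hJ.jetDensity_const x hx t
  rw [firstVar, this, deriv_const]

theorem varCoord_eq_zero (hJ : IsJetFamily J K) (hx : x ∉ K) : varCoord a J x = 0 := by
  have : (fun t => (a.e (J t x).proj).2) = fun _ => (a.e (J 0 x).proj).2 :=
    funext fun t => by rw [hJ.const x hx t]
  rw [varCoord, this, deriv_const]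

theorem continuous_firstVar (hvol : IsVolumeForm vol)
    (hL : ContMDiff 𝓘(ℝ, (X m × X n) × (X m →L[ℝ] X n)) 𝓘(ℝ, ℝ) ∞ L)
    (hJ : IsJetFamily J K) : Continuous (firstVar vol L J) :=
  (continuous_deriv_time (contMDiff_jetDensity hvol hL hJ)).comp (Continuous.prodMk_right 0)

theorem hasCompactSupport_firstVar [T2Space M] (hJ : IsJetFamily J K) :
    HasCompactSupport (firstVar vol L J) :=
  HasCompactSupport.intro hJ.compact fun _ hx => hJ.firstVar_eq_zero hx

theorem contMDiff_varCoord [T2Space M] (hJ : IsJetFamily J K)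
    (h : ∀ x ∈ K, (J 0 x).proj ∈ a.e.source) :
    ContMDiff 𝓘(ℝ, X m) 𝓘(ℝ, X n) ∞ (varCoord a J) := by
  intro x
  by_cases hx : x ∈ K
  · have hxs := hJ.mem_source (h x hx)
    have h1 := ContMDiffAt.comp x (contDiffAt_varCoord hJ (h x hx)).contMDiffAt
      (a.c_smooth.contMDiffAt (a.c.open_source.mem_nhds hxs))
    refine h1.congr_of_eventuallyEq ?_
    filter_upwards [a.c.open_source.mem_nhds hxs] with z hz
    rw [Function.comp_apply, a.c.left_inv hz]
  · refine (contMDiffAt_const (c := (0 : X n))).congr_of_eventuallyEq ?_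
    filter_upwards [hJ.compact.isClosed.isOpen_compl.mem_nhds hx] with z hz
    exact hJ.varCoord_eq_zero hz

/-- The family of jets of the sections `x ↦ J (ρ x * t) x`. -/
def scale (hJ : IsJetFamily J K) {ρ : M → ℝ} (hρ : ContMDiff 𝓘(ℝ, X m) 𝓘(ℝ, ℝ) ∞ ρ) (t : ℝ) :
    SmoothSection m (X m × X n) B.proj where
  toFun x := (J (ρ x * t) x).proj
  smooth := hJ.smooth_base.comp ((hρ.mul contMDiff_const).prodMk contMDiff_id)
  proj_toFun x := hJ.proj _ x

/-- Where $\rho$ vanishes locally, time stands still; off $K$ the underlying section does not move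
at all. Both hold on open sets, as needed for the jets to be constant there. -/
theorem isJetFamily_scale [T2Space M] (hJ : IsJetFamily J K) {ρ : M → ℝ}
    (hρ : ContMDiff 𝓘(ℝ, X m) 𝓘(ℝ, ℝ) ∞ ρ) :
    IsJetFamily (fun t => j1 (hJ.scale hρ t)) (K ∩ tsupport ρ) where
  smooth := contMDiff_j1_family (φ := hJ.scale hρ) (hJ.smooth_base.comp
    (((hρ.comp contMDiff_snd).mul contMDiff_fst).prodMk contMDiff_snd))
  proj t x := hJ.proj _ x
  compact := hJ.compact.inter_right (isClosed_tsupport ρ)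
  const x hx t := by
    refine j1_congr ?_
    by_cases hxK : x ∈ K
    · have hx' : x ∉ tsupport ρ := fun h => hx ⟨hxK, h⟩
      filter_upwards [(isClosed_tsupport ρ).isOpen_compl.mem_nhds hx'] with z hz
      change (J (ρ z * t) z).proj = (J (ρ z * 0) z).proj
      rw [image_eq_zero_of_notMem_tsupport hz, zero_mul, zero_mul]
    · filter_upwards [hJ.compact.isClosed.isOpen_compl.mem_nhds hxK] with z hz
      change (J (ρ z * t) z).proj = (J (ρ z * 0) z).proj
      rw [hJ.const z hz, hJ.const z hz (ρ z * 0)]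

theorem scale_zero (hJ : IsJetFamily J K) (h0 : J 0 = j1 φ) {ρ : M → ℝ}
    (hρ : ContMDiff 𝓘(ℝ, X m) 𝓘(ℝ, ℝ) ∞ ρ) : j1 (hJ.scale hρ 0) = j1 φ := by
  funext x
  refine j1_congr (Filter.Eventually.of_forall fun z => ?_)
  change (J (ρ z * 0) z).proj = φ.toFun z
  rw [mul_zero, h0]
  rfl

/-- Rescaling time pointwise is the intrinsic way to multiply a variation by a function, since
sections of $\pi$ form no vector space. -/
theorem varCoord_scale (hJ : IsJetFamily J K) {ρ : M → ℝ}
    (hρ : ContMDiff 𝓘(ℝ, X m) 𝓘(ℝ, ℝ) ∞ ρ) (h : (J 0 x).proj ∈ a.e.source) :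
    varCoord a (fun t => j1 (hJ.scale hρ t)) x = ρ x • varCoord a J x := by
  obtain ⟨h1, h2⟩ := varCoord_eq hJ h
  rw [h2]
  have h3 : HasDerivAt (fun t : ℝ => ρ x * t) (ρ x) 0 := by
    simpa using (hasDerivAt_id (0 : ℝ)).const_mul (ρ x)
  have h4 : HasDerivAt (fun t => (a.e (J t x).proj).2)
      (fderiv ℝ (locY a (fun t x => (J t x).proj)) (0, a.c x) (1, 0)) (ρ x * 0) := by
    rw [mul_zero]; exact h1
  exact (HasDerivAt.scomp (0 : ℝ) h4 h3).deriv

end IsJetFamily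

variable [T2Space M] [SecondCountableTopology M] [Nonempty M] [MeasurableSpace M] [BorelSpace M]

open MeasureTheory

theorem integrable_firstVar (hvol : IsVolumeForm vol)
    (hL : ContMDiff 𝓘(ℝ, (X m × X n) × (X m →L[ℝ] X n)) 𝓘(ℝ, ℝ) ∞ L)
    (hJ : IsJetFamily J K) : Integrable (firstVar vol L J) (volMeasure vol) := by
  have := isLocallyFiniteMeasure_volMeasure hvol
  exact (hJ.continuous_firstVar hvol hL).integrable_of_hasCompactSupport
    hJ.hasCompactSupport_firstVar

theorem hasDerivAt_integral_jetDensity (hvol : IsVolumeForm vol)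
    (hL : ContMDiff 𝓘(ℝ, (X m × X n) × (X m →L[ℝ] X n)) 𝓘(ℝ, ℝ) ∞ L)
    (hJ : IsJetFamily J K) (hint : Integrable (jetDensity vol L (J 0)) (volMeasure vol)) :
    HasDerivAt (fun t => ∫ x, jetDensity vol L (J t) x ∂(volMeasure vol))
      (∫ x, firstVar vol L J x ∂(volMeasure vol)) 0 := by
  have := isLocallyFiniteMeasure_volMeasure hvol
  exact hasDerivAt_integral_of_compact (contMDiff_jetDensity hvol hL hJ) hJ.compact
    hJ.jetDensity_const hint

/-- `φ` is critical with respect to variations supported in the members of some open cover. -/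
def IsLocallyCritical (vol : DForm (X m) M m) (L : J1 B → ℝ)
    (φ : SmoothSection m (X m × X n) B.proj) : Prop :=
  ∀ x₀ : M, ∃ U : Set M, IsOpen U ∧ x₀ ∈ U ∧ ∀ (J : ℝ → M → J1 B) (K : Set M),
    IsJetFamily J K → J 0 = j1 φ → K ⊆ U → ∫ x, firstVar vol L J x ∂(volMeasure vol) = 0

/-- The first variation at $j^1\phi$ is linear in $\eta$. A partition of unity on $K$ splits $\eta$
into $\sum_i\rho_i\eta$, each summand being realised by a time-rescaled family supported in one of
the sets where criticality is known. -/
theorem IsLocallyCritical.integral_eq_zero (hvol : IsVolumeForm vol)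
    (hL : ContMDiff 𝓘(ℝ, (X m × X n) × (X m →L[ℝ] X n)) 𝓘(ℝ, ℝ) ∞ L)
    (hφ : IsLocallyCritical vol L φ) (hJ : IsJetFamily J K) (h0 : J 0 = j1 φ) :
    ∫ x, firstVar vol L J x ∂(volMeasure vol) = 0 := by
  have : LocallyCompactSpace M := ChartedSpace.locallyCompactSpace (X m) M
  choose U hUo hxU hU using hφ
  obtain ⟨s, hs⟩ := hJ.compact.elim_finite_subcover U hUo
    fun x _ => Set.mem_iUnion.2 ⟨x, hxU x⟩
  obtain ⟨ρ, hρ⟩ := SmoothPartitionOfUnity.exists_isSubordinate 𝓘(ℝ, X m) hJ.compact.isClosed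
    (fun i : s => U i) (fun i => hUo i) (hs.trans fun x hx => by simpa using hx)
  have hρs : ∀ i, ContMDiff 𝓘(ℝ, X m) 𝓘(ℝ, ℝ) ∞ (ρ i) := fun i => (ρ i).contMDiff
  have hsum : ∀ x, firstVar vol L J x
      = ∑ i : s, firstVar vol L (fun t => j1 (hJ.scale (hρs i) t)) x := by
    intro x
    obtain ⟨a, ha⟩ := B.exists_adaptedChart (φ.toFun x)
    have ha' : (J 0 x).proj ∈ a.e.source := by rw [h0]; exact ha
    have hxs := hJ.mem_source ha'
    rw [firstVar_holonomic hvol hL hJ h0 ha]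
    have h1 : ∀ i : s, firstVar vol L (fun t => j1 (hJ.scale (hρs i) t)) x
        = linL L a (j1 φ x) (fun x => ρ i x • varCoord a J x) x := fun i => by
      rw [firstVar_holonomic hvol hL (hJ.isJetFamily_scale (hρs i)) (hJ.scale_zero h0 (hρs i)) ha]
      refine linL_congr hxs ?_
      filter_upwards [φ.smooth.continuous.continuousAt.preimage_mem_nhds
        (a.e.open_source.mem_nhds ha)] with z hz
      exact hJ.varCoord_scale (hρs i) (by rw [h0]; exact hz)
    simp only [h1]
    rw [← linL_sum]
    · congr 1
      funext z
      -- The functions $\rho_i$ are known to add up to $1$ only on $K$; off $K$ the variation itself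
      -- vanishes.
      by_cases hz : z ∈ K
      · rw [← Finset.sum_smul, ← finsum_eq_sum_of_fintype, ρ.sum_eq_one hz, one_smul]
      · simp [hJ.varCoord_eq_zero hz]
    · intro i _
      have h2 : DifferentiableAt ℝ (fun u => ρ i (a.c.symm u)) (a.c x) := by
        have h3 := ContMDiffAt.comp (a.c x) ((hρs i) _)
          (a.c_symm_smooth.contMDiffAt (a.c.open_target.mem_nhds (a.c.map_source hxs)))
        exact h3.contDiffAt.differentiableAt (by simp)
      exact h2.smul ((contDiffAt_varCoord hJ ha').differentiableAt (by simp))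
  simp only [hsum]
  rw [integral_finsetSum _ fun i _ => integrable_firstVar hvol hL (hJ.isJetFamily_scale (hρs i))]
  refine Finset.sum_eq_zero fun i _ => ?_
  exact hU i _ _ (hJ.isJetFamily_scale (hρs i)) (hJ.scale_zero h0 (hρs i))
    (Set.inter_subset_right.trans (hρ i))

/-- It is enough to test criticality with variations along the coordinate fields of a chart. -/
theorem isLocallyCritical_of_coordinates (hvol : IsVolumeForm vol)
    (hL : ContMDiff 𝓘(ℝ, (X m × X n) × (X m →L[ℝ] X n)) 𝓘(ℝ, ℝ) ∞ L)
    (h : ∀ x₀ : M, ∃ a : AdaptedChart B, φ.toFun x₀ ∈ a.e.source ∧ ∀ A : Fin n, ∃ U : Set M,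
      IsOpen U ∧ x₀ ∈ U ∧ ∀ η : M → ℝ, ContMDiff 𝓘(ℝ, X m) 𝓘(ℝ, ℝ) ∞ η → HasCompactSupport η →
        tsupport η ⊆ U → ∃ J : ℝ → M → J1 B, IsJetFamily J (tsupport η) ∧ J 0 = j1 φ ∧
          (∀ x ∈ U, varCoord a J x = η x • stdB A) ∧
          ∫ x, firstVar vol L J x ∂(volMeasure vol) = 0) :
    IsLocallyCritical vol L φ := by
  intro x₀
  obtain ⟨a, ha, h⟩ := h x₀
  choose U hUo hxU hU using h
  have hVo : IsOpen (φ.toFun ⁻¹' a.e.source) := a.e.open_source.preimage φ.smooth.continuous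
  refine ⟨φ.toFun ⁻¹' a.e.source ∩ ⋂ A, U A, hVo.inter (isOpen_iInter_of_finite hUo),
    ⟨ha, Set.mem_iInter.2 hxU⟩, fun J K hJ h0 hK => ?_⟩
  have hKe : ∀ x ∈ K, (J 0 x).proj ∈ a.e.source := fun x hx => by rw [h0]; exact (hK hx).1
  -- The chart components of the variation are smooth on all of $M$: $K$ lies over the chart, and
  -- they vanish off $K$. They can therefore serve as the test functions $\eta$.
  have hv := hJ.contMDiff_varCoord hKe
  have hη : ∀ A : Fin n, ContMDiff 𝓘(ℝ, X m) 𝓘(ℝ, ℝ) ∞ (fun x => varCoord a J x A) := fun A =>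
    ((EuclideanSpace.proj A : X n →L[ℝ] ℝ).contDiff.contMDiff).comp hv
  have hηK : ∀ A : Fin n, tsupport (fun x => varCoord a J x A) ⊆ K := fun A =>
    closure_minimal (fun x hx => by
      by_contra hxK
      exact hx (by simp [hJ.varCoord_eq_zero hxK])) hJ.compact.isClosed
  have hηc : ∀ A : Fin n, HasCompactSupport (fun x => varCoord a J x A) := fun A =>
    hJ.compact.of_isClosed_subset (isClosed_tsupport _) (hηK A)
  choose I hI hI0 hIv hIi using fun A => hU A _ (hη A) (hηc A)
    ((hηK A).trans (hK.trans (Set.inter_subset_right.trans (Set.iInter_subset _ A))))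
  -- On $K$ this is linearity, since the families $I_A$ realise the components of the variation of
  -- $J$; off $K$ all the terms vanish.
  have hsum : ∀ x, firstVar vol L J x = ∑ A, firstVar vol L (I A) x := by
    intro x
    by_cases hx : x ∈ K
    · have hxe : φ.toFun x ∈ a.e.source := (hK hx).1
      have hxs := hJ.mem_source (hKe x hx)
      rw [firstVar_holonomic hvol hL hJ h0 hxe]
      have h1 : ∀ A, firstVar vol L (I A) x
          = linL L a (j1 φ x) (fun x => varCoord a J x A • stdB A) x := fun A => by
        rw [firstVar_holonomic hvol hL (hI A) (hI0 A) hxe]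
        refine linL_congr hxs ?_
        filter_upwards [(hUo A).mem_nhds (Set.mem_iInter.1 (hK hx).2 A)] with z hz
        exact hIv A z hz
      simp only [h1]
      rw [← linL_sum]
      · congr 1
        funext z
        conv_lhs => rw [← (EuclideanSpace.basisFun (Fin n) ℝ).sum_repr (varCoord a J z)]
        refine Finset.sum_congr rfl fun A _ => ?_
        simp
      · intro A _
        have h2 := (contDiffAt_varCoord hJ (hKe x hx)).differentiableAt (by simp)
        exact ((EuclideanSpace.proj A : X n →L[ℝ] ℝ).differentiableAt.comp _ h2).smul_const _
    · rw [hJ.firstVar_eq_zero hx]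
      exact (Finset.sum_eq_zero fun A _ => (hI A).firstVar_eq_zero fun h => hx (hηK A h)).symm
  simp only [hsum]
  rw [integral_finsetSum _ fun A _ => integrable_firstVar hvol hL (hI A)]
  exact Finset.sum_eq_zero fun A _ => hIi A

end Critical


/-! ### Vertical flows move a section only over a compact set. -/

section Flows

variable {m : ℕ} {M : Type*} [TopologicalSpace M] [ChartedSpace (X m) M]
  {K P : Type*} [NormedAddCommGroup K] [NormedSpace ℝ K] [CompleteSpace K] [TopologicalSpace P]
  [ChartedSpace K P] [IsManifold 𝓘(ℝ, K) ∞ P] {p : P → M}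
  {Z : ∀ q : P, TangentSpace 𝓘(ℝ, K) q} {σ : ℝ → P → P}

/-- A flow fixes the zeros of its velocity. -/
theorem IsVerticalFlow.fixed [T2Space P] (hσ : IsVerticalFlow m p Z σ) {q : P} (hq : Z q = 0)
    (t : ℝ) : σ t q = q := by
  have : IsManifold 𝓘(ℝ, K) 1 P := IsManifold.of_le (n := ∞) (by simp)
  have h := isMIntegralCurve_Ioo_eq_of_contMDiff_boundaryless (t₀ := 0)
    (hσ.smooth.of_le (by simp)) (hσ.flow_integral q) (isMIntegralCurve_const hq) (hσ.flow_zero q)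
  exact congrFun h t

/-- The image under $p$ of the support of the field serves: over any other point the section meets
only zeros of the field, which the flow fixes. -/
theorem IsVerticalFlow.exists_compact [T2Space P] (hσ : IsVerticalFlow m p Z σ)
    (hp : Continuous p) (s : SmoothSection m K p) :
    ∃ C : Set M, IsCompact C ∧ ∀ x ∉ C, ∀ t, σ t (s.toFun x) = s.toFun x := by
  obtain ⟨C, hC, hZ⟩ := hσ.compact_support
  refine ⟨p '' C, hC.image hp, fun x hx t => hσ.fixed (hZ _ fun h => hx ⟨_, h, s.proj_toFun x⟩) t⟩

end Flows

/-! ### The two principles and local criticality. -/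

section Principles

variable {m n : ℕ} {M E F : Type*}
  [TopologicalSpace M] [ChartedSpace (X m) M] [IsManifold 𝓘(ℝ, X m) ∞ M]
  [TopologicalSpace E] [ChartedSpace (X m × X n) E] [IsManifold 𝓘(ℝ, X m × X n) ∞ E]
  [TopologicalSpace F] [ChartedSpace (X n) F] [IsManifold 𝓘(ℝ, X n) ∞ F]
  {B : ConfigBundle m n M E F} {L : J1 B → ℝ} {a : AdaptedChart B} {vol : DForm (X m) M m}
  {K : Set M} {x : M} {φ : SmoothSection m (X m × X n) B.proj}
  {ψ : SmoothSection m ((X m × X n) × (Fin m → (X n →L[ℝ] ℝ))) (restProj B)}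

theorem AdaptedChart.proj_eq (a : AdaptedChart B) {y y' : E} (h : y ∈ a.e.source)
    (h' : y' ∈ a.e.source) (he : (a.e y').1 = (a.e y).1) : B.proj y' = B.proj y := by
  rw [a.fst_e _ h, a.fst_e _ h'] at he
  exact a.c.injOn (a.mapsTo _ h') (a.mapsTo _ h) he

theorem contMDiff_restProj :
    ContMDiff 𝓘(ℝ, (X m × X n) × (Fin m → (X n →L[ℝ] ℝ))) 𝓘(ℝ, X m) ∞ (restProj B) :=
  B.contMDiff_proj.comp (restMomCoords B).contMDiff_proj

section Lagrangian

variable {Z : ∀ y : E, TangentSpace 𝓘(ℝ, X m × X n) y} {σ : ℝ → E → E}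

theorem isJetFamily_vary [T2Space M] (hσ : IsVerticalFlow m B.proj Z σ) (hK : IsCompact K)
    (hfix : ∀ x ∉ K, ∀ t, σ t (φ.toFun x) = φ.toFun x) :
    IsJetFamily (fun t => j1 (φ.vary hσ t)) K where
  smooth := contMDiff_j1_family (φ := φ.vary hσ) (hσ.flow_smooth.comp
    (contMDiff_fst.prodMk (φ.smooth.comp contMDiff_snd)))
  proj t := (φ.vary hσ t).proj_toFun
  compact := hK
  const x hx t := by
    refine j1_congr ?_
    filter_upwards [hK.isClosed.isOpen_compl.mem_nhds hx] with z hz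
    exact (hfix z hz t).trans (hfix z hz 0).symm

theorem j1_vary_zero (hσ : IsVerticalFlow m B.proj Z σ) : j1 (φ.vary hσ 0) = j1 φ :=
  funext fun _ => j1_congr (Filter.Eventually.of_forall fun _ => hσ.flow_zero _)

end Lagrangian

section Hamiltonian

variable {Z : ∀ q : RestMom B, TangentSpace 𝓘(ℝ, (X m × X n) × (Fin m → (X n →L[ℝ] ℝ))) q}
  {σ : ℝ → RestMom B → RestMom B}

/-- The section of `π` underlying a section of `τ̄`. -/
def SmoothSection.base (ψ : SmoothSection m ((X m × X n) × (Fin m → (X n →L[ℝ] ℝ))) (restProj B)) :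
    SmoothSection m (X m × X n) B.proj where
  toFun x := (ψ.toFun x).proj
  smooth := (restMomCoords B).contMDiff_proj.comp ψ.smooth
  proj_toFun := ψ.proj_toFun

/-- $FL^{-1}$ turns a variation of $\psi$ in $J^1\pi^*$ into a family of sections of $J^1\pi\to M$,
in general not holonomic. -/
theorem isJetFamily_restVary (H : IsHyperRegular vol L) (hσ : IsVerticalFlow m (restProj B) Z σ)
    (hK : IsCompact K) (hfix : ∀ x ∉ K, ∀ t, σ t (ψ.toFun x) = ψ.toFun x) :
    IsJetFamily (fun t x => H.choose.symm ((ψ.vary hσ t).toFun x)) K where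
  smooth := H.choose.symm.contMDiff.comp (hσ.flow_smooth.comp
    (contMDiff_fst.prodMk (ψ.smooth.comp contMDiff_snd)))
  proj t x := (congrArg B.proj (proj_hamiltonian H _)).trans ((ψ.vary hσ t).proj_toFun x)
  compact := hK
  const x hx t := congrArg H.choose.symm ((hfix x hx t).trans (hfix x hx 0).symm)

theorem restVary_zero (H : IsHyperRegular vol L) (hσ : IsVerticalFlow m (restProj B) Z σ) :
    (fun x => H.choose.symm ((ψ.vary hσ 0).toFun x)) = fun x => H.choose.symm (ψ.toFun x) :=
  funext fun _ => congrArg H.choose.symm (hσ.flow_zero _)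

/-- A fixed section counts as a family with empty support, so the local regularity statements for
families apply to it. -/
theorem isJetFamily_const (H : IsHyperRegular vol L) :
    IsJetFamily (fun _ x => H.choose.symm (ψ.toFun x)) ∅ where
  smooth := H.choose.symm.contMDiff.comp (ψ.smooth.comp contMDiff_snd)
  proj _ x := (congrArg B.proj (proj_hamiltonian H _)).trans (ψ.proj_toFun x)
  compact := isCompact_empty
  const _ _ _ := rfl

theorem hasDerivAt_locMom (hL : ContMDiff 𝓘(ℝ, (X m × X n) × (X m →L[ℝ] X n)) 𝓘(ℝ, ℝ) ∞ L)
    {J : ℝ → M → J1 B} (hJ : IsJetFamily J K) (h : (J 0 x).proj ∈ a.e.source) :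
    HasDerivAt (fun t => locMom L a (a.jetCoord (J t x)))
      (deriv (fun t => locMom L a (a.jetCoord (J t x))) 0) 0 := by
  have hG := hasDerivAt_slice ((contDiffAt_locJ hJ h).differentiableAt (by simp))
  have h1 := (((contDiffAt_locMom_locJ hL hJ h).differentiableAt
    (by simp)).hasFDerivAt.comp_hasDerivAt (0 : ℝ) hG)
  have h2 : ((locMom L a) ∘ fun s => locJ a J (s, a.c x))
      = fun t => locMom L a (a.jetCoord (J t x)) := by
    simp only [Function.comp_def, locJ, a.c.left_inv (hJ.mem_source h)]
  rw [h2] at h1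
  rw [h1.deriv]
  exact h1

end Hamiltonian

variable [T2Space M] [SecondCountableTopology M] [Nonempty M] [MeasurableSpace M] [BorelSpace M]

open MeasureTheory

/-- Flows along $\partial/\partial y^A$ with velocity $\eta$ realise the coordinate variations. The
derivative of the action is $0$ by the principle and the integral of the first variation by
differentiation under the integral; uniqueness of derivatives equates them. -/
theorem HamiltonPrinciple.isLocallyCritical [T2Space E] (hvol : IsVolumeForm vol)
    (hL : ContMDiff 𝓘(ℝ, (X m × X n) × (X m →L[ℝ] X n)) 𝓘(ℝ, ℝ) ∞ L)
    (h : HamiltonPrinciple vol L φ) : IsLocallyCritical vol L φ := by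
  refine isLocallyCritical_of_coordinates hvol hL fun x₀ => ?_
  obtain ⟨a, ha⟩ := B.exists_adaptedChart (φ.toFun x₀)
  refine ⟨a, ha, fun A => ?_⟩
  obtain ⟨U, hUo, hxU, hUs, hU⟩ := exists_verticalFlow_tangent B.contMDiff_proj φ a.e a.e_smooth
    a.e_symm_smooth (w := (0, stdB A))
    (ℓ := (EuclideanSpace.proj A : X n →L[ℝ] ℝ).comp (ContinuousLinearMap.snd ℝ (X m) (X n)))
    (by simp) (fun q hq q' hq' c hc => a.proj_eq hq hq' (by rw [hc]; simp)) ha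
  refine ⟨U, hUo, hxU, fun η hη hc hs => ?_⟩
  obtain ⟨Z, σ, hσ, h1, h2⟩ := hU η hη hs
  have hJ := isJetFamily_vary hσ hc h2
  refine ⟨_, hJ, j1_vary_zero hσ, fun x hx => ?_, ?_⟩
  · have h3 := (ContinuousLinearMap.snd ℝ (X m) (X n)).hasFDerivAt.comp_hasDerivAt (0 : ℝ) (h1 x hx).2
    exact h3.deriv
  · have h3 := h.2 Z σ hσ
    simp only [formIntegral, formDensity_poincareCartan] at h3
    have h4 := h.1
    rw [FormIntegrable, formDensity_poincareCartan, ← j1_vary_zero hσ] at h4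
    exact (hasDerivAt_integral_jetDensity hvol hL hJ h4).unique h3

theorem HamiltonJacobiPrinciple.integral_eq_zero (hvol : IsVolumeForm vol)
    (hL : ContMDiff 𝓘(ℝ, (X m × X n) × (X m →L[ℝ] X n)) 𝓘(ℝ, ℝ) ∞ L) (H : IsHyperRegular vol L)
    (h : HamiltonJacobiPrinciple vol (hamiltonianSection H) ψ)
    {Z : ∀ q : RestMom B, TangentSpace 𝓘(ℝ, (X m × X n) × (Fin m → (X n →L[ℝ] ℝ))) q}
    {σ : ℝ → RestMom B → RestMom B} (hσ : IsVerticalFlow m (restProj B) Z σ)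
    (hK : IsCompact K) (hfix : ∀ x ∉ K, ∀ t, σ t (ψ.toFun x) = ψ.toFun x) :
    ∫ x, firstVar vol L (fun t x => H.choose.symm ((ψ.vary hσ t).toFun x)) x ∂(volMeasure vol)
      = 0 := by
  have h3 := h.2 Z σ hσ
  simp only [formIntegral, formDensity_hamiltonCartan hvol hL H (SmoothSection.smooth _)] at h3
  have h4 := h.1
  rw [FormIntegrable, formDensity_hamiltonCartan hvol hL H ψ.smooth, ← restVary_zero H hσ] at h4
  exact (hasDerivAt_integral_jetDensity hvol hL (isJetFamily_restVary H hσ hK hfix) h4).unique h3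

/-- When the base does not vary, only the derivative of $\partial£/\partial v$ paired with $A-v$ is
left. The coordinates of $J^1\pi^*$ are $g\,\partial£/\partial v$, so moving one momentum at rate
$c$ isolates one entry of $A-v$, divided by $g$. -/
theorem firstVar_momentum (hvol : IsVolumeForm vol)
    (hL : ContMDiff 𝓘(ℝ, (X m × X n) × (X m →L[ℝ] X n)) 𝓘(ℝ, ℝ) ∞ L)
    {J : ℝ → M → J1 B} (hJ : IsJetFamily J K) (hJ0 : (J 0 x).proj ∈ a.e.source)
    {c : ℝ} {ν : Fin m} {A : Fin n}
    (hy : ∀ᶠ z in 𝓝 x, varCoord a J z = 0)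
    (hp : HasDerivAt (fun t => (restMomCoords B).coord a (J t x).proj (legendre vol L (J t x)).snd)
      (c • Pi.single ν (EuclideanSpace.proj A : X n →L[ℝ] ℝ)) 0) :
    firstVar vol L J x = c * ((a.vertCoord (J 0 x).proj (velL (fun x => (J 0 x).proj) x)
      - (a.jetCoord (J 0 x)).2) (stdB ν) A / volCoeff vol a x) := by
  have hx := hJ.mem_source hJ0
  have hd := hasDerivAt_locMom hL hJ hJ0
  set p' := deriv (fun t => locMom L a (a.jetCoord (J t x))) 0 with hp'
  set C := a.vertCoord (J 0 x).proj (velL (fun x => (J 0 x).proj) x) - (a.jetCoord (J 0 x)).2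
    with hC
  have hg := volCoeff_ne_zero (a := a) hvol hx
  have hlin : linL L a (J 0 x) (varCoord a J) x = 0 :=
    (linL_congr hx hy).trans linL_zero
  have hev : ∀ᶠ t in 𝓝 (0 : ℝ), (J t x).proj ∈ a.e.source :=
    (hJ.smooth_base.continuous.comp (Continuous.prodMk_left x)).continuousAt.preimage_mem_nhds
      (a.e.open_source.mem_nhds hJ0)
  have hcoord : ∀ ν' w, volCoeff vol a x * p' (tens ν' w)
      = c * Pi.single (M := fun _ => X n →L[ℝ] ℝ) ν (EuclideanSpace.proj A) ν' w := by
    intro ν' w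
    have h1 : HasDerivAt (fun t => volCoeff vol a x * locMom L a (a.jetCoord (J t x)) (tens ν' w))
        (volCoeff vol a x * p' (tens ν' w)) 0 := by
      have h0 := hd.clm_apply (hasDerivAt_const (0 : ℝ) (tens ν' w : X m →L[ℝ] X n))
      rw [map_zero, add_zero] at h0
      exact h0.const_mul _
    have h2 : HasDerivAt (fun t => (restMomCoords B).coord a (J t x).proj
        (legendre vol L (J t x)).snd ν' w)
        (c * Pi.single (M := fun _ => X n →L[ℝ] ℝ) ν (EuclideanSpace.proj A) ν' w) 0 :=
      ((ContinuousLinearMap.apply ℝ ℝ w).comp (ContinuousLinearMap.proj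
        (φ := fun _ : Fin m => X n →L[ℝ] ℝ) ν')).hasFDerivAt.comp_hasDerivAt (0 : ℝ) hp
    refine (h1.congr_of_eventuallyEq ?_).unique h2
    filter_upwards [hev] with t ht
    refine (legendre_coord hL ht ν' w).trans ?_
    rw [hJ.proj]
  -- Expanding $A-v$ in elementary tensors, all momentum derivatives vanish except the one in place
  -- $\nu$.
  have hsum : volCoeff vol a x * p' C = c * C (stdB ν) A := by
    conv_lhs => rw [← sum_tens C, map_sum, Finset.mul_sum]
    simp only [hcoord]
    rw [Finset.sum_eq_single ν]
    · simp
    · intro ν' _ hν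
      simp [Pi.single_eq_of_ne hν]
    · simp
  rw [firstVar_eq hvol hL hJ hJ0, hlin, zero_add, mul_div_assoc', eq_div_iff hg, ← hsum, mul_comm]

/-- A solution of the Hamilton–Jacobi principle is the Legendre transform of a holonomic section. -/
theorem HamiltonJacobiPrinciple.holonomic [T2Space E] (hvol : IsVolumeForm vol)
    (hL : ContMDiff 𝓘(ℝ, (X m × X n) × (X m →L[ℝ] X n)) 𝓘(ℝ, ℝ) ∞ L) (H : IsHyperRegular vol L)
    (h : HamiltonJacobiPrinciple vol (hamiltonianSection H) ψ) :
    (fun x => H.choose.symm (ψ.toFun x)) = j1 ψ.base := by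
  have := isLocallyFiniteMeasure_volMeasure hvol
  have := isOpenPosMeasure_volMeasure hvol
  have : LocallyCompactSpace M := ChartedSpace.locallyCompactSpace (X m) M
  have : T2Space (RestMom B) := (restMomCoords B).t2Space
  funext x₀
  obtain ⟨a, ha⟩ := B.exists_adaptedChart (ψ.toFun x₀).proj
  let J₀ : ℝ → M → J1 B := fun _ x => H.choose.symm (ψ.toFun x)
  have hJ₀ : IsJetFamily J₀ ∅ := isJetFamily_const H
  have hbase : (fun x => (J₀ 0 x).proj) = ψ.base.toFun := funext fun x => proj_hamiltonian H _
  -- The defect $A-v$ from being holonomic, to be shown to vanish at $x_0$.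
  let C : M → (X m →L[ℝ] X n) := fun x =>
    a.vertCoord (J₀ 0 x).proj (velL (fun x => (J₀ 0 x).proj) x) - (a.jetCoord (J₀ 0 x)).2
  have hJa : (J₀ 0 x₀).proj ∈ a.e.source := (congrFun hbase x₀).symm ▸ ha
  have hxs := hJ₀.mem_source (t := 0) hJa
  have hopen : IsOpen {x | (J₀ 0 x).proj ∈ a.e.source} :=
    a.e.open_source.preimage (hJ₀.toSection 0).smooth.continuous
  have hCc : ContinuousAt C x₀ := by
    have h1 : ContinuousAt (fun z => locA a (fun t x => (J₀ t x).proj) z - (locJ a J₀ z).2)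
        ((0 : ℝ), a.c x₀) :=
      (contDiffAt_locA (a := a) (Y := fun t x => (J₀ t x).proj) hJ₀.smooth_base (hJ₀.proj 0 x₀)
        hJa).continuousAt.sub (contDiffAt_locJ hJ₀ hJa).continuousAt.snd
    have h2 : ContinuousAt (fun x => ((0 : ℝ), a.c x)) x₀ :=
      continuousAt_const.prodMk (a.c.continuousAt hxs)
    refine (ContinuousAt.comp (f := fun x => ((0 : ℝ), a.c x)) (x := x₀) h1 h2).congr ?_
    filter_upwards [hopen.mem_nhds hJa] with x hx
    have h3 := vertCoord_family (a := a) (t := 0) (Y := fun t x => (J₀ t x).proj) hJ₀.smooth_base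
      (hJ₀.proj 0 x) hx
    simp only [Function.comp_apply, C]
    rw [h3, locJ_eq hJ₀ hx]
  have hzero : ∀ ν A, C x₀ (stdB ν) A = 0 := by
    intro ν A
    by_contra hne
    let g : M → ℝ := fun x => C x (stdB ν) A / volCoeff vol a x
    have hgc : ContinuousAt g x₀ :=
      ((EuclideanSpace.proj A : X n →L[ℝ] ℝ).continuous.continuousAt.comp
        (hCc.clm_apply continuousAt_const)).div (contMDiffAt_volCoeff hvol hxs).continuousAt
        (volCoeff_ne_zero hvol hxs)
    have hg0 : g x₀ ≠ 0 := div_ne_zero hne (volCoeff_ne_zero hvol hxs)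
    -- Multiplying by $g(x_0)$ treats both signs of $g(x_0)$ at once.
    have hpos : ∀ᶠ x in 𝓝 x₀, 0 < g x₀ * g x :=
      (continuousAt_const.mul hgc).eventually (lt_mem_nhds (mul_self_pos.2 hg0))
    -- The direction of the single momentum $p^\nu_A$; the point of $E$ stays fixed along it.
    let w : (X m × X n) × (Fin m → (X n →L[ℝ] ℝ)) :=
      (0, Pi.single ν (EuclideanSpace.proj A))
    let ℓ : ((X m × X n) × (Fin m → (X n →L[ℝ] ℝ))) →L[ℝ] ℝ :=
      ((ContinuousLinearMap.apply ℝ ℝ (stdB A : X n)).comp (ContinuousLinearMap.proj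
        (φ := fun _ : Fin m => X n →L[ℝ] ℝ) ν)).comp (ContinuousLinearMap.snd ℝ _ _)
    have hw : ℓ w = 1 := by simp [ℓ, w]
    set e := (restMomCoords B).homeo (ψ.toFun x₀) a with he
    have hvert : ∀ q ∈ e.source, ∀ q' ∈ e.source, ∀ c : ℝ, e q' = e q + c • w →
        restProj B q' = restProj B q := fun q hq q' hq' c hc =>
      a.proj_eq hq hq' ((congrArg (fun z => z.1.1) hc).trans (by simp [w]; rfl))
    obtain ⟨U, hUo, hxU, hUs, hU⟩ := exists_verticalFlow_tangent contMDiff_restProj ψ e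
      ((restMomCoords B).contMDiffOn_homeo _ a) ((restMomCoords B).contMDiffOn_homeo_symm _ a)
      hw hvert (x₀ := x₀) ha
    -- The bump is supported where the test flow is available and where $g$ keeps the sign of
    -- $g(x_0)$.
    obtain ⟨η, -, hη⟩ := (SmoothBumpFunction.nhds_basis_tsupport (I := 𝓘(ℝ, X m)) x₀).mem_iff.1
      (Filter.inter_mem (hUo.mem_nhds hxU) hpos)
    obtain ⟨Z, σ, hσ, h1, h2⟩ := hU η η.contMDiff (hη.trans Set.inter_subset_left)
    have hJ := isJetFamily_restVary (ψ := ψ) H hσ η.hasCompactSupport h2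
    have hint := h.integral_eq_zero hvol hL H hσ η.hasCompactSupport h2
    set J : ℝ → M → J1 B := fun t x => H.choose.symm ((ψ.vary hσ t).toFun x) with hJdef
    have hJ0 : J 0 = J₀ 0 := restVary_zero H hσ
    have hvar : ∀ x ∈ U, HasDerivAt (fun t => e (legendre vol L (J t x))) (η x • w) 0 := by
      intro x hx
      have h3 : (fun t => e (legendre vol L (J t x))) = fun t => e (σ t (ψ.toFun x)) :=
        funext fun t => congrArg e (legendre_symm H _)
      rw [h3]
      exact (h1 x hx).2
    have hf : ∀ x ∈ U, firstVar vol L J x = η x * g x := by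
      intro x hx
      have hxa : (J 0 x).proj ∈ a.e.source := by
        rw [hJ0]
        change (H.choose.symm (ψ.toFun x)).proj ∈ a.e.source
        rw [proj_hamiltonian]
        exact hUs x hx
      have hy : ∀ᶠ z in 𝓝 x, varCoord a J z = 0 := by
        filter_upwards [hUo.mem_nhds hx] with z hz
        have h4 := ((ContinuousLinearMap.snd ℝ (X m) (X n)).comp (ContinuousLinearMap.fst ℝ
          (X m × X n) (Fin m → (X n →L[ℝ] ℝ)))).hasFDerivAt.comp_hasDerivAt (0 : ℝ) (hvar z hz)
        refine h4.deriv.trans ?_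
        simp [w]
      have hp := (ContinuousLinearMap.snd ℝ (X m × X n)
        (Fin m → (X n →L[ℝ] ℝ))).hasFDerivAt.comp_hasDerivAt (0 : ℝ) (hvar x hx)
      have h5 := firstVar_momentum (c := η x) (ν := ν) (A := A) hvol hL hJ hxa hy hp
      rw [h5, hJ0]
    have hcont : Continuous fun x => g x₀ * firstVar vol L J x :=
      continuous_const.mul (hJ.continuous_firstVar hvol hL)
    have hnonneg : 0 ≤ fun x => g x₀ * firstVar vol L J x := by
      intro x
      by_cases hx : x ∈ tsupport η
      · change 0 ≤ g x₀ * firstVar vol L J x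
        rw [hf x (hη hx).1, mul_left_comm]
        exact mul_nonneg η.nonneg (le_of_lt (hη hx).2)
      · change 0 ≤ g x₀ * firstVar vol L J x
        rw [hJ.firstVar_eq_zero hx, mul_zero]
    have hne0 : g x₀ * firstVar vol L J x₀ ≠ 0 := by
      rw [hf x₀ hxU, η.eq_one, one_mul]
      exact mul_ne_zero hg0 hg0
    -- The integrand is continuous, nonnegative and nonzero at $x_0$, so its integral is positive as
    -- the measure charges open sets. This contradicts the Hamilton–Jacobi principle.
    have hlt := hcont.integral_pos_of_hasCompactSupport_nonneg_nonzero (μ := volMeasure vol)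
      (hJ.hasCompactSupport_firstVar.mul_left) hnonneg hne0
    rw [integral_const_mul, hint, mul_zero] at hlt
    exact lt_irrefl _ hlt
  have hC0 : C x₀ = 0 := by
    rw [← sum_tens (C x₀)]
    refine Finset.sum_eq_zero fun ν _ => ?_
    have : C x₀ (stdB ν) = 0 := by
      ext A
      exact hzero ν A
    rw [this]
    ext v
    simp
  -- The two jets lie over the same point of $E$ and $C(x_0)=0$ says that their fibre coordinates
  -- agree, so they are equal.
  have h1 : (jetCoords B).coord a (J₀ 0 x₀).proj (j1 (hJ₀.toSection 0) x₀).snd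
      = (jetCoords B).coord a (J₀ 0 x₀).proj (J₀ 0 x₀).snd := sub_eq_zero.1 hC0
  have h2 : j1 (hJ₀.toSection 0) x₀ = J₀ 0 x₀ := by
    have h3 := (jetCoords B).inv_coord a (J₀ 0 x₀).proj hJa (j1 (hJ₀.toSection 0) x₀).snd
    have h4 := (jetCoords B).inv_coord a (J₀ 0 x₀).proj hJa (J₀ 0 x₀).snd
    exact congrArg (Bundle.TotalSpace.mk (J₀ 0 x₀).proj) (h3.symm.trans ((congrArg _ h1).trans h4))
  refine h2.symm.trans (j1_congr (Filter.Eventually.of_forall fun x => congrFun hbase x))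

/-- Since $FL^{-1}\circ\psi$ is holonomic, flows of $J^1\pi^*$ along $\partial/\partial y^A$ give
admissible families starting at a first jet prolongation. $FL^{-1}$ covers the identity of $E$, so
their base variation is the prescribed one, whatever the fibre part does. -/
theorem HamiltonJacobiPrinciple.isLocallyCritical [T2Space E] (hvol : IsVolumeForm vol)
    (hL : ContMDiff 𝓘(ℝ, (X m × X n) × (X m →L[ℝ] X n)) 𝓘(ℝ, ℝ) ∞ L) (H : IsHyperRegular vol L)
    (h : HamiltonJacobiPrinciple vol (hamiltonianSection H) ψ) :
    IsLocallyCritical vol L ψ.base := by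
  have : T2Space (RestMom B) := (restMomCoords B).t2Space
  refine isLocallyCritical_of_coordinates hvol hL fun x₀ => ?_
  obtain ⟨a, ha⟩ := B.exists_adaptedChart (ψ.toFun x₀).proj
  refine ⟨a, ha, fun A => ?_⟩
  let w : (X m × X n) × (Fin m → (X n →L[ℝ] ℝ)) := ((0, stdB A), 0)
  let ℓ : ((X m × X n) × (Fin m → (X n →L[ℝ] ℝ))) →L[ℝ] ℝ :=
    ((EuclideanSpace.proj A : X n →L[ℝ] ℝ).comp (ContinuousLinearMap.snd ℝ (X m) (X n))).comp
      (ContinuousLinearMap.fst ℝ _ _)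
  have hw : ℓ w = 1 := by simp [ℓ, w]
  set e := (restMomCoords B).homeo (ψ.toFun x₀) a with he
  have hvert : ∀ q ∈ e.source, ∀ q' ∈ e.source, ∀ c : ℝ, e q' = e q + c • w →
      restProj B q' = restProj B q := fun q hq q' hq' c hc =>
    a.proj_eq hq hq' ((congrArg (fun z => z.1.1) hc).trans (by simp [w]; rfl))
  obtain ⟨U, hUo, hxU, hUs, hU⟩ := exists_verticalFlow_tangent contMDiff_restProj ψ e
    ((restMomCoords B).contMDiffOn_homeo _ a) ((restMomCoords B).contMDiffOn_homeo_symm _ a)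
    hw hvert (x₀ := x₀) ha
  refine ⟨U, hUo, hxU, fun η hη hc hs => ?_⟩
  obtain ⟨Z, σ, hσ, h1, h2⟩ := hU η hη hs
  refine ⟨_, isJetFamily_restVary (ψ := ψ) H hσ hc h2,
    (restVary_zero H hσ).trans (h.holonomic hvol hL H), fun x hx => ?_,
    h.integral_eq_zero hvol hL H hσ hc h2⟩
  have h3 : (fun t => (a.e (H.choose.symm ((ψ.vary hσ t).toFun x)).proj).2)
      = fun t => (e (σ t (ψ.toFun x))).1.2 :=
    funext fun t => congrArg (fun y => (a.e y).2) (proj_hamiltonian H _)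
  rw [varCoord, h3]
  have h4 := ((ContinuousLinearMap.snd ℝ (X m) (X n)).comp (ContinuousLinearMap.fst ℝ
    (X m × X n) (Fin m → (X n →L[ℝ] ℝ)))).hasFDerivAt.comp_hasDerivAt (0 : ℝ) (h1 x hx).2
  exact h4.deriv

theorem IsLocallyCritical.hamiltonPrinciple [T2Space E] (hvol : IsVolumeForm vol)
    (hL : ContMDiff 𝓘(ℝ, (X m × X n) × (X m →L[ℝ] X n)) 𝓘(ℝ, ℝ) ∞ L)
    (hφ : IsLocallyCritical vol L φ)
    (hint : Integrable (jetDensity vol L (j1 φ)) (volMeasure vol)) :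
    HamiltonPrinciple vol L φ := by
  refine ⟨by rwa [FormIntegrable, formDensity_poincareCartan], fun Z σ hσ => ?_⟩
  obtain ⟨C, hC, hfix⟩ := hσ.exists_compact B.contMDiff_proj.continuous φ
  have hJ := isJetFamily_vary hσ hC hfix
  simp only [formIntegral, formDensity_poincareCartan]
  have h1 := hasDerivAt_integral_jetDensity hvol hL hJ (by rwa [j1_vary_zero])
  rwa [hφ.integral_eq_zero hvol hL hJ (j1_vary_zero hσ)] at h1

/-- An arbitrary vertical flow on $J^1\pi^*$ yields, through $FL^{-1}$, a family of jets starting at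
$j^1\phi$, and criticality already covers families that are not holonomic for $t\ne 0$. -/
theorem IsLocallyCritical.hamiltonJacobiPrinciple [T2Space E] (hvol : IsVolumeForm vol)
    (hL : ContMDiff 𝓘(ℝ, (X m × X n) × (X m →L[ℝ] X n)) 𝓘(ℝ, ℝ) ∞ L) (H : IsHyperRegular vol L)
    (hφ : IsLocallyCritical vol L φ)
    (hint : Integrable (jetDensity vol L (j1 φ)) (volMeasure vol))
    (hψ : (fun x => H.choose.symm (ψ.toFun x)) = j1 φ) :
    HamiltonJacobiPrinciple vol (hamiltonianSection H) ψ := by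
  have : T2Space (RestMom B) := (restMomCoords B).t2Space
  refine ⟨by rwa [FormIntegrable, formDensity_hamiltonCartan hvol hL H ψ.smooth, hψ],
    fun Z σ hσ => ?_⟩
  obtain ⟨C, hC, hfix⟩ := hσ.exists_compact contMDiff_restProj.continuous ψ
  have hJ := isJetFamily_restVary H hσ hC hfix
  have h0 := (restVary_zero (ψ := ψ) H hσ).trans hψ
  simp only [formIntegral, formDensity_hamiltonCartan hvol hL H (SmoothSection.smooth _)]
  have h1 := hasDerivAt_integral_jetDensity hvol hL hJ (by rwa [h0])
  rwa [hφ.integral_eq_zero hvol hL hJ h0] at h1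

end Principles

end FieldTheory

end

/-! ### The equivalence theorem. -/

theorem mainTheorem3 {m n : ℕ} {M E F : Type*}
    [TopologicalSpace M] [ChartedSpace (X m) M] [IsManifold 𝓘(ℝ, X m) ∞ M]
    [T2Space M] [SecondCountableTopology M] [ConnectedSpace M]
    [MeasurableSpace M] [BorelSpace M]
    [TopologicalSpace E] [ChartedSpace (X m × X n) E] [IsManifold 𝓘(ℝ, X m × X n) ∞ E]
    [T2Space E] [SecondCountableTopology E]
    [TopologicalSpace F] [ChartedSpace (X n) F] [IsManifold 𝓘(ℝ, X n) ∞ F]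
    (B : ConfigBundle m n M E F) (vol : DForm (X m) M m) (hvol : IsVolumeForm vol)
    (L : J1 B → ℝ) (hL : ContMDiff 𝓘(ℝ, (X m × X n) × (X m →L[ℝ] X n)) 𝓘(ℝ, ℝ) ∞ L)
    (H : IsHyperRegular vol L) :
    (∀ φ : SmoothSection m (X m × X n) B.proj, HamiltonPrinciple vol L φ →
      ∃ ψ : SmoothSection m ((X m × X n) × (Fin m → (X n →L[ℝ] ℝ))) (restProj B),
        (∀ x, ψ.toFun x = legendre vol L (j1 φ x)) ∧
        HamiltonJacobiPrinciple vol (hamiltonianSection H) ψ) ∧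
    (∀ ψ : SmoothSection m ((X m × X n) × (Fin m → (X n →L[ℝ] ℝ))) (restProj B),
      HamiltonJacobiPrinciple vol (hamiltonianSection H) ψ →
      ∃ φ : SmoothSection m (X m × X n) B.proj,
        (∀ x, φ.toFun x = (ψ.toFun x).proj) ∧ HamiltonPrinciple vol L φ) := by
  refine ⟨fun φ hφ => ?_, fun ψ hψ => ?_⟩
  · have hint : MeasureTheory.Integrable (jetDensity vol L (j1 φ)) (volMeasure vol) := by
      have h := hφ.1
      rwa [FormIntegrable, formDensity_poincareCartan] at h
    have hsm := H.choose.contMDiff.comp (contMDiff_j1 φ)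
    rw [H.choose_spec] at hsm
    exact ⟨⟨fun x => legendre vol L (j1 φ x), hsm, φ.proj_toFun⟩, fun _ => rfl,
      (hφ.isLocallyCritical hvol hL).hamiltonJacobiPrinciple hvol hL H hint
        (funext fun x => symm_legendre H (j1 φ x))⟩
  -- Convergence of the Hamiltonian action passes to the Lagrangian one because, $FL^{-1}\circ\psi$
  -- being holonomic, the two densities coincide.
  · have hint : MeasureTheory.Integrable (jetDensity vol L (j1 ψ.base)) (volMeasure vol) := by
      have h := hψ.1
      rwa [FormIntegrable, formDensity_hamiltonCartan hvol hL H ψ.smooth,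
        hψ.holonomic hvol hL H] at h
    exact ⟨ψ.base, fun _ => rfl, (hψ.isLocallyCritical hvol hL H).hamiltonPrinciple hvol hL hint⟩
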